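/- Let $M$ be the random $n\times n$ matrix over $GF(2)$ in which, independently for each $j\in[n]$, column $j$ is the sum of the unit vector of row $j$ and the unit vectors of two random rows. These two rows are either chosen uniformly and independently from $[n]$ ("with replacement", so that coinciding entries cancel) or are two distinct uniformly random rows of $[n]\setminus\{j\}$ ("without replacement"); the statement holds in each of the two models. Let $\omega=\omega(n)\to\infty$ with $\omega=o(\sqrt n)$. For a square matrix over $GF(2)$ with $N$ rows, a \emph{dependency} is a nonempty set of rows whose sum is zero. It is \emph{fundamental} if no proper subset of it is a dependency, \emph{small} if it has at most $\omega(n)$ elements, and \emph{large} if its size lies in $J=\left[\tfrac N2-\sqrt{N\log N},\ \tfrac N2+\sqrt{N\log N}\right]$. A sequence $(B_1,\dots,B_k)$ of dependencies is \emph{simple} if $|B_{j_1}\oplus\cdots\oplus B_{j_l}|\in J$ for all $1\le l\le k$ and $j_1<\dots<j_l$, where $\oplus$ is the symmetric difference. The maximum number of large simple dependencies of the matrix is the largest $k$ for which it has a simple sequence of length $k$. Fix integers $h\ge 0$ and $0\le r\le m$, and put $k=h+r$. For $L\subseteq[n]$ let $\mathcal E_L$ be the event that $$M=\begin{pmatrix}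 S_L&0\\ C&M'\end{pmatrix}$$ (the rows and columns in $L$ being written first), where the $L\times L$ submatrix $S_L$ has exactly $m$ small fundamental dependencies, these are pairwise disjoint and have total size $|L|$, and the submatrix $M'$ on $[n]\setminus L$ has no small dependency and its maximum number of large simple dependencies is $k$. Then, as $n\to\infty$, uniformly over all $L\subseteq[n]$ with $\Pr(\mathcal E_L)>0$, $$\Pr\left(\text{the maximum number of large simple dependencies of } M \text{ is } h \,\middle|\, \mathcal E_L\right)\ \sim\ \genfrac{[}{]}{0pt}{}{m}{r}_2\left(\tfrac12\right)^{(h+r)(m-r)}\prod_{j=h+1}^{h+r}\left(1-\left(\tfrac12\right)^j\right),$$ where $\genfrac{[}{]}{0pt}{}{m}{r}_q=\prod_{i=0}^{r-1}\frac{q^{m-i}-1}{q^{i+1}-1}$ and empty products are $1$. -/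

import Mathlib

open Filter ProbabilityTheory

/-- The two ways of choosing the two random unit entries of a column. -/
inductive Sampling : Type
  | withReplacement
  | withoutReplacement

/-- The admissible choices of the random entries: in column `j` they lie in the rows `(e j).1` and
`(e j).2`.  With replacement they are arbitrary; without replacement they are two distinct rows,
both different from `j`. -/
def Sampling.choices (s : Sampling) (n : ℕ) : Set (Fin n → Fin n × Fin n) :=
  match s with
  | .withReplacement => Set.univ
  | .withoutReplacement => {e | ∀ j, (e j).1 ≠ j ∧ (e j).2 ≠ j ∧ (e j).1 ≠ (e j).2}

/-- The uniform distribution on the admissible choices. -/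
noncomputable def Sampling.law (s : Sampling) (n : ℕ) :
    MeasureTheory.Measure (Fin n → Fin n × Fin n) :=
  uniformOn (s.choices n)

/-- The `n × n` matrix over `GF(2)` given by the random choices: column `j` is the sum of the unit
vectors of the rows `j`, `(e j).1` and `(e j).2`, so that coinciding entries cancel. -/
def outMatrix {n : ℕ} (e : Fin n → Fin n × Fin n) : Matrix (Fin n) (Fin n) (ZMod 2) :=
  fun i j => (if i = j then 1 else 0) + (if i = (e j).1 then 1 else 0)
    + (if i = (e j).2 then 1 else 0)

section Dependencies

variable {ι : Type} [Fintype ι] [DecidableEq ι]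

/-- A nonempty set of rows of `M` whose sum is zero. -/
def IsDependency (M : Matrix ι ι (ZMod 2)) (S : Finset ι) : Prop :=
  S.Nonempty ∧ ∀ j, ∑ i ∈ S, M i j = 0

/-- A dependency that contains no smaller dependency. -/
def IsFundamental (M : Matrix ι ι (ZMod 2)) (S : Finset ι) : Prop :=
  IsDependency M S ∧ ∀ T, T ⊆ S → IsDependency M T → T = S

open Classical in
/-- The fundamental dependencies of `M` of size at most `w`. -/
noncomputable def smallFundamental (M : Matrix ι ι (ZMod 2)) (w : ℕ) : Finset (Finset ι) :=
  Finset.univ.filter fun S => IsFundamental M S ∧ S.card ≤ w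

/-- `ℓ` lies in the interval `[N/2 - √(N log N), N/2 + √(N log N)]`. -/
def IsLargeSize (N ℓ : ℕ) : Prop :=
  |(ℓ : ℝ) - (N : ℝ) / 2| ≤ Real.sqrt ((N : ℝ) * Real.log (N : ℝ))

/-- The symmetric difference of the sets `B i`, `i ∈ I`: the elements that lie in an odd number of
them. -/
def symmDiffOver {k : ℕ} (B : Fin k → Finset ι) (I : Finset (Fin k)) : Finset ι :=
  Finset.univ.filter fun x => Odd (I.filter fun i => x ∈ B i).card

/-- A simple sequence of large dependencies: all symmetric differences of one or more of its
members (in particular the members themselves) have large size. -/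
def IsSimpleSequence (M : Matrix ι ι (ZMod 2)) {k : ℕ} (B : Fin k → Finset ι) : Prop :=
  (∀ i, IsDependency M (B i)) ∧
    ∀ I : Finset (Fin k), I.Nonempty → IsLargeSize (Fintype.card ι) (symmDiffOver B I).card

/-- The maximum length of a simple sequence of large dependencies of `M` is `k`. -/
def HasMaxSimple (M : Matrix ι ι (ZMod 2)) (k : ℕ) : Prop :=
  IsGreatest {l : ℕ | ∃ B : Fin l → Finset ι, IsSimpleSequence M B} k

/-- The small fundamental dependencies of `M` are exactly `m` pairwise disjoint sets, whose total
size is the number of rows of `M`. -/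
def SplitsIntoSmallFundamental (M : Matrix ι ι (ZMod 2)) (w m : ℕ) : Prop :=
  (smallFundamental M w).card = m ∧
  (∀ S ∈ smallFundamental M w, ∀ T ∈ smallFundamental M w, S ≠ T → Disjoint S T) ∧
  ∑ S ∈ smallFundamental M w, S.card = Fintype.card ι

end Dependencies

/-- The hypothesis on `M`, for a set `L` of indices, with dependencies of size at most `w` counted
as small: the block of `M` with rows in `L` and columns outside `L` is zero; the block on `L` has
`m` small fundamental dependencies of total size `|L|`; the block on the complement of `L` has no
small dependency, and the maximum number of its large simple dependencies is `k`. -/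
def BlockHypothesis {n : ℕ} (M : Matrix (Fin n) (Fin n) (ZMod 2)) (L : Finset (Fin n))
    (w m k : ℕ) : Prop :=
  (∀ i ∈ L, ∀ j ∉ L, M i j = 0) ∧
  SplitsIntoSmallFundamental
    (M.submatrix (fun i : {i // i ∈ L} => i.val) (fun i : {i // i ∈ L} => i.val)) w m ∧
  (∀ S, IsDependency
      (M.submatrix (fun i : {i // i ∉ L} => i.val) (fun i : {i // i ∉ L} => i.val)) S →
    w < S.card) ∧
  HasMaxSimple (M.submatrix (fun i : {i // i ∉ L} => i.val) (fun i : {i // i ∉ L} => i.val)) k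

/-- The Gaussian coefficient `[m choose r]_q`, for `r ≤ m`. -/
noncomputable def gaussianCoeff (q : ℝ) (m r : ℕ) : ℝ :=
  ∏ i ∈ Finset.range r, (q ^ (m - i) - 1) / (q ^ (i + 1) - 1)

/-- The limiting probability, for `r ≤ m`. -/
noncomputable def pStar (h r m : ℕ) : ℝ :=
  gaussianCoeff 2 m r * (1 / 2 : ℝ) ^ ((h + r) * (m - r))
    * ∏ j ∈ Finset.Icc (h + 1) (h + r), (1 - (1 / 2 : ℝ) ^ j)

/-! Write K for the left kernel of the block M' off L and R for the right kernel of S_L. The small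
fundamental dependencies are a basis of the left kernel of S_L (`finrank_leftKer_block`), so dim R =
m. The event forces each column j of L to have one random row in its own dependency and the other
one, v(j), off L (`exists_inner`). Replacing v by any other choice off L preserves the event, so v
is uniform given everything else. A vector y off L extends to the left kernel of M exactly if y is
in K and the pullback y∘v lies in the row space of S_L, that is, is orthogonal to R
(`map_restrictOff_leftKer`). In bases of K and R, the second condition is a linear system given by
an m × dim K matrix over GF(2), and the extendable y form a space of dimension dim K minus its rank.

Suppose that all nonzero vectors of K have weight close to half of the rows. Then the maximum
numbers of large simple dependencies are dimensions (`hasMaxSimple_iff`): dim K = h + r, and M has h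
of them iff the matrix has rank r. A nontrivial Fourier coefficient of the random matrix factors
over the columns of L, and at least one factor is the normalised character sum of a nonzero vector
of K, which is small. So the matrix is nearly uniform (`card_preimage_sub_le`), and the proportion
of matrices of rank r is `pStar` (`card_finrank_span_eq`, `pStar_eq`).

The supposition has to be likely under the conditioning. The columns of L are independent of the
others, so only the event off L matters. There the columns follow the same model with N = n - |L|
rows, up to pairs that cancel inside L, which are negligible since |L| ≤ mω. First moments make
kernel vectors that are neither bounded in size nor close to N/2 unlikely (`pr_intermediate_le`);
this suffices once the conditioning event has probability bounded away from zero. The main work is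
therefore `exists_le_pr_good`: with probability at least a constant, the left kernel has dimension k
and all its nonzero vectors have weight near N/2.

For this, a set J of D columns is put aside. The other columns have a left kernel W of dimension at
least D. In expectation it has about 2^D vectors of weight near N/2 but only O((3/2)^D) small ones.
So for large D, with probability bounded below, dim W = D, small vectors are few, and every nonzero
small one meets J; the last point rests on a switching argument that avoids small closed sets
(`exists_le_pr_noClosedSet`). Choose a linear map from W to GF(2)^J that is the restriction to J on
small vectors and has a kernel of dimension k. A Fourier count on W shows that a constant proportion
of the row pairs realises each coordinate of this map (`Usable.colPr_ge`). If all columns of J do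
so, the left kernel is the kernel of the map, and it contains no nonzero small vector. -/

/-! ### Finite probability space of the random columns: union bounds, independence, resampling. -/

section Configurations

variable {ι : Type} [Fintype ι] [DecidableEq ι]

/-- The admissible pairs of random rows of column `j`. -/
def pairs (s : Sampling) (j : ι) : Finset (ι × ι) :=
  match s with
  | .withReplacement => Finset.univ
  | .withoutReplacement => Finset.univ.filter fun p => p.1 ≠ j ∧ p.2 ≠ j ∧ p.1 ≠ p.2

/-- The admissible choices of the random rows of all columns. -/
def configs (ι : Type) [Fintype ι] [DecidableEq ι] (s : Sampling) : Finset (ι → ι × ι) :=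
  Fintype.piFinset (pairs s)

/-- The number of admissible pairs of a column, for `N` rows. -/
def totalPairs (s : Sampling) (N : ℕ) : ℕ :=
  match s with
  | .withReplacement => N * N
  | .withoutReplacement => (N - 1) * (N - 2)

lemma card_pairs (s : Sampling) (j : ι) : (pairs s j).card = totalPairs s (Fintype.card ι) := by
  cases s with
  | withReplacement => simp [pairs, totalPairs]
  | withoutReplacement =>
    have h : pairs .withoutReplacement j = (Finset.univ.erase j).offDiag := by
      ext p; simp [pairs, Finset.mem_offDiag]
    rw [h, Finset.offDiag_card, Finset.card_erase_of_mem (Finset.mem_univ _), Finset.card_univ]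
    simp only [totalPairs]
    rw [show Fintype.card ι - 2 = Fintype.card ι - 1 - 1 by omega, Nat.mul_sub_one (_ - 1) (_ - 1)]

lemma card_configs (s : Sampling) :
    (configs ι s).card = totalPairs s (Fintype.card ι) ^ Fintype.card ι := by
  simp [configs, Fintype.card_piFinset, card_pairs]

lemma totalPairs_pos (s : Sampling) {N : ℕ} (hN : 3 ≤ N) : 0 < totalPairs s N := by
  cases s with
  | withReplacement => simp only [totalPairs]; positivity
  | withoutReplacement =>
    simp only [totalPairs]
    exact Nat.mul_pos (by omega) (by omega)

open Classical in
/-- The proportion of the admissible choices that satisfy `P`. -/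
noncomputable def pr (s : Sampling) (P : (ι → ι × ι) → Prop) : ℝ :=
  ((configs ι s).filter P).card / (configs ι s).card

open Classical in
/-- The proportion of the admissible pairs of column `j` that satisfy `Q`. -/
noncomputable def colPr (s : Sampling) (j : ι) (Q : ι × ι → Prop) : ℝ :=
  ((pairs s j).filter Q).card / (pairs s j).card

variable {s : Sampling} {P Q : (ι → ι × ι) → Prop}

lemma pr_def (s : Sampling) (P : (ι → ι × ι) → Prop) [DecidablePred P] :
    pr s P = ((configs ι s).filter P).card / (configs ι s).card := by
  unfold pr; congr!

lemma colPr_def (s : Sampling) (j : ι) (Q : ι × ι → Prop) [DecidablePred Q] :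
    colPr s j Q = ((pairs s j).filter Q).card / (pairs s j).card := by
  unfold colPr; congr!

lemma pr_nonneg : 0 ≤ pr s P := by unfold pr; positivity

lemma colPr_nonneg {j : ι} {Q : ι × ι → Prop} : 0 ≤ colPr s j Q := by unfold colPr; positivity

lemma pr_mono (h : ∀ e ∈ configs ι s, P e → Q e) : pr s P ≤ pr s Q := by
  classical
  rw [pr_def, pr_def]
  gcongr ?_ / _
  refine Nat.cast_le.2 (Finset.card_le_card fun e he => ?_)
  rw [Finset.mem_filter] at he ⊢
  exact ⟨he.1, h e he.1 he.2⟩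

lemma pr_congr (h : ∀ e ∈ configs ι s, P e ↔ Q e) : pr s P = pr s Q :=
  le_antisymm (pr_mono fun e he => (h e he).1) (pr_mono fun e he => (h e he).2)

lemma colPr_mono {j : ι} {Q Q' : ι × ι → Prop} (h : ∀ p ∈ pairs s j, Q p → Q' p) :
    colPr s j Q ≤ colPr s j Q' := by
  classical
  rw [colPr_def, colPr_def]
  gcongr ?_ / _
  refine Nat.cast_le.2 (Finset.card_le_card fun e he => ?_)
  rw [Finset.mem_filter] at he ⊢
  exact ⟨he.1, h e he.1 he.2⟩

lemma pr_or_le : pr s (fun e => P e ∨ Q e) ≤ pr s P + pr s Q := by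
  classical
  rw [pr_def, pr_def, pr_def, ← add_div]
  gcongr
  have : (configs ι s).filter (fun e => P e ∨ Q e)
      = (configs ι s).filter P ∪ (configs ι s).filter Q := Finset.filter_or _ _ _
  rw [this]
  exact_mod_cast Finset.card_union_le _ _

lemma pr_exists_le {κ : Type*} (I : Finset κ) (R : κ → (ι → ι × ι) → Prop) :
    pr s (fun e => ∃ i ∈ I, R i e) ≤ ∑ i ∈ I, pr s (R i) := by
  classical
  rw [pr_def]
  simp only [pr_def]
  rw [← Finset.sum_div]
  gcongr
  have : (configs ι s).filter (fun e => ∃ i ∈ I, R i e)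
      ⊆ I.biUnion fun i => (configs ι s).filter (R i) := by
    intro e he
    simp only [Finset.mem_filter, Finset.mem_biUnion] at he ⊢
    obtain ⟨he, i, hi, hR⟩ := he
    exact ⟨i, hi, he, hR⟩
  exact_mod_cast (Finset.card_le_card this).trans Finset.card_biUnion_le

lemma configs_card_pos (s : Sampling) (hN : 3 ≤ Fintype.card ι) : 0 < (configs ι s).card := by
  rw [card_configs]; exact pow_pos (totalPairs_pos s hN) _

lemma pairs_card_pos (s : Sampling) (j : ι) (hN : 3 ≤ Fintype.card ι) : 0 < (pairs s j).card := by
  rw [card_pairs]; exact totalPairs_pos s hN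

lemma pr_true (hN : 3 ≤ Fintype.card ι) : pr s (fun _ : ι → ι × ι => True) = 1 := by
  have := configs_card_pos (ι := ι) s hN
  simp only [pr, Finset.filter_true]
  field_simp

lemma colPr_true (hN : 3 ≤ Fintype.card ι) (j : ι) : colPr s j (fun _ => True) = 1 := by
  have := pairs_card_pos (ι := ι) s j hN
  simp only [colPr, Finset.filter_true]
  field_simp

lemma pr_not (hN : 3 ≤ Fintype.card ι) : pr s (fun e => ¬ P e) = 1 - pr s P := by
  classical
  have h := configs_card_pos (ι := ι) s hN
  have h2 := Finset.card_filter_add_card_filter_not (s := configs ι s) P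
  rw [pr_def, pr_def]
  rw [eq_sub_iff_add_eq, ← add_div, div_eq_one_iff_eq (by positivity)]
  rw [add_comm]
  exact_mod_cast h2

lemma colPr_not (hN : 3 ≤ Fintype.card ι) (j : ι) (Q : ι × ι → Prop) :
    colPr s j (fun p => ¬ Q p) = 1 - colPr s j Q := by
  classical
  have h := pairs_card_pos (ι := ι) s j hN
  have h2 := Finset.card_filter_add_card_filter_not (s := pairs s j) Q
  rw [colPr_def, colPr_def]
  rw [eq_sub_iff_add_eq, ← add_div, div_eq_one_iff_eq (by positivity)]
  rw [add_comm]
  exact_mod_cast h2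

/-- The columns are independent. -/
lemma pr_forall (R : ι → ι × ι → Prop) :
    pr s (fun e => ∀ j, R j (e j)) = ∏ j, colPr s j (R j) := by
  classical
  rw [pr_def]
  simp only [colPr_def]
  have h1 : (configs ι s).filter (fun e => ∀ j, R j (e j))
      = Fintype.piFinset fun j => (pairs s j).filter (R j) := by
    ext e
    simp only [configs, Finset.mem_filter, Fintype.mem_piFinset]
    exact ⟨fun h j => ⟨h.1 j, h.2 j⟩, fun h => ⟨fun j => (h j).1, fun j => (h j).2⟩⟩
  rw [Finset.prod_div_distrib, h1, configs, Fintype.card_piFinset, Fintype.card_piFinset]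
  push_cast
  rfl

lemma pr_forall_mem (hN : 3 ≤ Fintype.card ι) (J : Finset ι) (R : ι → ι × ι → Prop) :
    pr s (fun e => ∀ j ∈ J, R j (e j)) = ∏ j ∈ J, colPr s j (R j) := by
  classical
  rw [pr_forall (fun j p => j ∈ J → R j p), ← Finset.prod_subset (Finset.subset_univ J)]
  · refine Finset.prod_congr rfl fun j hj => ?_
    simp [hj]
  · intro j _ hj
    simp only [hj, false_imp_iff]
    exact colPr_true hN j

open Classical in
lemma sum_pr_eq {κ : Type*} (I : Finset κ) (R : κ → (ι → ι × ι) → Prop) :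
    ∑ i ∈ I, pr s (R i)
      = (∑ e ∈ configs ι s, ((I.filter fun i => R i e).card : ℝ)) / (configs ι s).card := by
  unfold pr
  rw [← Finset.sum_div]
  congr 1
  simp only [Finset.card_filter]
  push_cast
  exact Finset.sum_comm

/-- `e` on `J` and `e'` off `J`. -/
def mix {α : Type*} (J : Finset ι) (e e' : ι → α) : ι → α := fun j => if j ∈ J then e j else e' j

lemma mix_mem {J : Finset ι} {e e' : ι → ι × ι} (h : e ∈ configs ι s) (h' : e' ∈ configs ι s) :
    mix J e e' ∈ configs ι s := by
  simp only [configs, Fintype.mem_piFinset, mix] at *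
  intro j
  split_ifs
  exacts [h j, h' j]

/-- Swapping the values on `J` of a pair of choices. -/
lemma sum_swap {β : Type*} [AddCommMonoid β] (J : Finset ι)
    (F : (ι → ι × ι) → (ι → ι × ι) → β) :
    ∑ e ∈ configs ι s, ∑ e' ∈ configs ι s, F (mix J e' e) (mix J e e')
      = ∑ e ∈ configs ι s, ∑ e' ∈ configs ι s, F e e' := by
  rw [← Finset.sum_product', ← Finset.sum_product']
  have hmix : ∀ e e' : ι → ι × ι, mix J (mix J e e') (mix J e' e) = e := by
    intro e e'; funext j; simp only [mix]; split_ifs <;> rfl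
  refine Finset.sum_bij' (fun q _ => (mix J q.2 q.1, mix J q.1 q.2))
    (fun q _ => (mix J q.2 q.1, mix J q.1 q.2)) ?_ ?_ ?_ ?_ ?_
  · intro q hq
    rw [Finset.mem_product] at hq ⊢
    exact ⟨mix_mem hq.2 hq.1, mix_mem hq.1 hq.2⟩
  · intro q hq
    rw [Finset.mem_product] at hq ⊢
    exact ⟨mix_mem hq.2 hq.1, mix_mem hq.1 hq.2⟩
  · intro q _
    exact Prod.ext (hmix _ _) (hmix _ _)
  · intro q _
    exact Prod.ext (hmix _ _) (hmix _ _)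
  · intro q _; rfl

/-- Conditioning on the columns off `J`. -/
lemma pr_and_resample (hN : 3 ≤ Fintype.card ι) (J : Finset ι) (R : (ι → ι × ι) → Prop)
    (H : (ι → ι × ι) → ι → ι × ι → Prop)
    (hR : ∀ e e', (∀ j ∉ J, e j = e' j) → (R e ↔ R e'))
    (hH : ∀ e e', (∀ j ∉ J, e j = e' j) → H e = H e') :
    pr s (fun e => R e ∧ ∀ j ∈ J, H e j (e j))
      = (∑ e ∈ configs ι s, Set.indicator {e | R e} (fun e => ∏ j ∈ J, colPr s j (H e j)) e)
        / (configs ι s).card := by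
  classical
  have hpos := configs_card_pos (ι := ι) s hN
  -- After the swap, `R` and `H` still see the old columns off `J`, while the columns of `J` come
  -- from the independent copy `e'`; summing over `e'` first gives a product over `J`.
  have key := sum_swap (s := s) J (β := ℝ) (fun e _ =>
    if R e ∧ ∀ j ∈ J, H e j (e j) then 1 else 0)
  have h1 : ∀ e e' : ι → ι × ι, (R (mix J e' e) ∧ ∀ j ∈ J, H (mix J e' e) j ((mix J e' e) j)) ↔
      (R e ∧ ∀ j ∈ J, H e j (e' j)) := by
    intro e e'
    have hoff : ∀ j ∉ J, mix J e' e j = e j := fun j hj => by simp [mix, hj]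
    rw [hR _ _ hoff, hH _ _ hoff]
    refine and_congr_right fun _ => forall₂_congr fun j hj => ?_
    simp [mix, hj]
  simp only [h1, Finset.sum_const, nsmul_eq_mul] at key
  rw [← Finset.mul_sum] at key
  have h2 : ∀ e, (∑ e' ∈ configs ι s, if R e ∧ ∀ j ∈ J, H e j (e' j) then (1 : ℝ) else 0)
      = (configs ι s).card * Set.indicator {e | R e} (fun e => ∏ j ∈ J, colPr s j (H e j)) e := by
    intro e
    by_cases he : R e
    · have hm : e ∈ {e | R e} := he
      rw [Set.indicator_of_mem hm, ← pr_forall_mem hN, pr_def, mul_div_cancel₀ _ (by positivity)]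
      simp [he]
    · have hm : e ∉ {e | R e} := he
      rw [Set.indicator_of_notMem hm]
      simp [he]
  simp only [h2] at key
  rw [← Finset.mul_sum] at key
  have h3 := mul_left_cancel₀ (by positivity) key
  rw [h3, pr_def]
  congr 1
  simp

/-- Events that depend on disjoint sets of columns are independent. -/
lemma pr_and_eq_mul (hN : 3 ≤ Fintype.card ι) (J : Finset ι)
    (hP : ∀ e e', (∀ j ∈ J, e j = e' j) → (P e ↔ P e'))
    (hQ : ∀ e e', (∀ j ∉ J, e j = e' j) → (Q e ↔ Q e')) :
    pr s (fun e => P e ∧ Q e) = pr s P * pr s Q := by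
  classical
  have hpos := configs_card_pos (ι := ι) s hN
  have key := sum_swap (s := s) J (β := ℝ) (fun e _ => if P e ∧ Q e then 1 else 0)
  have h1 : ∀ e e' : ι → ι × ι, (P (mix J e' e) ∧ Q (mix J e' e)) ↔ (P e' ∧ Q e) := by
    intro e e'
    rw [hP (mix J e' e) e' fun j hj => by simp [mix, hj],
      hQ (mix J e' e) e fun j hj => by simp [mix, hj]]
  simp only [h1, Finset.sum_const, nsmul_eq_mul] at key
  rw [← Finset.mul_sum] at key
  have h2 : ∀ e, (∑ e' ∈ configs ι s, if P e' ∧ Q e then (1 : ℝ) else 0)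
      = (if Q e then 1 else 0) * ((configs ι s).filter P).card := by
    intro e
    by_cases he : Q e <;> simp [he]
  simp only [h2] at key
  rw [← Finset.sum_mul] at key
  rw [pr_def, pr_def, pr_def, div_mul_div_comm, div_eq_div_iff (by positivity) (by positivity)]
  simp only [Finset.sum_boole] at key
  linear_combination (-((configs ι s).card : ℝ)) * key

/-- Given the columns off `J`, those of `J` are independent, so a bound `c` for each of them yields
`c ^ |J|`. The target `H` may depend on the columns off `J`, so it can be chosen after they are
known. -/
lemma le_pr_and_resample (hN : 3 ≤ Fintype.card ι) (J : Finset ι) (R : (ι → ι × ι) → Prop)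
    (H : (ι → ι × ι) → ι → ι × ι → Prop)
    (hR : ∀ e e', (∀ j ∉ J, e j = e' j) → (R e ↔ R e'))
    (hH : ∀ e e', (∀ j ∉ J, e j = e' j) → H e = H e') {c : ℝ} (hc : 0 ≤ c)
    (hle : ∀ e ∈ configs ι s, R e → ∀ j ∈ J, c ≤ colPr s j (H e j)) :
    c ^ J.card * pr s R ≤ pr s (fun e => R e ∧ ∀ j ∈ J, H e j (e j)) := by
  classical
  rw [pr_and_resample hN J R H hR hH, pr_def, ← mul_div_assoc]
  gcongr
  rw [Finset.card_filter]
  push_cast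
  rw [Finset.mul_sum]
  refine Finset.sum_le_sum fun e he => ?_
  by_cases hRe : R e
  · have hm : e ∈ {e | R e} := hRe
    rw [Set.indicator_of_mem hm]
    simp only [hRe, if_true, mul_one]
    rw [← Finset.prod_const]
    exact Finset.prod_le_prod (fun _ _ => hc) fun j hj => hle e he hRe j hj
  · have hm : e ∉ {e | R e} := hRe
    rw [Set.indicator_of_notMem hm]
    simp [hRe]

end Configurations

/-! ### Orthogonality of a random column to an indicator vector. -/

section Columns

set_option linter.unusedSectionVars false

variable {ι : Type} [Fintype ι] [DecidableEq ι]

/-- The indicator vector of `S` over `GF(2)`. -/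
def chi (S : Finset ι) : ι → ZMod 2 := fun i => if i ∈ S then 1 else 0

/-- The column `j` with random rows `p` is orthogonal to the vector `w`. -/
def Orth (w : ι → ZMod 2) (j : ι) (p : ι × ι) : Prop := w j + w p.1 + w p.2 = 0

instance (w : ι → ZMod 2) (j : ι) (p : ι × ι) : Decidable (Orth w j p) := by
  unfold Orth; infer_instance

lemma orth_chi_iff {S : Finset ι} {j : ι} {p : ι × ι} :
    Orth (chi S) j p ↔ (j ∈ S ↔ (p.1 ∈ S ↔ p.2 ∉ S)) := by
  unfold Orth chi
  by_cases h1 : j ∈ S <;> by_cases h2 : p.1 ∈ S <;> by_cases h3 : p.2 ∈ S <;>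
    simp [h1, h2, h3] <;> decide

/-- The number of pairs that meet a set of `k` rows in exactly one row, for a column of the set. -/
def splitIn (s : Sampling) (N k : ℕ) : ℕ :=
  match s with
  | .withReplacement => 2 * (k * (N - k))
  | .withoutReplacement => 2 * ((k - 1) * (N - k))

/-- The number of pairs that meet a set of `k` rows in exactly one row, for a column off the
set. -/
def splitOut (s : Sampling) (N k : ℕ) : ℕ :=
  match s with
  | .withReplacement => 2 * (k * (N - k))
  | .withoutReplacement => 2 * (k * (N - 1 - k))

lemma card_split (A B : Finset ι) (h : Disjoint A B) :
    (A ×ˢ B ∪ B ×ˢ A).card = 2 * (A.card * B.card) := by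
  rw [Finset.card_union_of_disjoint, Finset.card_product, Finset.card_product]
  · ring
  · rw [Finset.disjoint_left]
    intro p hp hp'
    rw [Finset.mem_product] at hp hp'
    exact Finset.disjoint_left.1 h hp.1 hp'.1

lemma card_splitIn (s : Sampling) (S : Finset ι) {j : ι} (hj : j ∈ S) :
    ((pairs s j).filter fun p => p.1 ∈ S ↔ p.2 ∉ S).card
      = splitIn s (Fintype.card ι) S.card := by
  cases s with
  | withReplacement =>
    have : ((pairs .withReplacement j).filter fun p => p.1 ∈ S ↔ p.2 ∉ S)
        = S ×ˢ Sᶜ ∪ Sᶜ ×ˢ S := by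
      ext p
      simp only [pairs, Finset.mem_filter, Finset.mem_univ, Finset.mem_union, Finset.mem_product,
        Finset.mem_compl]
      tauto
    rw [this, card_split _ _ disjoint_compl_right, Finset.card_compl]
    rfl
  | withoutReplacement =>
    have : ((pairs .withoutReplacement j).filter fun p => p.1 ∈ S ↔ p.2 ∉ S)
        = (S.erase j) ×ˢ Sᶜ ∪ Sᶜ ×ˢ (S.erase j) := by
      ext p
      simp only [pairs, Finset.mem_filter, Finset.mem_univ, Finset.mem_union, Finset.mem_product,
        Finset.mem_compl, Finset.mem_erase]
      constructor
      · tauto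
      · rintro (⟨⟨h1, h2⟩, h3⟩ | ⟨h3, h1, h2⟩)
        · exact ⟨⟨trivial, h1, fun h => h3 (h ▸ hj), fun h => h3 (h ▸ h2)⟩, by tauto⟩
        · exact ⟨⟨trivial, fun h => h3 (h ▸ hj), h1, fun h => h3 (h ▸ h2)⟩, by tauto⟩
    rw [this, card_split, Finset.card_compl, Finset.card_erase_of_mem hj]
    · rfl
    · exact Finset.disjoint_of_subset_left (Finset.erase_subset _ _) disjoint_compl_right

lemma card_splitOut (s : Sampling) (S : Finset ι) {j : ι} (hj : j ∉ S) :
    ((pairs s j).filter fun p => p.1 ∈ S ↔ p.2 ∉ S).card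
      = splitOut s (Fintype.card ι) S.card := by
  cases s with
  | withReplacement =>
    have : ((pairs .withReplacement j).filter fun p => p.1 ∈ S ↔ p.2 ∉ S)
        = S ×ˢ Sᶜ ∪ Sᶜ ×ˢ S := by
      ext p
      simp only [pairs, Finset.mem_filter, Finset.mem_univ, Finset.mem_union, Finset.mem_product,
        Finset.mem_compl]
      tauto
    rw [this, card_split _ _ disjoint_compl_right, Finset.card_compl]
    rfl
  | withoutReplacement =>
    have : ((pairs .withoutReplacement j).filter fun p => p.1 ∈ S ↔ p.2 ∉ S)
        = S ×ˢ (Sᶜ.erase j) ∪ (Sᶜ.erase j) ×ˢ S := by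
      ext p
      simp only [pairs, Finset.mem_filter, Finset.mem_univ, Finset.mem_union, Finset.mem_product,
        Finset.mem_compl, Finset.mem_erase]
      constructor
      · tauto
      · rintro (⟨h2, h1, h3⟩ | ⟨⟨h1, h3⟩, h2⟩)
        · exact ⟨⟨trivial, fun h => hj (h ▸ h2), h1, fun h => h3 (h ▸ h2)⟩, by tauto⟩
        · exact ⟨⟨trivial, h1, fun h => hj (h ▸ h2), fun h => h3 (h ▸ h2)⟩, by tauto⟩
    rw [this, card_split, Finset.card_erase_of_mem (by simpa using hj), Finset.card_compl]
    · rw [Nat.sub_right_comm]; rfl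
    · exact Finset.disjoint_of_subset_right (Finset.erase_subset _ _) disjoint_compl_right

/-- The probability that a column of a set of `k` rows is orthogonal to its indicator vector. -/
noncomputable def inPr (s : Sampling) (N k : ℕ) : ℝ := splitIn s N k / totalPairs s N

/-- The probability that a column off a set of `k` rows is orthogonal to its indicator vector. -/
noncomputable def outPr (s : Sampling) (N k : ℕ) : ℝ := 1 - splitOut s N k / totalPairs s N

lemma inPr_nonneg (s : Sampling) (N k : ℕ) : 0 ≤ inPr s N k := by unfold inPr; positivity

lemma colPr_orth_of_mem (s : Sampling) {S : Finset ι} {j : ι} (hj : j ∈ S) :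
    colPr s j (Orth (chi S) j) = inPr s (Fintype.card ι) S.card := by
  rw [colPr_def, inPr, card_pairs, ← card_splitIn s S hj]
  congr 3
  ext p
  simp [orth_chi_iff, hj]

lemma colPr_orth_of_notMem (s : Sampling) (hN : 3 ≤ Fintype.card ι) {S : Finset ι} {j : ι}
    (hj : j ∉ S) : colPr s j (Orth (chi S) j) = outPr s (Fintype.card ι) S.card := by
  have h : colPr s j (Orth (chi S) j) = colPr s j (fun p => ¬ (p.1 ∈ S ↔ p.2 ∉ S)) := by
    congr 1
    funext p
    simp [orth_chi_iff, hj]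
  rw [h, colPr_not hN, colPr_def, outPr, card_splitOut s S hj, card_pairs]

/-- The probability that the columns off `J` are orthogonal to the indicator vector of `S`. -/
lemma pr_orth (s : Sampling) (hN : 3 ≤ Fintype.card ι) (S J : Finset ι) :
    pr s (fun e => ∀ j ∈ Jᶜ, Orth (chi S) j (e j))
      = inPr s (Fintype.card ι) S.card ^ (S \ J).card
        * outPr s (Fintype.card ι) S.card ^ (Fintype.card ι - J.card - (S \ J).card) := by
  rw [pr_forall_mem hN, ← Finset.prod_inter_mul_prod_sdiff _ S]
  have h1 : Jᶜ ∩ S = S \ J := by ext; simp [and_comm]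
  have h2 : (Jᶜ \ S).card = Fintype.card ι - J.card - (S \ J).card := by
    rw [Finset.card_sdiff, Finset.inter_comm, h1, Finset.card_compl]
  rw [h1, ← h2, ← Finset.prod_const, ← Finset.prod_const]
  congr 1
  · exact Finset.prod_congr rfl fun j hj => colPr_orth_of_mem s (Finset.mem_sdiff.1 hj).1
  · exact Finset.prod_congr rfl fun j hj =>
      colPr_orth_of_notMem s hN (Finset.mem_sdiff.1 hj).2

/-- Summation over all sets, by the sizes of their parts in `J` and off `J`. -/
lemma sum_finset_split (J : Finset ι) (F : ℕ → ℕ → ℝ) :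
    ∑ S : Finset ι, F (S ∩ J).card (S \ J).card
      = ∑ I ∈ J.powerset, ∑ t ∈ Finset.range (Fintype.card ι - J.card + 1),
          ((Fintype.card ι - J.card).choose t : ℝ) * F I.card t := by
  have h : ∀ I : Finset ι, ∑ t ∈ Finset.range (Fintype.card ι - J.card + 1),
      ((Fintype.card ι - J.card).choose t : ℝ) * F I.card t
      = ∑ T ∈ (Jᶜ).powerset, F I.card T.card := by
    intro I
    rw [Finset.sum_powerset_apply_card (fun t => F I.card t), Finset.card_compl]
    simp only [nsmul_eq_mul]
  simp only [h]
  rw [← Finset.sum_product']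
  refine Finset.sum_bij' (fun S _ => (S ∩ J, S \ J)) (fun q _ => q.1 ∪ q.2) ?_ ?_ ?_ ?_ ?_
  · intro S _
    simp only [Finset.mem_product, Finset.mem_powerset]
    exact ⟨Finset.inter_subset_right, fun x hx => by
      simpa using (Finset.mem_sdiff.1 hx).2⟩
  · simp
  · intro S _; ext x; by_cases hx : x ∈ J <;> simp [hx]
  · rintro ⟨I, T⟩ h
    simp only [Finset.mem_product, Finset.mem_powerset] at h
    obtain ⟨h1, h2⟩ := h
    have h3 : ∀ x ∈ T, x ∉ J := fun x hx => by simpa using h2 hx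
    ext x <;> simp only [Finset.mem_inter, Finset.mem_union, Finset.mem_sdiff]
    · constructor
      · rintro ⟨hx | hx, hJ⟩
        exacts [hx, absurd hJ (h3 x hx)]
      · exact fun hx => ⟨Or.inl hx, h1 hx⟩
    · constructor
      · rintro ⟨hx | hx, hJ⟩
        exacts [absurd (h1 hx) hJ, hx]
      · exact fun hx => ⟨Or.inr hx, h3 x hx⟩
  · intro S _; rfl

/-- The expected number of vectors whose size satisfies `Q` and that are orthogonal to the columns
off `J`. -/
lemma sum_pr_orth (s : Sampling) (hN : 3 ≤ Fintype.card ι) (J : Finset ι) (Q : ℕ → Prop)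
    [DecidablePred Q] :
    ∑ S : Finset ι with Q S.card, pr s (fun e => ∀ j ∈ Jᶜ, Orth (chi S) j (e j))
      = ∑ I ∈ J.powerset, ∑ t ∈ Finset.range (Fintype.card ι - J.card + 1),
          ((Fintype.card ι - J.card).choose t : ℝ) * if Q (I.card + t) then
            inPr s (Fintype.card ι) (I.card + t) ^ t
              * outPr s (Fintype.card ι) (I.card + t) ^ (Fintype.card ι - J.card - t) else 0 := by
  rw [← sum_finset_split J fun i t => if Q (i + t) then
      inPr s (Fintype.card ι) (i + t) ^ t
        * outPr s (Fintype.card ι) (i + t) ^ (Fintype.card ι - J.card - t) else 0,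
    Finset.sum_filter]
  refine Finset.sum_congr rfl fun S _ => ?_
  rw [Finset.card_inter_add_card_sdiff, pr_orth s hN]

end Columns

/-! ### Bounds for single terms of the expected number of orthogonal vectors. -/

section Estimates

/-- One term of the binomial expansion of `(a / 2 + b) ^ n`. Without the weight 1/2 the bound would
be useless, since `inPr + outPr = 1` with replacement; the price `2 ^ t` is recovered in
`small_term_le`. -/
lemma choose_mul_le_two_pow {n t : ℕ} (ht : t ≤ n) {a b : ℝ} (ha : 0 ≤ a) (hb : 0 ≤ b) :
    (n.choose t : ℝ) * (a ^ t * b ^ (n - t)) ≤ 2 ^ t * (a / 2 + b) ^ n := by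
  have h : (a / 2) ^ t * b ^ (n - t) * (n.choose t : ℝ) ≤ (a / 2 + b) ^ n := by
    rw [add_pow]
    exact Finset.single_le_sum (f := fun m => (a / 2) ^ m * b ^ (n - m) * (n.choose m : ℝ))
      (fun i _ => by positivity) (Finset.mem_range.2 (by omega))
  calc (n.choose t : ℝ) * (a ^ t * b ^ (n - t))
      = 2 ^ t * ((a / 2) ^ t * b ^ (n - t) * (n.choose t : ℝ)) := by
        rw [div_pow]; field_simp
    _ ≤ _ := by gcongr

/-- Chernoff's argument: one term of `(exp (-l) + exp l) ^ n`, with `cosh l ≤ exp (l ^ 2 / 2)`. The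
value of `l` minimises the resulting exponent. -/
lemma choose_le_exp {n t : ℕ} (hn : 0 < n) (ht : t ≤ n) :
    (n.choose t : ℝ) ≤ 2 ^ n * Real.exp (-((n : ℝ) - 2 * t) ^ 2 / (2 * n)) := by
  set l : ℝ := ((n : ℝ) - 2 * t) / n with hl
  have h : Real.exp (-l) ^ t * Real.exp l ^ (n - t) * (n.choose t : ℝ)
      ≤ (Real.exp (-l) + Real.exp l) ^ n := by
    rw [add_pow]
    exact Finset.single_le_sum
      (f := fun m => Real.exp (-l) ^ m * Real.exp l ^ (n - m) * (n.choose m : ℝ))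
      (fun i _ => by positivity) (Finset.mem_range.2 (by omega))
  have h2 : Real.exp (-l) + Real.exp l ≤ 2 * Real.exp (l ^ 2 / 2) := by
    have := Real.cosh_le_exp_half_sq l
    rw [Real.cosh_eq] at this
    linarith
  have h3 : Real.exp (-l) ^ t * Real.exp l ^ (n - t) = Real.exp (l * ((n : ℝ) - 2 * t)) := by
    rw [← Real.exp_nat_mul, ← Real.exp_nat_mul, ← Real.exp_add]
    congr 1
    push_cast [ht]
    ring
  have h4 : (Real.exp (-l) + Real.exp l) ^ n ≤ 2 ^ n * Real.exp (n * (l ^ 2 / 2)) := by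
    calc _ ≤ (2 * Real.exp (l ^ 2 / 2)) ^ n := by gcongr
      _ = _ := by rw [mul_pow, Real.exp_nat_mul]
  rw [h3] at h
  have hn' : (n : ℝ) ≠ 0 := by positivity
  have h5 : -((n : ℝ) - 2 * t) ^ 2 / (2 * n) = n * (l ^ 2 / 2) - l * ((n : ℝ) - 2 * t) := by
    rw [hl]; field_simp; ring
  rw [h5, Real.exp_sub, ← mul_div_assoc, le_div_iff₀ (Real.exp_pos _), mul_comm]
  linarith

lemma outPr_nonneg_of_three_le (s : Sampling) {N k : ℕ} (hN : 3 ≤ N) : 0 ≤ outPr s N k := by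
  unfold outPr
  have hpos : (0 : ℝ) < totalPairs s N := by exact_mod_cast totalPairs_pos s hN
  rw [sub_nonneg, div_le_one hpos]
  norm_cast
  cases s with
  | withReplacement =>
    simp only [splitOut, totalPairs]
    rcases le_total k N with h | h
    · obtain ⟨m, rfl⟩ := Nat.exists_eq_add_of_le h
      rw [Nat.add_sub_cancel_left]
      nlinarith [sq_nonneg ((k : ℤ) - m)]
    · rw [Nat.sub_eq_zero_of_le h]; simp
  | withoutReplacement =>
    simp only [splitOut, totalPairs]
    rcases le_total k (N - 1) with h | h
    · obtain ⟨m, hm⟩ := Nat.exists_eq_add_of_le h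
      obtain ⟨M, rfl⟩ := Nat.exists_eq_add_of_le hN
      rw [show 3 + M - 1 = M + 2 by omega, show 3 + M - 2 = M + 1 by omega] at *
      rw [hm, Nat.add_sub_cancel_left]
      have h1 : 4 * (k * m) ≤ (k + m) * (k + m) := by
        zify; nlinarith [sq_nonneg ((k : ℤ) - m)]
      have h2 : (k + m) ≤ 2 * (M + 1) := by omega
      nlinarith [Nat.mul_le_mul_left (k + m) h2]
    · rw [Nat.sub_eq_zero_of_le h]; simp

lemma totalPairs_withoutReplacement_cast {N : ℕ} (hN : 3 ≤ N) :
    (totalPairs .withoutReplacement N : ℝ) = ((N : ℝ) - 1) * (N - 2) := by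
  simp only [totalPairs]
  push_cast [show 1 ≤ N by omega, show 2 ≤ N by omega]
  ring

lemma half_inPr_add_outPr_le (s : Sampling) {N k : ℕ} (hN : 3 ≤ N) (hk : 3 * k ≤ N) :
    inPr s N k / 2 + outPr s N k ≤ 1 - (k : ℝ) * (N - k) / N ^ 2 := by
  have hN' : (3 : ℝ) ≤ N := by exact_mod_cast hN
  have hk' : (3 : ℝ) * k ≤ N := by exact_mod_cast hk
  have hk0 : (0 : ℝ) ≤ k := by positivity
  cases s with
  | withReplacement =>
    simp only [inPr, outPr, splitIn, splitOut, totalPairs]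
    push_cast [show k ≤ N by omega]
    apply le_of_eq
    field_simp
    ring
  | withoutReplacement =>
    simp only [inPr, outPr, totalPairs_withoutReplacement_cast hN, splitIn, splitOut]
    rcases Nat.eq_zero_or_pos k with rfl | hk1
    · simp
    · push_cast [show k ≤ N by omega, show 1 ≤ k by omega, show k ≤ N - 1 by omega,
        show 1 ≤ N by omega]
      have h1 : (0 : ℝ) < ((N : ℝ) - 1) * (N - 2) := by nlinarith
      have h2 : (k : ℝ) * (N - k) / N ^ 2 ≤ (k * (N - k)) / (((N : ℝ) - 1) * (N - 2)) := by
        apply div_le_div_of_nonneg_left _ h1 (by nlinarith)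
        nlinarith
      have h3 : 2 * (((k : ℝ) - 1) * (N - k)) / (((N : ℝ) - 1) * (N - 2)) / 2
          + (1 - 2 * ((k : ℝ) * (N - 1 - k)) / (((N : ℝ) - 1) * (N - 2)))
          = 1 - (k * (N - k) + (N - 3 * k)) / (((N : ℝ) - 1) * (N - 2)) := by
        field_simp
        ring
      have h4 : (k * (N - k)) / (((N : ℝ) - 1) * (N - 2))
          ≤ (k * (N - k) + (N - 3 * k)) / (((N : ℝ) - 1) * (N - 2)) := by
        gcongr; linarith
      linarith

/-- The ratio of the geometric bound for the expected number of small dependencies. -/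
noncomputable def rho : ℝ := 2 * Real.exp (-(71 / 100))

lemma rho_pos : 0 < rho := by unfold rho; positivity

lemma rho_lt_one : rho < 1 := by
  have h : Real.exp (-(71 / 100)) < 1 / 2 := by
    rw [← Real.lt_log_iff_exp_lt (by norm_num), one_div, Real.log_inv]
    linarith [Real.log_two_lt_d9]
  unfold rho; linarith

/-- The constants satisfy 0.98 · 0.73 > 0.71 > log 2: at least 98% of the columns are off `J`, and
sizes up to 27% of the rows are allowed. So each element of the set gains a factor `exp (-0.71) <
1/2`, and each element off `J` pays a factor 2, which leaves `rho < 1`. -/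
lemma small_term_le (s : Sampling) {N D i t : ℕ} (hN : 3 ≤ N) (hD : 50 * D ≤ N)
    (ht : t ≤ N - D) (hk : 100 * (i + t) ≤ 27 * N) :
    ((N - D).choose t : ℝ) * (inPr s N (i + t) ^ t * outPr s N (i + t) ^ (N - D - t))
      ≤ (1 / 2) ^ i * rho ^ t := by
  have hN' : (3 : ℝ) ≤ N := by exact_mod_cast hN
  have hD' : (50 : ℝ) * D ≤ N := by exact_mod_cast hD
  have hk' : (100 : ℝ) * (i + t) ≤ 27 * N := by exact_mod_cast hk
  refine (choose_mul_le_two_pow ht (inPr_nonneg _ _ _) (outPr_nonneg_of_three_le s hN)).trans ?_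
  have h1 : (inPr s N (i + t) / 2 + outPr s N (i + t)) ^ (N - D)
      ≤ Real.exp (-(71 / 100)) ^ (i + t) := by
    have h0 : 0 ≤ inPr s N (i + t) / 2 + outPr s N (i + t) := by
      have := inPr_nonneg s N (i + t)
      have := outPr_nonneg_of_three_le s (k := i + t) hN
      positivity
    have h2 := half_inPr_add_outPr_le s (k := i + t) hN (by omega)
    push_cast at h2
    set k : ℝ := (i : ℝ) + t with hkdef
    have hk0 : 0 ≤ k := by positivity
    calc _ ≤ (Real.exp (-(k * (N - k) / N ^ 2))) ^ (N - D) := by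
          gcongr
          refine h2.trans ?_
          have := Real.add_one_le_exp (-(k * (N - k) / N ^ 2))
          linarith
      _ = Real.exp (-(((N : ℝ) - D) * (k * (N - k) / N ^ 2))) := by
          rw [← Real.exp_nat_mul]
          push_cast [show D ≤ N by omega]
          ring_nf
      _ ≤ Real.exp (-(71 / 100) * k) := by
          gcongr
          have h3 : (71 / 100 : ℝ) * N ^ 2 ≤ (N - D) * (N - k) := by
            have h5 : (98 / 100 : ℝ) * N ≤ N - D := by linarith
            have h6 : (73 / 100 : ℝ) * N ≤ N - k := by linarith
            nlinarith [mul_le_mul h5 h6 (by positivity) (by linarith)]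
          have h4 : (71 / 100 : ℝ) * k ≤ ((N : ℝ) - D) * (k * (N - k) / N ^ 2) := by
            rw [← mul_div_assoc, le_div_iff₀ (by positivity)]
            nlinarith [mul_le_mul_of_nonneg_left h3 hk0]
          linarith
      _ = _ := by
          rw [← Real.exp_nat_mul, hkdef]; push_cast; ring_nf
  calc _ ≤ 2 ^ t * Real.exp (-(71 / 100)) ^ (i + t) := by gcongr
    _ = Real.exp (-(71 / 100)) ^ i * rho ^ t := by rw [rho, mul_pow, pow_add]; ring
    _ ≤ _ := by
      gcongr
      · exact pow_nonneg rho_pos.le _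
      · have := rho_lt_one
        unfold rho at this
        linarith

/-- With x = (N - 2k) / N, twice the two orthogonality probabilities are 1 - x² and 1 + x² with
replacement; the term 4 / N covers the other model. -/
lemma two_mul_inPr_le (s : Sampling) {N k : ℕ} (hN : 10 ≤ N) (hk : k ≤ N) :
    2 * inPr s N k - 1 ≤ -((N : ℝ) - 2 * k) ^ 2 / N ^ 2 + 4 / N := by
  have hN' : (10 : ℝ) ≤ N := by exact_mod_cast hN
  have hk' : (k : ℝ) ≤ N := by exact_mod_cast hk
  have hk0 : (0 : ℝ) ≤ k := by positivity
  have hq : 4 * (k * ((N : ℝ) - k)) / N ^ 2 - 1 = -((N : ℝ) - 2 * k) ^ 2 / N ^ 2 := by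
    field_simp; ring
  cases s with
  | withReplacement =>
    simp only [inPr, splitIn, totalPairs]
    push_cast [hk]
    have : 2 * (2 * ((k : ℝ) * (N - k)) / (N * N)) = 4 * (k * ((N : ℝ) - k)) / N ^ 2 := by
      field_simp; ring
    rw [this, hq]
    have : (0 : ℝ) ≤ 4 / N := by positivity
    linarith
  | withoutReplacement =>
    simp only [inPr, totalPairs_withoutReplacement_cast (show 3 ≤ N by omega), splitIn]
    have h1 : (0 : ℝ) < ((N : ℝ) - 1) * (N - 2) := by nlinarith
    have h2 : ((k - 1 : ℕ) : ℝ) ≤ k := by exact_mod_cast Nat.sub_le _ _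
    push_cast [hk]
    have h3 : 2 * (2 * (((k - 1 : ℕ) : ℝ) * ((N : ℝ) - k)) / (((N : ℝ) - 1) * (N - 2)))
        ≤ 4 * (k * ((N : ℝ) - k)) / N ^ 2 * (1 + 4 / N) := by
      have h4 : 4 * (k * ((N : ℝ) - k)) / (((N : ℝ) - 1) * (N - 2))
          ≤ 4 * (k * ((N : ℝ) - k)) / N ^ 2 * (1 + 4 / N) := by
        rw [div_mul_eq_mul_div, div_le_div_iff₀ h1 (by positivity),
          mul_assoc (4 * (k * ((N : ℝ) - k)))]
        have : (N : ℝ) ^ 2 ≤ (1 + 4 / N) * (((N : ℝ) - 1) * (N - 2)) := by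
          rw [one_add_div (by positivity), div_mul_eq_mul_div, le_div_iff₀ (by positivity)]
          nlinarith
        have h5 : 0 ≤ 4 * (k * ((N : ℝ) - k)) := by
          have : 0 ≤ (N : ℝ) - k := by linarith
          positivity
        exact mul_le_mul_of_nonneg_left this h5
      refine le_trans ?_ h4
      rw [← mul_div_assoc]
      gcongr ?_ / _
      nlinarith [mul_le_mul_of_nonneg_right h2 (sub_nonneg.2 hk')]
    have h6 : 4 * (k * ((N : ℝ) - k)) / N ^ 2 ≤ 1 := by
      have : 0 ≤ ((N : ℝ) - 2 * k) ^ 2 / N ^ 2 := by positivity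
      have h7 := hq
      rw [neg_div] at h7
      linarith
    have h8 : 4 * (k * ((N : ℝ) - k)) / N ^ 2 * (4 / N) ≤ 1 * (4 / N) := by gcongr
    nlinarith

lemma two_mul_outPr_le (s : Sampling) {N k : ℕ} (hN : 10 ≤ N) (hk : k ≤ N) :
    2 * outPr s N k - 1 ≤ ((N : ℝ) - 2 * k) ^ 2 / N ^ 2 + 4 / N := by
  have hN' : (10 : ℝ) ≤ N := by exact_mod_cast hN
  have hk' : (k : ℝ) ≤ N := by exact_mod_cast hk
  have hk0 : (0 : ℝ) ≤ k := by positivity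
  cases s with
  | withReplacement =>
    simp only [outPr, splitOut, totalPairs]
    push_cast [hk]
    have : 2 * (1 - 2 * ((k : ℝ) * (N - k)) / (N * N)) - 1 = ((N : ℝ) - 2 * k) ^ 2 / N ^ 2 := by
      field_simp; ring
    rw [this]
    have : (0 : ℝ) ≤ 4 / N := by positivity
    linarith
  | withoutReplacement =>
    simp only [outPr, totalPairs_withoutReplacement_cast (show 3 ≤ N by omega), splitOut]
    have h1 : (0 : ℝ) < ((N : ℝ) - 1) * (N - 2) := by nlinarith
    push_cast
    set c : ℝ := ((N - 1 - k : ℕ) : ℝ) with hc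
    have hc0 : 0 ≤ c := by positivity
    have hc1 : (N : ℝ) - 1 - k ≤ c := by
      rw [hc, sub_sub, sub_le_iff_le_add]
      norm_cast
      omega
    have h2 : 4 * (k * ((N : ℝ) - 1 - k)) / N ^ 2
      ≤ 2 * (2 * (k * c) / (((N : ℝ) - 1) * (N - 2))) := by
      calc _ ≤ 4 * (k * c) / N ^ 2 := by gcongr
        _ ≤ 4 * (k * c) / (((N : ℝ) - 1) * (N - 2)) := by
          apply div_le_div_of_nonneg_left (by positivity) h1 (by nlinarith)
        _ = _ := by ring
    have h3 : 4 * (k * ((N : ℝ) - 1 - k)) / N ^ 2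
        = 1 - ((N : ℝ) - 2 * k) ^ 2 / N ^ 2 - 4 * k / N ^ 2 := by field_simp; ring
    have h4 : 4 * (k : ℝ) / N ^ 2 ≤ 4 / N := by
      rw [div_le_div_iff₀ (by positivity) (by positivity)]; nlinarith
    linarith

/-- Comparison with fair coins: each probability is written as 1/2 times a factor, and 1 + x ≤ exp x
bounds the factors. -/
lemma choose_mul_le_exp (s : Sampling) {N D t k : ℕ} (hN : 3 ≤ N) (ht : t ≤ N - D)
    {δ : ℝ} (hδ : t * (2 * inPr s N k - 1) + ((N - D - t : ℕ) : ℝ) * (2 * outPr s N k - 1) ≤ δ) :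
    ((N - D).choose t : ℝ) * (inPr s N k ^ t * outPr s N k ^ (N - D - t))
      ≤ ((N - D).choose t : ℝ) / 2 ^ (N - D) * Real.exp δ := by
  have ha := inPr_nonneg s N k
  have hb := outPr_nonneg_of_three_le s (k := k) hN
  rw [div_mul_eq_mul_div, mul_div_assoc]
  gcongr
  rw [le_div_iff₀ (by positivity)]
  calc inPr s N k ^ t * outPr s N k ^ (N - D - t) * 2 ^ (N - D)
      = (2 * inPr s N k) ^ t * (2 * outPr s N k) ^ (N - D - t) := by
        rw [mul_pow, mul_pow]
        nth_rw 2 [show N - D = t + (N - D - t) by omega]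
        rw [pow_add]; ring
    _ ≤ Real.exp (2 * inPr s N k - 1) ^ t * Real.exp (2 * outPr s N k - 1) ^ (N - D - t) := by
        gcongr
        · linarith [Real.add_one_le_exp (2 * inPr s N k - 1)]
        · linarith [Real.add_one_le_exp (2 * outPr s N k - 1)]
    _ = Real.exp (t * (2 * inPr s N k - 1) + ((N - D - t : ℕ) : ℝ) * (2 * outPr s N k - 1)) := by
        rw [← Real.exp_nat_mul, ← Real.exp_nat_mul, Real.exp_add]
    _ ≤ _ := Real.exp_le_exp.2 hδ

/-- With y = N - 2(i + t), the binomial coefficient contributes -y² / (2N) to the exponent, and the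
bias of the probabilities contributes (N - D - 2t) y² / N², about y³ / N². The sum is negative only
while y < N / 2, that is, for sizes above N / 4; this is why the small range has to reach beyond N /
4, to 27N / 100. Setting aside `D` columns costs the constant `2 * D + 4`. -/
lemma middle_term_le (s : Sampling) {N D i t : ℕ} (hN : 10 ≤ N) (hi : i ≤ D) (hD : D < N)
    (ht : t ≤ N - D) :
    ((N - D).choose t : ℝ) * (inPr s N (i + t) ^ t * outPr s N (i + t) ^ (N - D - t))
      ≤ Real.exp (-((N : ℝ) - 2 * (i + t)) ^ 2 / N * (1 / 2 - ((N : ℝ) - 2 * (i + t)) / N)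
          + (2 * D + 4)) := by
  have hN' : (10 : ℝ) ≤ N := by exact_mod_cast hN
  have hi' : (i : ℝ) ≤ D := by exact_mod_cast hi
  have hD' : (D : ℝ) < N := by exact_mod_cast hD
  have hi0 : (0 : ℝ) ≤ i := by positivity
  have hk : i + t ≤ N := by omega
  have hk' : (i : ℝ) + t ≤ N := by exact_mod_cast hk
  set y : ℝ := (N : ℝ) - 2 * (i + t) with hy
  set y₁ : ℝ := ((N - D : ℕ) : ℝ) - 2 * t with hy₁
  have hyy : y - y₁ = D - 2 * i := by rw [hy, hy₁]; push_cast [hD.le]; ring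
  have ha := two_mul_inPr_le s hN hk
  have hb := two_mul_outPr_le s hN hk
  push_cast at ha hb
  rw [← hy] at ha hb
  have hyN : y ^ 2 ≤ N ^ 2 := by
    have h1 : -N ≤ y := by rw [hy]; linarith
    have h2 : y ≤ N := by
      rw [hy]
      have : (0 : ℝ) ≤ t := by positivity
      linarith
    nlinarith
  have hu : y ^ 2 / N ^ 2 ≤ 1 := by rw [div_le_one (by positivity)]; exact hyN
  have hu0 : 0 ≤ y ^ 2 / N ^ 2 := by positivity
  have hδ : t * (2 * inPr s N (i + t) - 1)
      + ((N - D - t : ℕ) : ℝ) * (2 * outPr s N (i + t) - 1) ≤ y₁ * (y ^ 2 / N ^ 2) + 4 := by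
    have h1 : ((N - D - t : ℕ) : ℝ) = ((N - D : ℕ) : ℝ) - t := by push_cast [ht]; ring
    have h1' : (0 : ℝ) ≤ ((N - D : ℕ) : ℝ) - t := by rw [← h1]; positivity
    rw [h1]
    have h2 : (t : ℝ) * (2 * inPr s N (i + t) - 1) ≤ t * (-y ^ 2 / N ^ 2 + 4 / N) := by gcongr
    have h3 : (((N - D : ℕ) : ℝ) - t) * (2 * outPr s N (i + t) - 1)
        ≤ (((N - D : ℕ) : ℝ) - t) * (y ^ 2 / N ^ 2 + 4 / N) := by gcongr
    have h4 : ((N - D : ℕ) : ℝ) * (4 / N) ≤ 4 := by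
      rw [← mul_div_assoc, div_le_iff₀ (by positivity)]
      have : ((N - D : ℕ) : ℝ) ≤ N := by exact_mod_cast Nat.sub_le _ _
      linarith
    rw [hy₁]
    rw [neg_div] at h2
    nlinarith
  refine (choose_mul_le_exp s (by omega) ht hδ).trans ?_
  have h5 : ((N - D).choose t : ℝ) / 2 ^ (N - D)
      ≤ Real.exp (-y₁ ^ 2 / (2 * ((N - D : ℕ) : ℝ))) := by
    rw [div_le_iff₀ (by positivity), mul_comm]
    exact choose_le_exp (by omega) ht
  calc _ ≤ Real.exp (-y₁ ^ 2 / (2 * ((N - D : ℕ) : ℝ))) * Real.exp (y₁ * (y ^ 2 / N ^ 2) + 4) := by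
        gcongr
    _ = Real.exp (-y₁ ^ 2 / (2 * ((N - D : ℕ) : ℝ)) + (y₁ * (y ^ 2 / N ^ 2) + 4)) := by
        rw [← Real.exp_add]
    _ ≤ _ := by
      apply Real.exp_le_exp.2
      have hD0 : (0 : ℝ) ≤ D := by positivity
      have h6 : y₁ * (y ^ 2 / N ^ 2) ≤ y * (y ^ 2 / N ^ 2) + D := by
        have : y₁ ≤ y + D := by linarith
        nlinarith
      have h7 : -y₁ ^ 2 / (2 * ((N - D : ℕ) : ℝ)) ≤ -y ^ 2 / (2 * N) + D := by
        have hpos : (0 : ℝ) < ((N - D : ℕ) : ℝ) := by exact_mod_cast (by omega : 0 < N - D)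
        have h8 : ((N - D : ℕ) : ℝ) ≤ N := by exact_mod_cast Nat.sub_le _ _
        calc -y₁ ^ 2 / (2 * ((N - D : ℕ) : ℝ)) ≤ -y₁ ^ 2 / (2 * N) := by
              rw [neg_div, neg_div, neg_le_neg_iff]
              gcongr
          _ ≤ _ := by
              rw [div_add' _ _ _ (by positivity)]
              gcongr ?_ / _
              have h9 : |y| ≤ N := abs_le_of_sq_le_sq hyN (by positivity)
              have h10 := abs_le.1 h9
              have h11 : y₁ = y - (D - 2 * i) := by linarith
              have h12 : |(D : ℝ) - 2 * i| ≤ D := by rw [abs_le]; constructor <;> linarith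
              have h13 : |y * ((D : ℝ) - 2 * i)| ≤ N * D := by
                rw [abs_mul]; gcongr
              have h14 := abs_le.1 h13
              rw [h11]
              nlinarith [sq_nonneg ((D : ℝ) - 2 * i)]
      have h15 : -y ^ 2 / N * (1 / 2 - y / N) = -y ^ 2 / (2 * N) + y * (y ^ 2 / N ^ 2) := by
        field_simp; ring
      rw [h15]
      linarith

end Estimates

/-! ### Expected numbers of orthogonal vectors, by size: small, near half, neither. -/

section FirstMoments

/-- `k` is close to `N / 2`, slightly more so than a large size has to be. -/
def IsCore (N k : ℕ) : Prop :=
  |(k : ℝ) - (N : ℝ) / 2| ≤ 9 / 10 * Real.sqrt ((N : ℝ) * Real.log (N : ℝ))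

lemma eventually_log_le {c : ℝ} (hc : 0 < c) {a : ℝ} (ha : 0 < a) :
    ∀ᶠ N : ℕ in atTop, Real.log N ≤ c * (N : ℝ) ^ a := by
  have h := (isLittleO_log_rpow_atTop ha).bound hc
  have h2 := tendsto_natCast_atTop_atTop (R := ℝ) |>.eventually h
  filter_upwards [h2, eventually_ge_atTop 1] with N hN h1
  have h1' : (1 : ℝ) ≤ N := by exact_mod_cast h1
  rw [Real.norm_of_nonneg (Real.log_nonneg h1'), Real.norm_of_nonneg (by positivity)] at hN
  exact hN

/-- Off the core, y² ≥ 4 · 0.81 · N log N. If y / N ≤ 1 / 100, the exponent is below -3.24 · 0.49 ·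
log N < -(3/2) log N; otherwise it is linear in -N, as y / N ≤ 0.46. A power below -1 is needed
because the sum has about N terms. -/
lemma noncore_term_le (s : Sampling) (D : ℕ) : ∀ᶠ N : ℕ in atTop, ∀ i t : ℕ, i ≤ D → t ≤ N - D →
    27 * N < 100 * (i + t) → ¬ IsCore N (i + t) →
    ((N - D).choose t : ℝ) * (inPr s N (i + t) ^ t * outPr s N (i + t) ^ (N - D - t))
      ≤ Real.exp (2 * D + 4) * (N : ℝ) ^ (-(3 / 2) : ℝ) := by
  filter_upwards [eventually_ge_atTop 10, eventually_gt_atTop D,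
    eventually_log_le (c := 2 / 1000000) (by norm_num) (a := 1) (by norm_num)]
    with N hN hD hlog i t hi ht hk hcore
  have hN' : (10 : ℝ) ≤ N := by exact_mod_cast hN
  have hN0 : (0 : ℝ) < N := by linarith
  have hk' : (27 : ℝ) * N < 100 * (i + t) := by exact_mod_cast hk
  refine (middle_term_le s hN hi hD ht).trans ?_
  rw [Real.exp_add, mul_comm, Real.rpow_def_of_pos hN0]
  refine mul_le_mul_of_nonneg_left (Real.exp_le_exp.2 ?_) (Real.exp_pos _).le
  set y : ℝ := (N : ℝ) - 2 * (i + t) with hy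
  rw [Real.rpow_one] at hlog
  have hlog0 : 0 ≤ Real.log N := Real.log_nonneg (by linarith)
  have hyu : y / N ≤ 46 / 100 := by rw [div_le_iff₀ hN0, hy]; linarith
  have hy2 : 324 / 100 * (N * Real.log N) ≤ y ^ 2 := by
    unfold IsCore at hcore
    push_cast at hcore
    rw [not_le] at hcore
    have h1 : |(i : ℝ) + t - N / 2| = |y| / 2 := by
      rw [show (i : ℝ) + t - N / 2 = -(y / 2) by rw [hy]; ring, abs_neg, abs_div]
      norm_num
    rw [h1] at hcore
    have h2 : 0 ≤ Real.sqrt (N * Real.log N) := Real.sqrt_nonneg _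
    have h3 : Real.sqrt (N * Real.log N) ^ 2 = N * Real.log N := Real.sq_sqrt (by positivity)
    have h4 : |y| ^ 2 = y ^ 2 := sq_abs y
    nlinarith
  have hneg : -y ^ 2 / N * (1 / 2 - y / N) = -(y ^ 2 / N * (1 / 2 - y / N)) := by ring
  rw [hneg]
  have hy3 : 324 / 100 * Real.log N ≤ y ^ 2 / N := by
    rw [le_div_iff₀ hN0]; linarith
  have hy0 : 0 ≤ y ^ 2 / N := by positivity
  rcases le_or_gt (y / N) (1 / 100) with h | h
  · have h6 : y ^ 2 / N * (49 / 100) ≤ y ^ 2 / N * (1 / 2 - y / N) :=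
      mul_le_mul_of_nonneg_left (by linarith) hy0
    linarith
  · have h5 : (1 / 100) ^ 2 * N ≤ y ^ 2 / N := by
      have : y ^ 2 / N = (y / N) ^ 2 * N := by field_simp
      rw [this]
      gcongr
    have h6 : y ^ 2 / N * (4 / 100) ≤ y ^ 2 / N * (1 / 2 - y / N) :=
      mul_le_mul_of_nonneg_left (by linarith) hy0
    linarith

/-- In the core y is of order at most √(N log N), so the bias y³ / N² in the exponent tends to zero
and the fair-coin value is asymptotically an upper bound. -/
lemma core_term_le (s : Sampling) (D : ℕ) {δ : ℝ} (hδ : 0 < δ) :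
    ∀ᶠ N : ℕ in atTop, ∀ i t : ℕ, i ≤ D → t ≤ N - D → IsCore N (i + t) →
    ((N - D).choose t : ℝ) * (inPr s N (i + t) ^ t * outPr s N (i + t) ^ (N - D - t))
      ≤ ((N - D).choose t : ℝ) / 2 ^ (N - D) * Real.exp δ := by
  have hlarge : ∀ᶠ N : ℕ in atTop, (8 * D + 50) / δ + 3 ≤ (N : ℝ) ^ (1 / 5 : ℝ) :=
    ((tendsto_rpow_atTop (by norm_num)).comp tendsto_natCast_atTop_atTop).eventually_ge_atTop _
  filter_upwards [eventually_ge_atTop 10, eventually_gt_atTop D, hlarge,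
    eventually_log_le (c := 1 / 4) (by norm_num) (a := 1 / 5) (by norm_num)]
    with N hN hDN hZ hlog i t hi ht hcore
  have hN' : (10 : ℝ) ≤ N := by exact_mod_cast hN
  have hN0 : (0 : ℝ) < N := by linarith
  -- In powers of Z = N^(1/5), the core has |y| ≤ Z³, so the numerators are O(Z⁹) against N² = Z¹⁰.
  set Z : ℝ := (N : ℝ) ^ (1 / 5 : ℝ) with hZdef
  have hZ5 : Z ^ 5 = N := by
    rw [hZdef, ← Real.rpow_natCast, ← Real.rpow_mul hN0.le]; norm_num
  have hδ' : (0 : ℝ) < (8 * D + 50) / δ := by positivity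
  have hZ3 : 3 ≤ Z := by linarith
  have hi' : (i : ℝ) ≤ D := by exact_mod_cast hi
  have hi0 : (0 : ℝ) ≤ i := by positivity
  set y : ℝ := (N : ℝ) - 2 * (i + t) with hy
  have hyZ : |y| ≤ Z ^ 3 := by
    unfold IsCore at hcore
    push_cast at hcore
    have h1 : |(i : ℝ) + t - N / 2| = |y| / 2 := by
      rw [show (i : ℝ) + t - N / 2 = -(y / 2) by rw [hy]; ring, abs_neg, abs_div]
      norm_num
    rw [h1] at hcore
    have h2 : Real.sqrt (N * Real.log N) ≤ Z ^ 3 / 2 := by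
      rw [Real.sqrt_le_left (by positivity)]
      calc (N : ℝ) * Real.log N ≤ N * (1 / 4 * Z) := by gcongr
        _ = (Z ^ 3 / 2) ^ 2 := by rw [← hZ5]; ring
    have h3 : 0 ≤ Z ^ 3 := by positivity
    linarith
  have hden0 : ((N : ℝ) - 1) * (N - 2) = N ^ 2 - 3 * N + 2 := by ring
  have hden : 0 < ((N : ℝ) - 1) * (N - 2) := mul_pos (by linarith) (by linarith)
  have hbound : ∀ A : ℝ, A ≤ (|y| + D) * (y ^ 2 + N) + 2 * |y| * N →
      A / (((N : ℝ) - 1) * (N - 2)) ≤ δ := by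
    intro A hA
    have hden' : (N : ℝ) ^ 2 / 2 ≤ ((N : ℝ) - 1) * (N - 2) := by nlinarith
    have hnum : (|y| + D) * (y ^ 2 + N) + 2 * |y| * N ≤ (4 + 2 * D) * Z ^ 9 := by
      have h1 : y ^ 2 ≤ Z ^ 6 := by
        rw [← sq_abs]; calc |y| ^ 2 ≤ (Z ^ 3) ^ 2 := by gcongr
          _ = Z ^ 6 := by ring
      have h2 : (N : ℝ) ≤ Z ^ 6 := by
        rw [← hZ5]; exact pow_le_pow_right₀ (by linarith) (by norm_num)
      have h3 : (D : ℝ) ≤ D * Z ^ 3 := by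
        have : (1 : ℝ) ≤ Z ^ 3 := one_le_pow₀ (by linarith)
        have hD0 : (0 : ℝ) ≤ D := by positivity
        nlinarith
      calc (|y| + D) * (y ^ 2 + N) + 2 * |y| * N
          ≤ (Z ^ 3 + D * Z ^ 3) * (Z ^ 6 + Z ^ 6) + 2 * Z ^ 3 * Z ^ 6 := by gcongr
        _ = (4 + 2 * D) * Z ^ 9 := by ring
    have hZ10 : (N : ℝ) ^ 2 = Z ^ 10 := by rw [← hZ5]; ring
    rw [div_le_iff₀ hden]
    have h4 : 8 * D + 50 ≤ δ * Z := by
      have : (8 * D + 50) / δ ≤ Z := by linarith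
      rw [div_le_iff₀ hδ] at this
      linarith
    have h5 : (4 + 2 * D) * Z ^ 9 ≤ δ * (Z ^ 10 / 2) := by
      have h9 : 0 ≤ Z ^ 9 := by positivity
      have : (4 + 2 * (D : ℝ)) ≤ δ * Z / 2 := by
        have hD0 : (0 : ℝ) ≤ D := by positivity
        linarith
      calc (4 + 2 * (D : ℝ)) * Z ^ 9 ≤ δ * Z / 2 * Z ^ 9 := by gcongr
        _ = _ := by ring
    calc A ≤ _ := hA
      _ ≤ _ := hnum
      _ ≤ _ := h5
      _ = δ * ((N : ℝ) ^ 2 / 2) := by rw [hZ10]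
      _ ≤ _ := by gcongr
  refine choose_mul_le_exp s (by omega) ht ?_
  have hsmall : 3 * Z ^ 3 ≤ N := by
    rw [← hZ5]
    calc 3 * Z ^ 3 ≤ (3 * 3) * Z ^ 3 := by gcongr; norm_num
      _ ≤ (Z * Z) * Z ^ 3 := by gcongr
      _ = Z ^ 5 := by ring
  have hyN : |y| ≤ N / 3 := by linarith
  have hy' := abs_le.1 hyN
  have hk1 : 1 ≤ i + t := by
    have : (0 : ℝ) < (i : ℝ) + t := by rw [hy] at hy'; linarith
    have h : 0 < i + t := by exact_mod_cast this
    omega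
  have hk2 : i + t ≤ N - 1 := by
    have : (i : ℝ) + t < N := by rw [hy] at hy'; linarith
    have h : i + t < N := by exact_mod_cast this
    omega
  set y₁ : ℝ := ((N - D : ℕ) : ℝ) - 2 * t with hy₁
  have hyy : y₁ = y - (D - 2 * i) := by rw [hy, hy₁]; push_cast [hDN.le]; ring
  have hy₁le : |y₁| ≤ |y| + D := by
    rw [hyy]
    refine (abs_sub _ _).trans ?_
    gcongr
    rw [abs_le]; constructor <;> linarith
  have hN1 : ((N - D - t : ℕ) : ℝ) = ((N - D : ℕ) : ℝ) - t := by push_cast [ht]; ring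
  have hN2 : ((N - D : ℕ) : ℝ) ≤ N := by exact_mod_cast Nat.sub_le _ _
  have hN3 : (0 : ℝ) ≤ ((N - D : ℕ) : ℝ) := by positivity
  rw [hN1]
  cases s with
  | withReplacement =>
    simp only [inPr, outPr, splitIn, splitOut, totalPairs]
    push_cast [show i + t ≤ N by omega]
    have h1 : (t : ℝ) * (2 * (2 * (((i : ℝ) + t) * (N - (i + t))) / (N * N)) - 1)
        + (((N - D : ℕ) : ℝ) - t) * (2 * (1 - 2 * (((i : ℝ) + t) * (N - (i + t))) / (N * N)) - 1)
        = y₁ * y ^ 2 / N ^ 2 := by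
      rw [hy₁, hy]; field_simp; ring
    rw [h1]
    have h2 : |y₁ * y ^ 2| ≤ (|y| + D) * (y ^ 2 + N) + 2 * |y| * N := by
      rw [abs_mul, abs_of_nonneg (sq_nonneg y)]
      have : |y₁| * y ^ 2 ≤ (|y| + D) * y ^ 2 := by gcongr
      have : 0 ≤ (|y| + D) * N + 2 * |y| * N := by positivity
      linarith
    refine le_trans ?_ (hbound _ h2)
    calc y₁ * y ^ 2 / N ^ 2 ≤ |y₁ * y ^ 2| / N ^ 2 := by gcongr; exact le_abs_self _
      _ ≤ _ := by
        apply div_le_div_of_nonneg_left (abs_nonneg _) hden (by linarith)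
  | withoutReplacement =>
    simp only [inPr, outPr, totalPairs_withoutReplacement_cast (show 3 ≤ N by omega), splitIn,
      splitOut]
    push_cast [show i + t ≤ N by omega, hk1, hk2, show 1 ≤ N by omega]
    have hd1 : (N : ℝ) - 1 ≠ 0 := by intro h; linarith
    have hd2 : (N : ℝ) - 2 ≠ 0 := by intro h; linarith
    have h1 : (t : ℝ) * (2 * (2 * (((i : ℝ) + t - 1) * (N - (i + t))) / ((N - 1) * (N - 2))) - 1)
        + (((N - D : ℕ) : ℝ) - t)
          * (2 * (1 - 2 * (((i : ℝ) + t) * (N - 1 - (i + t))) / ((N - 1) * (N - 2))) - 1)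
        = (y₁ * (y ^ 2 - N + 2) - 2 * y * ((N - D : ℕ) : ℝ)) / ((N - 1) * (N - 2)) := by
      rw [hy₁, hy]; field_simp; ring
    rw [h1]
    apply hbound
    have h2 : |y ^ 2 - N + 2| ≤ y ^ 2 + N := by
      have := sq_nonneg y
      rw [abs_le]; constructor <;> linarith
    have h3 : y₁ * (y ^ 2 - N + 2) ≤ (|y| + D) * (y ^ 2 + N) := by
      refine (le_abs_self _).trans ?_
      rw [abs_mul]
      gcongr
    have h4 : -(2 * y * ((N - D : ℕ) : ℝ)) ≤ 2 * |y| * N := by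
      calc -(2 * y * ((N - D : ℕ) : ℝ)) = 2 * (-y) * ((N - D : ℕ) : ℝ) := by ring
        _ ≤ 2 * |y| * N := by gcongr; exact neg_le_abs y
    linarith

variable {ι : Type} [Fintype ι] [DecidableEq ι]

/-- The expected number of small vectors that are orthogonal to the columns off `J`. -/
lemma sum_small_le (s : Sampling) (J : Finset ι) (hN : 3 ≤ Fintype.card ι)
    (hJ : 50 * J.card ≤ Fintype.card ι) :
    ∑ S : Finset ι with 100 * S.card ≤ 27 * Fintype.card ι,
      pr s (fun e => ∀ j ∈ Jᶜ, Orth (chi S) j (e j)) ≤ (3 / 2) ^ J.card / (1 - rho) := by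
  rw [sum_pr_orth s hN J fun k => 100 * k ≤ 27 * Fintype.card ι]
  have hr0 := rho_pos
  have hr1 := rho_lt_one
  calc _ ≤ ∑ I ∈ J.powerset, (1 / 2 : ℝ) ^ I.card * (1 / (1 - rho)) := by
        refine Finset.sum_le_sum fun I hI => ?_
        calc _ ≤ ∑ t ∈ Finset.range (Fintype.card ι - J.card + 1),
              (1 / 2 : ℝ) ^ I.card * rho ^ t := by
              refine Finset.sum_le_sum fun t ht => ?_
              split_ifs with h
              · exact small_term_le s hN hJ (by simpa [Nat.lt_succ_iff] using ht) h
              · rw [mul_zero]; positivity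
          _ ≤ _ := by
              rw [← Finset.mul_sum]
              gcongr
              rw [one_div]
              exact (Summable.sum_le_tsum _ (fun _ _ => by positivity)
                (summable_geometric_of_lt_one hr0.le hr1)).trans_eq
                (tsum_geometric_of_lt_one hr0.le hr1)
    _ = _ := by
      -- The weights `(1 / 2) ^ |I|` over the subsets of `J` add up to `(3 / 2) ^ |J|`, which is of
      -- smaller order than the `2 ^ |J|` vectors near half.
      rw [← Finset.sum_mul, Finset.sum_powerset_apply_card (fun n => (1 / 2 : ℝ) ^ n)]
      have := add_pow (1 / 2 : ℝ) 1 J.card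
      simp only [one_pow, mul_one] at this
      rw [div_eq_mul_one_div (_ ^ _) (1 - rho), show (3 / 2 : ℝ) = 1 / 2 + 1 by norm_num, this]
      congr 1
      exact Finset.sum_congr rfl fun n _ => by rw [nsmul_eq_mul, mul_comm]

lemma sum_geometric_gt_le (w n : ℕ) :
    ∑ t ∈ Finset.range n, (if w < t then rho ^ t else 0) ≤ rho ^ w / (1 - rho) := by
  have hr0 := rho_pos
  have hr1 := rho_lt_one
  calc _ ≤ ∑ t ∈ Finset.range (w + n), (if w ≤ t then rho ^ t else 0) := by
        refine (Finset.sum_le_sum_of_subset_of_nonneg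
          (Finset.range_subset_range.2 (Nat.le_add_left n w)) fun _ _ _ => by positivity).trans ?_
        refine Finset.sum_le_sum fun t _ => ?_
        split_ifs <;> first | omega | positivity | exact le_rfl
    _ = ∑ t ∈ Finset.range n, rho ^ w * rho ^ t := by
        rw [Finset.sum_range_add]
        rw [Finset.sum_eq_zero, zero_add]
        · exact Finset.sum_congr rfl fun t _ => by rw [if_pos (by omega), pow_add]
        · intro t ht
          rw [if_neg]; simpa using ht
    _ ≤ _ := by
        rw [← Finset.mul_sum, div_eq_mul_inv]
        gcongr
        exact (Summable.sum_le_tsum _ (fun _ _ => by positivity)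
          (summable_geometric_of_lt_one hr0.le hr1)).trans_eq (tsum_geometric_of_lt_one hr0.le hr1)

/-- The expected number of small vectors off `J` that are not very small and are orthogonal to the
columns off `J`. -/
lemma sum_small_disjoint_le (s : Sampling) (J : Finset ι) (w : ℕ) (hN : 3 ≤ Fintype.card ι)
    (hJ : 50 * J.card ≤ Fintype.card ι) :
    ∑ S ∈ (Jᶜ).powerset with w < S.card ∧ 100 * S.card ≤ 27 * Fintype.card ι,
      pr s (fun e => ∀ j ∈ Jᶜ, Orth (chi S) j (e j)) ≤ rho ^ w / (1 - rho) := by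
  refine le_trans ?_ (sum_geometric_gt_le w (Fintype.card ι - J.card + 1))
  rw [Finset.sum_filter]
  set F : ℕ → ℝ := fun t => if w < t ∧ 100 * t ≤ 27 * Fintype.card ι then
        inPr s (Fintype.card ι) t ^ t
          * outPr s (Fintype.card ι) t ^ (Fintype.card ι - J.card - t) else 0 with hF
  have h : ∀ S ∈ (Jᶜ).powerset, (if w < S.card ∧ 100 * S.card ≤ 27 * Fintype.card ι then
      pr s (fun e => ∀ j ∈ Jᶜ, Orth (chi S) j (e j)) else 0)
      = F S.card := by
    intro S hS
    rw [Finset.mem_powerset] at hS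
    have h1 : S \ J = S := by
      rw [Finset.sdiff_eq_self_iff_disjoint, Finset.disjoint_left]
      exact fun x hx => by simpa using hS hx
    simp only [pr_orth s hN, h1, hF]
  rw [Finset.sum_congr rfl h, Finset.sum_powerset_apply_card F, Finset.card_compl]
  refine Finset.sum_le_sum fun t ht => ?_
  rw [nsmul_eq_mul, hF]
  dsimp only
  split_ifs with h1 h2 h2
  · have := small_term_le s (i := 0) hN hJ (by simpa [Nat.lt_succ_iff] using ht)
      (by simpa using h1.2)
    simpa using this
  · exact absurd h1.1 h2
  · rw [mul_zero]; have := rho_pos; positivity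
  · simp

/-- The expected number of vectors that are neither small nor close to half of the rows tends to
zero. -/
lemma sum_noncore_le (s : Sampling) (D : ℕ) {ε : ℝ} (hε : 0 < ε) :
    ∀ᶠ N : ℕ in atTop, ∀ (ι : Type) [Fintype ι] [DecidableEq ι] (J : Finset ι)
      (Q : ℕ → Prop) [DecidablePred Q], (∀ k, Q k → 27 * N < 100 * k ∧ ¬ IsCore N k) →
      Fintype.card ι = N → J.card = D →
      ∑ S : Finset ι with Q S.card, pr s (fun e => ∀ j ∈ Jᶜ, Orth (chi S) j (e j)) ≤ ε := by
  have hlim : Tendsto (fun N : ℕ => 2 ^ D * (2 * Real.exp (2 * D + 4))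
      * (N : ℝ) ^ (-(1 / 2) : ℝ)) atTop (nhds (2 ^ D * (2 * Real.exp (2 * D + 4)) * 0)) :=
    ((tendsto_rpow_neg_atTop (by norm_num)).comp tendsto_natCast_atTop_atTop).const_mul _
  rw [mul_zero] at hlim
  filter_upwards [eventually_ge_atTop 3, noncore_term_le s D, eventually_gt_atTop D,
    hlim.eventually_le_const hε] with N hN hterm hD hl ι _ _ J Q _ hQ hcard hJ
  subst hcard
  rw [sum_pr_orth s hN J Q, hJ]
  set N := Fintype.card ι
  have hN0 : (0 : ℝ) < N := by positivity
  refine le_trans ?_ hl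
  calc _ ≤ ∑ I ∈ J.powerset, ∑ t ∈ Finset.range (N - D + 1),
        Real.exp (2 * D + 4) * (N : ℝ) ^ (-(3 / 2) : ℝ) := by
        refine Finset.sum_le_sum fun I hI => Finset.sum_le_sum fun t ht => ?_
        split_ifs with h
        · refine hterm _ _ ?_ (by simpa [Nat.lt_succ_iff] using ht) (hQ _ h).1 (hQ _ h).2
          rw [← hJ]
          exact Finset.card_le_card (Finset.mem_powerset.1 hI)
        · rw [mul_zero]; positivity
    _ = 2 ^ D * (((N - D + 1 : ℕ) : ℝ) * (Real.exp (2 * D + 4) * (N : ℝ) ^ (-(3 / 2) : ℝ))) := by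
        rw [Finset.sum_const, Finset.sum_const, Finset.card_powerset, hJ, Finset.card_range]
        simp
    _ ≤ 2 ^ D * ((2 * N) * (Real.exp (2 * D + 4) * (N : ℝ) ^ (-(3 / 2) : ℝ))) := by
        gcongr
        norm_cast
        omega
    _ = _ := by
        have : (N : ℝ) * (N : ℝ) ^ (-(3 / 2) : ℝ) = (N : ℝ) ^ (-(1 / 2) : ℝ) := by
          rw [← Real.rpow_one_add' hN0.le (by norm_num)]; norm_num
        rw [← this]; ring

/-- The expected number of vectors of size close to half of the rows that are orthogonal to all
but `D` columns is about `2 ^ D`. -/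
lemma sum_core_le (s : Sampling) (D : ℕ) {ε : ℝ} (hε : 0 < ε) :
    ∀ᶠ N : ℕ in atTop, ∀ (ι : Type) [Fintype ι] [DecidableEq ι] (J : Finset ι)
      (Q : ℕ → Prop) [DecidablePred Q], (∀ k, Q k → IsCore N k) →
      Fintype.card ι = N → J.card = D →
      ∑ S : Finset ι with Q S.card, pr s (fun e => ∀ j ∈ Jᶜ, Orth (chi S) j (e j))
        ≤ 2 ^ D * (1 + ε) := by
  have hlog : 0 < Real.log (1 + ε) := Real.log_pos (by linarith)
  filter_upwards [eventually_ge_atTop 3, core_term_le s D hlog]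
    with N hN hterm ι _ _ J Q _ hQ hcard hJ
  subst hcard
  rw [sum_pr_orth s hN J Q, hJ]
  set N := Fintype.card ι
  rw [Real.exp_log (by linarith)] at hterm
  calc _ ≤ ∑ I ∈ J.powerset, ∑ t ∈ Finset.range (N - D + 1),
        ((N - D).choose t : ℝ) / 2 ^ (N - D) * (1 + ε) := by
        refine Finset.sum_le_sum fun I hI => Finset.sum_le_sum fun t ht => ?_
        split_ifs with h
        · refine hterm _ _ ?_ (by simpa [Nat.lt_succ_iff] using ht) (hQ _ h)
          rw [← hJ]
          exact Finset.card_le_card (Finset.mem_powerset.1 hI)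
        · rw [mul_zero]; positivity
    _ = _ := by
        rw [Finset.sum_const, Finset.card_powerset, hJ, ← Finset.sum_mul, ← Finset.sum_div]
        have := Nat.sum_range_choose (N - D)
        rw [← Nat.cast_sum, this]
        simp [mul_add]

end FirstMoments

/-! ### Small closed sets and a switching argument to avoid them. -/

section ClosedSets

set_option linter.unusedSectionVars false

variable {ι : Type} [Fintype ι] [DecidableEq ι]

/-- The condition on column `j` for `T` to be closed: exactly one of the random rows lies in `T`
if `j` does, and none otherwise. -/
def ClosedCol (T : Finset ι) (j : ι) (p : ι × ι) : Prop :=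
  (j ∈ T → (p.1 ∈ T ↔ p.2 ∉ T)) ∧ (j ∉ T → p.1 ∉ T ∧ p.2 ∉ T)

/-- The random rows of the columns of `T` link `T` to itself exactly once, and no other column
meets `T`. -/
def ClosedSet (T : Finset ι) (e : ι → ι × ι) : Prop := ∀ j, ClosedCol T j (e j)

/-- There is no nonempty closed set of at most `w` rows. -/
def NoClosedSet (w : ℕ) (e : ι → ι × ι) : Prop :=
  ∀ T : Finset ι, T.Nonempty → T.card ≤ w → ¬ ClosedSet T e

lemma ClosedCol.orth {T : Finset ι} {j : ι} {p : ι × ι} (h : ClosedCol T j p) :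
    Orth (chi T) j p := by
  rw [orth_chi_iff]
  unfold ClosedCol at h
  tauto

lemma half_sq_le_totalPairs (s : Sampling) {N : ℕ} (hN : 6 ≤ N) :
    (N : ℝ) ^ 2 / 2 ≤ totalPairs s N := by
  have hN' : (6 : ℝ) ≤ N := by exact_mod_cast hN
  cases s with
  | withReplacement => simp only [totalPairs]; push_cast; nlinarith
  | withoutReplacement =>
    rw [totalPairs_withoutReplacement_cast (by omega)]; nlinarith

lemma colPr_le (s : Sampling) (hN : 6 ≤ Fintype.card ι) (j : ι) (Q : ι × ι → Prop)
    (A : Finset (ι × ι)) (hQ : ∀ p, Q p → p ∈ A) {m : ℝ} (hm : (A.card : ℝ) ≤ m) :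
    colPr s j Q ≤ 2 * m / (Fintype.card ι : ℝ) ^ 2 := by
  classical
  have h1 := half_sq_le_totalPairs s hN
  have hN' : (0 : ℝ) < Fintype.card ι := by positivity
  have hm0 : 0 ≤ m := le_trans (by positivity) hm
  rw [colPr_def, card_pairs]
  calc _ ≤ m / ((Fintype.card ι : ℝ) ^ 2 / 2) := by
        gcongr
        refine le_trans ?_ hm
        exact_mod_cast Finset.card_le_card fun p hp => hQ p (Finset.mem_filter.1 hp).2
    _ = _ := by field_simp

lemma card_meet_le (S : Finset ι) :
    ((S ×ˢ Finset.univ ∪ Finset.univ ×ˢ S : Finset (ι × ι)).card : ℝ)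
      ≤ 2 * S.card * Fintype.card ι := by
  norm_cast
  refine (Finset.card_union_le _ _).trans ?_
  rw [Finset.card_product, Finset.card_product, Finset.card_univ]
  apply le_of_eq; ring

lemma colPr_meet_le (s : Sampling) (hN : 6 ≤ Fintype.card ι) (S : Finset ι) (j : ι) :
    colPr s j (fun p => p.1 ∈ S ∨ p.2 ∈ S) ≤ 4 * S.card / Fintype.card ι := by
  have hN' : (0 : ℝ) < Fintype.card ι := by positivity
  refine (colPr_le s hN j _ (S ×ˢ Finset.univ ∪ Finset.univ ×ˢ S) ?_ (card_meet_le S)).trans_eq ?_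
  · intro p hp; simpa using hp
  · field_simp; ring

lemma colPr_split_le (s : Sampling) (hN : 6 ≤ Fintype.card ι) (S : Finset ι) (j : ι) :
    colPr s j (fun p => p.1 ∈ S ↔ p.2 ∉ S) ≤ 4 * S.card / Fintype.card ι :=
  (colPr_mono fun p _ h => by tauto).trans (colPr_meet_le s hN S j)

lemma pr_coord (s : Sampling) (hN : 3 ≤ Fintype.card ι) (j : ι) (Q : ι × ι → Prop) :
    pr s (fun e => Q (e j)) = colPr s j Q := by
  have := pr_forall_mem (s := s) hN {j} (fun _ => Q)
  simpa using this

/-- There are at most N^l sets of size l, which cancels the denominators; the bound does not depend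
on N. -/
lemma sum_pow_card_le (m : ℕ) (hN : 0 < Fintype.card ι) {c : ℝ} (hc : 0 ≤ c) :
    ∑ S : Finset ι with S.card ≤ m, (c / Fintype.card ι) ^ S.card
      ≤ ∑ l ∈ Finset.range (m + 1), c ^ l := by
  have hN' : (0 : ℝ) < Fintype.card ι := by exact_mod_cast hN
  rw [Finset.sum_filter, ← Finset.powerset_univ,
    Finset.sum_powerset_apply_card (fun l => if l ≤ m then (c / Fintype.card ι) ^ l else 0)]
  simp only [smul_ite, smul_zero, Finset.card_univ]
  rw [← Finset.sum_filter]
  refine (Finset.sum_le_sum fun l _ => ?_).trans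
    (Finset.sum_le_sum_of_subset_of_nonneg (f := fun l => c ^ l)
      (s := (Finset.range (Fintype.card ι + 1)).filter (· ≤ m)) ?_ fun _ _ _ => by positivity)
  · rw [nsmul_eq_mul, div_pow, ← mul_div_assoc, div_le_iff₀ (by positivity), mul_comm]
    gcongr
    exact_mod_cast Nat.choose_le_pow _ _
  · intro l hl
    rw [Finset.mem_filter] at hl
    exact Finset.mem_range.2 (by omega)

/-- Replacing the columns of a closed set `L` by columns that do not meet `L`. -/
lemma pr_closed_maximal_le (s : Sampling) (w m : ℕ) (hN : 6 ≤ Fintype.card ι) (L : Finset ι)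
    (hL : L.card ≤ m) (hm : 8 * m ≤ Fintype.card ι) :
    pr s (fun e => ClosedSet L e ∧ ∀ T : Finset ι, Disjoint L T → T.Nonempty → T.card ≤ w →
        ¬ ∀ j ∉ L, ClosedCol T j (e j))
      ≤ (8 * m / Fintype.card ι) ^ L.card * pr s (NoClosedSet (ι := ι) w) := by
  have hN' : (0 : ℝ) < Fintype.card ι := by positivity
  have hL' : (L.card : ℝ) ≤ m := by exact_mod_cast hL
  have hm' : (8 : ℝ) * m ≤ Fintype.card ι := by exact_mod_cast hm
  -- `R` is the part of the event that concerns the columns off `L`. Given `R`, that `L` is closed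
  -- costs at most `(4 * m / N) ^ |L|`, while the columns of `L` miss `L` with probability at least
  -- `(1 / 2) ^ |L|`; the quotient is the factor in the statement.
  set R : (ι → ι × ι) → Prop := fun e => (∀ j ∉ L, (e j).1 ∉ L ∧ (e j).2 ∉ L) ∧
    ∀ T : Finset ι, Disjoint L T → T.Nonempty → T.card ≤ w → ¬ ∀ j ∉ L, ClosedCol T j (e j)
    with hRdef
  have hR : ∀ e e' : ι → ι × ι, (∀ j ∉ L, e j = e' j) → (R e ↔ R e') := by
    intro e e' h
    simp only [hRdef]
    refine and_congr (forall₂_congr fun j hj => by rw [h j hj]) (forall₄_congr fun T _ _ _ => ?_)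
    exact not_congr (forall₂_congr fun j hj => by rw [h j hj])
  have hloc : ∀ Q : ι → ι × ι → Prop, ∀ e e' : ι → ι × ι, (∀ j ∈ L, e j = e' j) →
      ((∀ j ∈ L, Q j (e j)) ↔ (∀ j ∈ L, Q j (e' j))) :=
    fun Q e e' h => forall₂_congr fun j hj => by rw [h j hj]
  have h1 : pr s (fun e => ClosedSet L e ∧ ∀ T : Finset ι, Disjoint L T → T.Nonempty →
      T.card ≤ w → ¬ ∀ j ∉ L, ClosedCol T j (e j))
      ≤ pr s (fun e => ∀ j ∈ L, ((e j).1 ∈ L ↔ (e j).2 ∉ L)) * pr s R := by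
    rw [← pr_and_eq_mul (by omega) L (hloc fun _ p => p.1 ∈ L ↔ p.2 ∉ L) hR]
    exact pr_mono fun e _ he => ⟨fun j hj => (he.1 j).1 hj, fun j hj => (he.1 j).2 hj, he.2⟩
  have h2 : pr s (fun e => ∀ j ∈ L, ¬ ((e j).1 ∈ L ∨ (e j).2 ∈ L)) * pr s R
      ≤ pr s (NoClosedSet (ι := ι) w) := by
    rw [← pr_and_eq_mul (by omega) L (hloc fun _ p => ¬ (p.1 ∈ L ∨ p.2 ∈ L)) hR]
    refine pr_mono fun e _ he T hT hTw hcl => ?_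
    obtain ⟨hin, hout, hno⟩ := he
    have hnot : ∀ j, (e j).1 ∉ L ∧ (e j).2 ∉ L := by
      intro j
      by_cases hj : j ∈ L
      · exact not_or.1 (hin j hj)
      · exact hout j hj
    -- No column meets `L` now, so deleting `L` from a closed set keeps the conditions on the
    -- columns off `L`. It leaves a nonempty set, because a column of `T` has a random row in `T`,
    -- which is not in `L`.
    refine hno (T \ L) Finset.disjoint_sdiff ?_
      ((Finset.card_le_card Finset.sdiff_subset).trans hTw) ?_
    · obtain ⟨j, hj⟩ := hT
      have h3 := (hcl j).1 hj
      by_cases h4 : (e j).1 ∈ T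
      · exact ⟨_, Finset.mem_sdiff.2 ⟨h4, (hnot j).1⟩⟩
      · exact ⟨(e j).2, Finset.mem_sdiff.2 ⟨by tauto, (hnot j).2⟩⟩
    · intro j hj
      have h5 := hcl j
      have h6 := hnot j
      unfold ClosedCol at h5 ⊢
      simp only [Finset.mem_sdiff]
      tauto
  have h3 : pr s (fun e => ∀ j ∈ L, ((e j).1 ∈ L ↔ (e j).2 ∉ L))
      ≤ (4 * m / Fintype.card ι) ^ L.card := by
    rw [pr_forall_mem (by omega) L fun _ p => p.1 ∈ L ↔ p.2 ∉ L, ← Finset.prod_const]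
    refine Finset.prod_le_prod (fun _ _ => colPr_nonneg) fun j _ => ?_
    refine (colPr_split_le s hN L j).trans ?_
    gcongr
  have h4 : (1 / 2 : ℝ) ^ L.card ≤ pr s (fun e => ∀ j ∈ L, ¬ ((e j).1 ∈ L ∨ (e j).2 ∈ L)) := by
    rw [pr_forall_mem (by omega) L fun _ p => ¬ (p.1 ∈ L ∨ p.2 ∈ L), ← Finset.prod_const]
    refine Finset.prod_le_prod (fun _ _ => by norm_num) fun j _ => ?_
    rw [colPr_not (by omega)]
    have h5 := colPr_meet_le s hN L j
    have h6 : 4 * (L.card : ℝ) / Fintype.card ι ≤ 1 / 2 := by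
      rw [div_le_iff₀ hN']; linarith
    linarith
  calc _ ≤ _ := h1
    _ ≤ (4 * m / Fintype.card ι) ^ L.card * pr s R := by gcongr; exact pr_nonneg
    _ = (8 * m / Fintype.card ι) ^ L.card * ((1 / 2) ^ L.card * pr s R) := by
        rw [← mul_assoc, ← mul_pow]; congr 2; ring
    _ ≤ _ := by
        gcongr
        exact (mul_le_mul_of_nonneg_right h4 pr_nonneg).trans h2

/-- A set that is closed off a closed set `L` rarely meets a column of `L`. -/
lemma pr_closed_hit_le (s : Sampling) (w m : ℕ) (hN : 6 ≤ Fintype.card ι) (L T : Finset ι)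
    (hL : L.card ≤ m) (hT : T.card ≤ w) (hLT : Disjoint L T) {j : ι} (hj : j ∈ L) :
    pr s (fun e => ClosedSet L e ∧ (∀ j ∉ L, ClosedCol T j (e j)) ∧ ¬ ClosedCol T j (e j))
      ≤ 1 / Fintype.card ι * ((4 * (m + w + 1) ^ 2 / Fintype.card ι) ^ L.card
        * (4 * (m + w + 1) ^ 2 / Fintype.card ι) ^ T.card) := by
  classical
  have hN' : (0 : ℝ) < Fintype.card ι := by positivity
  have hL' : (L.card : ℝ) ≤ m := by exact_mod_cast hL
  have hT' : (T.card : ℝ) ≤ w := by exact_mod_cast hT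
  set c : ℝ := 4 * ((m : ℝ) + w + 1) ^ 2 with hc
  have hm0 : (0 : ℝ) ≤ m := by positivity
  have hw0 : (0 : ℝ) ≤ w := by positivity
  have hjT : j ∉ T := Finset.disjoint_left.1 hLT hj
  -- Every column of `L ∪ T` has a random row in a small prescribed set; in column `j` both rows are
  -- in small sets, one in `L` and one in `T`. This gives the extra factor 1 / N.
  set R : ι → ι × ι → Prop := fun i p => if i = j then p ∈ (L ×ˢ T ∪ T ×ˢ L) else
    if i ∈ L then (p.1 ∈ L ↔ p.2 ∉ L) else (p.1 ∈ T ↔ p.2 ∉ T) with hR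
  have h1 : pr s (fun e => ClosedSet L e ∧ (∀ j ∉ L, ClosedCol T j (e j)) ∧
      ¬ ClosedCol T j (e j)) ≤ pr s (fun e => ∀ i ∈ L ∪ T, R i (e i)) := by
    refine pr_mono fun e _ he i hi => ?_
    obtain ⟨hcl, hoff, hhit⟩ := he
    simp only [hR]
    split_ifs with h2 h3
    · subst h2
      have h4 := (hcl i).1 hj
      have h5 : (e i).1 ∈ T ∨ (e i).2 ∈ T := by
        unfold ClosedCol at hhit; tauto
      have h6 : ∀ x ∈ T, x ∉ L := fun x hx => Finset.disjoint_right.1 hLT hx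
      simp only [Finset.mem_union, Finset.mem_product]
      rcases h5 with h5 | h5
      · have := h6 _ h5; tauto
      · have := h6 _ h5; tauto
    · exact (hcl i).1 h3
    · exact (hoff i h3).1 ((Finset.mem_union.1 hi).resolve_left h3)
  refine h1.trans ?_
  rw [pr_forall_mem (by omega), ← Finset.mul_prod_erase _ _ (Finset.mem_union_left T hj)]
  have h2 : colPr s j (R j) ≤ c / (Fintype.card ι : ℝ) ^ 2 := by
    have h3 := colPr_le s hN j (R j) (L ×ˢ T ∪ T ×ˢ L) (fun p hp => by
      simpa only [hR, if_true] using hp) le_rfl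
    refine h3.trans ?_
    gcongr
    rw [card_split L T hLT]
    push_cast
    have : (L.card : ℝ) * T.card ≤ m * w := by gcongr
    nlinarith
  have h3 : ∏ i ∈ (L ∪ T).erase j, colPr s i (R i)
      ≤ (c / Fintype.card ι) ^ ((L ∪ T).erase j).card := by
    rw [← Finset.prod_const]
    refine Finset.prod_le_prod (fun _ _ => colPr_nonneg) fun i hi => ?_
    have hij : i ≠ j := Finset.ne_of_mem_erase hi
    by_cases h4 : i ∈ L
    · have : R i = fun p => p.1 ∈ L ↔ p.2 ∉ L := by funext p; simp [hR, hij, h4]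
      rw [this]
      refine (colPr_split_le s hN L i).trans ?_
      gcongr
      nlinarith
    · have : R i = fun p => p.1 ∈ T ↔ p.2 ∉ T := by funext p; simp [hR, hij, h4]
      rw [this]
      refine (colPr_split_le s hN T i).trans ?_
      gcongr
      nlinarith
  have h4 : ((L ∪ T).erase j).card + 1 = L.card + T.card := by
    rw [Finset.card_erase_add_one (Finset.mem_union_left T hj), Finset.card_union_of_disjoint hLT]
  calc _ ≤ c / (Fintype.card ι : ℝ) ^ 2 * (c / Fintype.card ι) ^ ((L ∪ T).erase j).card := by
        gcongr
        exact Finset.prod_nonneg fun _ _ => colPr_nonneg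
    _ = 1 / Fintype.card ι * (c / Fintype.card ι) ^ (((L ∪ T).erase j).card + 1) := by
        rw [pow_succ (c / (Fintype.card ι : ℝ)) ((L ∪ T).erase j).card]
        generalize (c / Fintype.card ι) ^ ((L ∪ T).erase j).card = x
        field_simp
    _ = _ := by rw [h4, pow_add]

lemma exists_rho_pow_le {ε : ℝ} (hε : 0 < ε) : ∃ m : ℕ, rho ^ m / (1 - rho) ≤ ε := by
  have h := (tendsto_pow_atTop_nhds_zero_of_lt_one rho_pos.le rho_lt_one).div_const (1 - rho)
  rw [zero_div] at h
  exact (h.eventually_le_const hε).exists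

/-- Take a largest closed set `L` of size at most `w + m`. If `|L| ≤ m` and a disjoint `T` of size
at most `w` is closed in the columns off `L`, then `T` must violate a column of `L`: otherwise `L ∪
T` would be a larger closed set within the size limit. -/
lemma closed_trichotomy (w m : ℕ) (e : ι → ι × ι) :
    (∃ L : Finset ι, (m < L.card ∧ L.card ≤ w + m) ∧ ClosedSet L e) ∨
    (∃ L : Finset ι, L.card ≤ m ∧ ClosedSet L e ∧ ∀ T : Finset ι, Disjoint L T → T.Nonempty →
      T.card ≤ w → ¬ ∀ j ∉ L, ClosedCol T j (e j)) ∨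
    (∃ L : Finset ι, L.card ≤ m ∧ ∃ T : Finset ι, T.card ≤ w ∧ ∃ j ∈ L, Disjoint L T ∧
      (ClosedSet L e ∧ (∀ j ∉ L, ClosedCol T j (e j)) ∧ ¬ ClosedCol T j (e j))) := by
  classical
  obtain ⟨L, hL, hmax⟩ := Finset.exists_max_image
    (Finset.univ.filter fun L : Finset ι => L.card ≤ w + m ∧ ClosedSet L e) Finset.card
    ⟨∅, Finset.mem_filter.2 ⟨Finset.mem_univ _, by simp, fun j => by simp [ClosedCol]⟩⟩
  simp only [Finset.mem_filter, Finset.mem_univ, true_and] at hL hmax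
  rcases lt_or_ge m L.card with h | h
  · exact Or.inl ⟨L, ⟨h, hL.1⟩, hL.2⟩
  by_cases h2 : ∀ T : Finset ι, Disjoint L T → T.Nonempty → T.card ≤ w →
      ¬ ∀ j ∉ L, ClosedCol T j (e j)
  · exact Or.inr (Or.inl ⟨L, h, hL.2, h2⟩)
  push Not at h2
  obtain ⟨T, hLT, hT, hTw, hoff⟩ := h2
  by_cases h3 : ∀ j ∈ L, ClosedCol T j (e j)
  · exfalso
    have hcard : (L ∪ T).card = L.card + T.card := Finset.card_union_of_disjoint hLT
    have := hmax (L ∪ T) ⟨by omega, fun j => by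
      have h4 : ClosedCol T j (e j) := by
        by_cases hj : j ∈ L
        exacts [h3 j hj, hoff j hj]
      have h5 := hL.2 j
      have h6 : j ∈ L → j ∉ T := fun hj => Finset.disjoint_left.1 hLT hj
      unfold ClosedCol at h4 h5 ⊢
      simp only [Finset.mem_union]
      tauto⟩
    have := hT.card_pos
    omega
  · push Not at h3
    obtain ⟨j, hj, hcol⟩ := h3
    exact Or.inr (Or.inr ⟨L, h, T, hTw, j, hj, hLT, hL.2, hoff, hcol⟩)

/-- The probability that there is no small closed set is bounded away from zero. -/
theorem exists_le_pr_noClosedSet (s : Sampling) : ∃ p : ℝ, 0 < p ∧ ∀ w : ℕ, ∀ᶠ N : ℕ in atTop,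
    ∀ (ι : Type) [Fintype ι] [DecidableEq ι], Fintype.card ι = N →
      p ≤ pr s (NoClosedSet (ι := ι) w) := by
  classical
  -- Here `m` is fixed before `w`, so the final bound is uniform in `w`. The first and third cases
  -- of the trichotomy have probability at most 1 / 4 each, and the second one at most `K` times the
  -- wanted probability.
  obtain ⟨m, hm⟩ := exists_rho_pow_le (ε := 1 / 4) (by norm_num)
  set K : ℝ := ∑ l ∈ Finset.range (m + 1), (8 * (m : ℝ)) ^ l with hK
  have hK1 : 1 ≤ K := by
    rw [hK, Finset.sum_range_succ']
    have : 0 ≤ ∑ l ∈ Finset.range m, (8 * (m : ℝ)) ^ (l + 1) := by positivity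
    simp only [pow_zero]; linarith
  refine ⟨1 / (2 * K), by positivity, fun w => ?_⟩
  set c : ℝ := 4 * ((m : ℝ) + w + 1) ^ 2 with hc
  set K₁ : ℝ := ∑ l ∈ Finset.range (m + 1), c ^ l with hK₁
  set K₂ : ℝ := ∑ l ∈ Finset.range (w + 1), c ^ l with hK₂
  have hlim : Tendsto (fun N : ℕ => m * K₁ * K₂ / (N : ℝ)) atTop (nhds 0) :=
    tendsto_const_div_atTop_nhds_zero_nat _
  filter_upwards [eventually_ge_atTop 6, eventually_ge_atTop (8 * m),
    eventually_ge_atTop (4 * (w + m)), hlim.eventually_le_const (show (0 : ℝ) < 1 / 4 by norm_num)]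
    with N hN hNm hNw hl ι _ _ hcard
  subst hcard
  have hN' : (0 : ℝ) < Fintype.card ι := by positivity
  have h0 : (1 : ℝ) ≤ pr s (fun e : ι → ι × ι =>
        ∃ L ∈ Finset.univ.filter fun L : Finset ι => m < L.card ∧ L.card ≤ w + m, ClosedSet L e)
      + (pr s (fun e : ι → ι × ι => ∃ L ∈ Finset.univ.filter fun L : Finset ι => L.card ≤ m,
        ClosedSet L e ∧ ∀ T : Finset ι, Disjoint L T → T.Nonempty →
          T.card ≤ w → ¬ ∀ j ∉ L, ClosedCol T j (e j))
      + pr s (fun e : ι → ι × ι => ∃ L ∈ Finset.univ.filter fun L : Finset ι => L.card ≤ m,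
        ∃ T ∈ Finset.univ.filter fun T : Finset ι => T.card ≤ w, ∃ j ∈ L, Disjoint L T ∧
          (ClosedSet L e ∧ (∀ j ∉ L, ClosedCol T j (e j)) ∧ ¬ ClosedCol T j (e j)))) := by
    rw [← pr_true (ι := ι) (s := s) (by omega)]
    refine le_trans (pr_mono fun e _ _ => ?_)
      (pr_or_le.trans (add_le_add_right pr_or_le _))
    simpa only [Finset.mem_filter, Finset.mem_univ, true_and] using closed_trichotomy w m e
  have h1 : pr s (fun e : ι → ι × ι =>
      ∃ L ∈ Finset.univ.filter fun L : Finset ι => m < L.card ∧ L.card ≤ w + m, ClosedSet L e)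
      ≤ 1 / 4 := by
    refine (pr_exists_le _ _).trans (le_trans ?_ hm)
    refine le_trans ?_ (sum_small_disjoint_le (ι := ι) s ∅ m (by omega) (by simp))
    refine le_trans (Finset.sum_le_sum fun L _ => pr_mono fun e _ (he : ClosedSet L e) => ?_)
      (Finset.sum_le_sum_of_subset_of_nonneg ?_ fun _ _ _ => pr_nonneg)
    · exact fun j _ => (he j).orth
    · intro L hL
      simp only [Finset.mem_filter, Finset.mem_univ, true_and] at hL
      simp only [Finset.mem_filter, Finset.mem_powerset, Finset.compl_empty]
      exact ⟨Finset.subset_univ _, hL.1, by omega⟩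
  have h2 : pr s (fun e : ι → ι × ι => ∃ L ∈ Finset.univ.filter fun L : Finset ι => L.card ≤ m,
        ClosedSet L e ∧ ∀ T : Finset ι, Disjoint L T → T.Nonempty →
          T.card ≤ w → ¬ ∀ j ∉ L, ClosedCol T j (e j)) ≤ K * pr s (NoClosedSet (ι := ι) w) := by
    refine (pr_exists_le _ _).trans ?_
    refine (Finset.sum_le_sum fun L hL => pr_closed_maximal_le s w m hN L
      (by simpa using hL) hNm).trans ?_
    rw [← Finset.sum_mul]
    gcongr
    · exact pr_nonneg
    · exact sum_pow_card_le m (by omega) (by positivity)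
  have h3 : pr s (fun e : ι → ι × ι => ∃ L ∈ Finset.univ.filter fun L : Finset ι => L.card ≤ m,
        ∃ T ∈ Finset.univ.filter fun T : Finset ι => T.card ≤ w, ∃ j ∈ L, Disjoint L T ∧
          (ClosedSet L e ∧ (∀ j ∉ L, ClosedCol T j (e j)) ∧ ¬ ClosedCol T j (e j))) ≤ 1 / 4 := by
    refine le_trans ?_ hl
    refine (pr_exists_le _ _).trans ?_
    have hterm : ∀ L ∈ Finset.univ.filter fun L : Finset ι => L.card ≤ m,
        pr s (fun e : ι → ι × ι => ∃ T ∈ Finset.univ.filter fun T : Finset ι => T.card ≤ w,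
          ∃ j ∈ L, Disjoint L T ∧
          (ClosedSet L e ∧ (∀ j ∉ L, ClosedCol T j (e j)) ∧ ¬ ClosedCol T j (e j)))
        ≤ (c / Fintype.card ι) ^ L.card * (m * K₂ / Fintype.card ι) := by
      intro L hL
      have hLm : L.card ≤ m := by simpa using hL
      refine (pr_exists_le _ _).trans ?_
      have hterm2 : ∀ T ∈ Finset.univ.filter fun T : Finset ι => T.card ≤ w,
          pr s (fun e : ι → ι × ι => ∃ j ∈ L, Disjoint L T ∧
          (ClosedSet L e ∧ (∀ j ∉ L, ClosedCol T j (e j)) ∧ ¬ ClosedCol T j (e j)))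
          ≤ m * (1 / Fintype.card ι * (c / Fintype.card ι) ^ L.card)
            * (c / Fintype.card ι) ^ T.card := by
        intro T hT
        refine (pr_exists_le _ _).trans ?_
        calc _ ≤ ∑ j ∈ L, 1 / Fintype.card ι * ((c / Fintype.card ι) ^ L.card
                * (c / Fintype.card ι) ^ T.card) := by
              refine Finset.sum_le_sum fun j hj => ?_
              by_cases hLT : Disjoint L T
              · refine (pr_mono fun e _ he => he.2).trans
                  (pr_closed_hit_le s w m hN L T hLm (by simpa using hT) hLT hj)
              · have : pr s (fun e : ι → ι × ι => Disjoint L T ∧ (ClosedSet L e ∧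
                    (∀ j ∉ L, ClosedCol T j (e j)) ∧ ¬ ClosedCol T j (e j))) = 0 := by
                  simp [pr_def, hLT]
                rw [this]
                positivity
          _ = (L.card : ℝ) * (1 / Fintype.card ι * (c / Fintype.card ι) ^ L.card)
                * (c / Fintype.card ι) ^ T.card := by
              rw [Finset.sum_const, nsmul_eq_mul]; ring
          _ ≤ _ := by gcongr
      refine (Finset.sum_le_sum hterm2).trans ?_
      rw [← Finset.mul_sum]
      calc _ ≤ m * (1 / Fintype.card ι * (c / Fintype.card ι) ^ L.card) * K₂ := by
            gcongr
            exact sum_pow_card_le w (by omega) (by positivity)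
        _ = _ := by ring
    refine (Finset.sum_le_sum hterm).trans ?_
    rw [← Finset.sum_mul]
    calc _ ≤ K₁ * (m * K₂ / Fintype.card ι) := by
          gcongr
          exact sum_pow_card_le m (by omega) (by positivity)
      _ = _ := by ring
  rw [div_le_iff₀ (by positivity)]
  nlinarith

/-- Small vectors off `J` that are orthogonal to the columns off `J` mostly come from closed
sets. -/
lemma sum_pr_not_closed_le (s : Sampling) (J : Finset ι) (w : ℕ) (hN : 6 ≤ Fintype.card ι) :
    ∑ S ∈ (Jᶜ).powerset with S.card ≤ w,
      pr s (fun e => (∀ j ∈ Jᶜ, Orth (chi S) j (e j)) ∧ ¬ ClosedSet S e)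
      ≤ (∑ l ∈ Finset.range (w + 1), (4 * (w : ℝ)) ^ l) * (2 * w ^ 2 + J.card * (4 * w))
        / Fintype.card ι := by
  classical
  have hN' : (0 : ℝ) < Fintype.card ι := by positivity
  have hterm : ∀ S ∈ (Jᶜ).powerset.filter fun S => S.card ≤ w,
      pr s (fun e => (∀ j ∈ Jᶜ, Orth (chi S) j (e j)) ∧ ¬ ClosedSet S e)
      ≤ (4 * w / Fintype.card ι) ^ S.card
        * ((2 * w ^ 2 + J.card * (4 * w)) / Fintype.card ι) := by
    intro S hS
    simp only [Finset.mem_filter, Finset.mem_powerset] at hS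
    have hSw : (S.card : ℝ) ≤ w := by exact_mod_cast hS.2
    have hSJ : ∀ x ∈ S, x ∉ J := fun x hx => by simpa using hS.1 hx
    have hsplit : pr s (fun e => ∀ i ∈ S, ((e i).1 ∈ S ↔ (e i).2 ∉ S))
        ≤ (4 * w / Fintype.card ι) ^ S.card := by
      rw [pr_forall_mem (by omega) S fun _ p => p.1 ∈ S ↔ p.2 ∉ S, ← Finset.prod_const]
      refine Finset.prod_le_prod (fun _ _ => colPr_nonneg) fun i _ => ?_
      refine (colPr_split_le s hN S i).trans ?_
      gcongr
    have hcol : ∀ (j : ι) (Q : ι × ι → Prop), j ∉ S → ∀ b : ℝ, colPr s j Q ≤ b →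
        pr s (fun e => (∀ i ∈ S, ((e i).1 ∈ S ↔ (e i).2 ∉ S)) ∧ Q (e j))
          ≤ (4 * w / Fintype.card ι) ^ S.card * b := by
      intro j Q hj b hb
      rw [pr_and_eq_mul (by omega) S
        (fun e e' h => forall₂_congr fun i hi => by rw [h i hi])
        (fun e e' h => by rw [h j hj]), pr_coord s (by omega)]
      gcongr
      exact colPr_nonneg
    -- If closedness fails, some column off `S` meets `S`. Off `J`, orthogonality then puts both of
    -- its random rows in `S`, with probability O(1 / N²) for each of N columns; in `J`, one row
    -- suffices, with probability O(1 / N) for each of boundedly many columns.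
    have h1 : pr s (fun e => (∀ j ∈ Jᶜ, Orth (chi S) j (e j)) ∧ ¬ ClosedSet S e)
        ≤ pr s (fun e => ∃ j ∈ Sᶜ, (∀ i ∈ S, ((e i).1 ∈ S ↔ (e i).2 ∉ S)) ∧
            ((e j).1 ∈ S ∧ (e j).2 ∈ S))
          + pr s (fun e => ∃ j ∈ J, (∀ i ∈ S, ((e i).1 ∈ S ↔ (e i).2 ∉ S)) ∧
            ((e j).1 ∈ S ∨ (e j).2 ∈ S)) := by
      refine le_trans (pr_mono fun e _ he => ?_) pr_or_le
      obtain ⟨ho, hn⟩ := he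
      have hin : ∀ i ∈ S, ((e i).1 ∈ S ↔ (e i).2 ∉ S) := fun i hi =>
        (orth_chi_iff.1 (ho i (hS.1 hi))).1 hi
      unfold ClosedSet at hn
      push Not at hn
      obtain ⟨j, hj⟩ := hn
      have hjS : j ∉ S := fun h => hj ⟨fun _ => hin j h, fun h' => absurd h h'⟩
      have hmeet : (e j).1 ∈ S ∨ (e j).2 ∈ S := by
        unfold ClosedCol at hj; tauto
      by_cases hjJ : j ∈ J
      · exact Or.inr ⟨j, hjJ, hin, hmeet⟩
      · refine Or.inl ⟨j, by simpa using hjS, hin, ?_⟩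
        have := orth_chi_iff.1 (ho j (by simpa using hjJ))
        tauto
    refine h1.trans ?_
    have h2 : ∀ j ∈ Sᶜ, pr s (fun e => (∀ i ∈ S, ((e i).1 ∈ S ↔ (e i).2 ∉ S)) ∧
        ((e j).1 ∈ S ∧ (e j).2 ∈ S))
        ≤ (4 * w / Fintype.card ι) ^ S.card * (2 * w ^ 2 / (Fintype.card ι : ℝ) ^ 2) := by
      intro j hj
      refine hcol j (fun p => p.1 ∈ S ∧ p.2 ∈ S) (by simpa using hj) _ ?_
      refine (colPr_le s hN j _ (S ×ˢ S) (fun p hp => Finset.mem_product.2 hp) le_rfl).trans ?_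
      rw [Finset.card_product, pow_two (w : ℝ)]
      push_cast
      gcongr
    have h3 : ∀ j ∈ J, pr s (fun e => (∀ i ∈ S, ((e i).1 ∈ S ↔ (e i).2 ∉ S)) ∧
        ((e j).1 ∈ S ∨ (e j).2 ∈ S))
        ≤ (4 * w / Fintype.card ι) ^ S.card * (4 * w / Fintype.card ι) := by
      intro j hj
      refine hcol j (fun p => p.1 ∈ S ∨ p.2 ∈ S) (fun h => hSJ j h hj) _ ?_
      refine (colPr_meet_le s hN S j).trans ?_
      gcongr
    calc _ ≤ ∑ j ∈ Sᶜ, (4 * w / Fintype.card ι : ℝ) ^ S.card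
              * (2 * w ^ 2 / (Fintype.card ι : ℝ) ^ 2)
            + ∑ j ∈ J, (4 * w / Fintype.card ι : ℝ) ^ S.card * (4 * w / Fintype.card ι) :=
          add_le_add ((pr_exists_le _ _).trans (Finset.sum_le_sum h2))
            ((pr_exists_le _ _).trans (Finset.sum_le_sum h3))
      _ = (4 * w / Fintype.card ι : ℝ) ^ S.card * (((Sᶜ).card : ℝ)
              * (2 * w ^ 2 / (Fintype.card ι : ℝ) ^ 2) + J.card * (4 * w / Fintype.card ι)) := by
          rw [Finset.sum_const, Finset.sum_const, nsmul_eq_mul, nsmul_eq_mul]; ring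
      _ ≤ (4 * w / Fintype.card ι : ℝ) ^ S.card * ((Fintype.card ι : ℝ)
              * (2 * w ^ 2 / (Fintype.card ι : ℝ) ^ 2) + J.card * (4 * w / Fintype.card ι)) := by
          gcongr
          exact Finset.card_le_univ _
      _ = _ := by congr 1; field_simp
  refine (Finset.sum_le_sum hterm).trans ?_
  rw [← Finset.sum_mul, mul_div_assoc (∑ l ∈ Finset.range (w + 1), (4 * (w : ℝ)) ^ l)]
  gcongr
  refine le_trans (Finset.sum_le_sum_of_subset_of_nonneg ?_ fun _ _ _ => by positivity)
    (sum_pow_card_le (ι := ι) w (by omega) (by positivity))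
  exact Finset.filter_subset_filter _ (Finset.subset_univ _)

end ClosedSets

/-! ### Extension of a linear map with prescribed nullity. -/

section LinearAlgebra

open Module

/-- Since `ρ` is injective on `B`, complements of `B` and of its image have equal dimension. Map one
complement to the other by a bijection of bases, except that `k` basis vectors go to zero. -/
lemma exists_linearMap_extend {F V U : Type*} [Field F] [AddCommGroup V] [Module F V]
    [Module.Finite F V] [AddCommGroup U] [Module F U] [Module.Finite F U]
    (hVU : finrank F V = finrank F U) (B : Submodule F V) (ρ : V →ₗ[F] U)
    (hρ : ∀ b ∈ B, ρ b = 0 → b = 0) {k : ℕ} (hk : finrank F B + k ≤ finrank F V) :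
    ∃ Ψ : V →ₗ[F] U, (∀ b ∈ B, Ψ b = ρ b) ∧ finrank F (LinearMap.ker Ψ) = k := by
  classical
  obtain ⟨C, hC⟩ := B.exists_isCompl
  obtain ⟨C', hC'⟩ := (B.map ρ).exists_isCompl
  have hinj : Function.Injective (ρ.comp B.subtype) := by
    rw [← LinearMap.ker_eq_bot, LinearMap.ker_eq_bot']
    intro b hb
    exact Subtype.ext (hρ b b.2 hb)
  have hmap : LinearMap.range (ρ.comp B.subtype) = B.map ρ := by
    rw [LinearMap.range_comp, Submodule.range_subtype]
  have hfmap : finrank F (B.map ρ) = finrank F B := by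
    rw [← hmap]; exact LinearMap.finrank_range_of_inj hinj
  have h1 := Submodule.finrank_add_eq_of_isCompl hC
  have h2 := Submodule.finrank_add_eq_of_isCompl hC'
  have hdim : finrank F C = finrank F C' := by omega
  let b := finBasis F C
  let b' := (finBasis F C').reindex (finCongr hdim.symm)
  let g : Fin (finrank F C) → C' := fun i => if (i : ℕ) < k then 0 else b' i
  let ψ : C →ₗ[F] C' := b.constr F g
  have hψ : finrank F (LinearMap.range ψ) = finrank F C - k := by
    have hr : LinearMap.range ψ
        = Submodule.span F (b' '' {i : Fin (finrank F C) | k ≤ (i : ℕ)}) := by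
      rw [Basis.constr_range]
      apply le_antisymm
      · rw [Submodule.span_le]
        rintro _ ⟨i, rfl⟩
        simp only [g]
        split_ifs with h
        · exact Submodule.zero_mem _
        · exact Submodule.subset_span ⟨i, not_lt.1 h, rfl⟩
      · refine Submodule.span_mono ?_
        rintro _ ⟨i, hi, rfl⟩
        exact ⟨i, by simp only [g]; rw [if_neg (not_lt.2 hi)]⟩
    have hli : LinearIndepOn F b' {i : Fin (finrank F C) | k ≤ (i : ℕ)} :=
      b'.linearIndependent.linearIndepOn _
    rw [hr]
    rw [Set.image_eq_range]
    rw [finrank_span_eq_card hli]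
    have : Fintype.card {i : Fin (finrank F C) | k ≤ (i : ℕ)} = finrank F C - k := by
      have h5 := Fintype.card_subtype fun i : Fin (finrank F C) => k ≤ (i : ℕ)
      have h6 : Fintype.card {i : Fin (finrank F C) | k ≤ (i : ℕ)}
          = Fintype.card {i : Fin (finrank F C) // k ≤ (i : ℕ)} := Fintype.card_congr (Equiv.refl _)
      have h3 := Fin.card_filter_val_lt (n := finrank F C) (m := k)
      have h4 := Finset.card_filter_add_card_filter_not
        (s := (Finset.univ : Finset (Fin (finrank F C))))
        (fun i => (i : ℕ) < k)
      simp only [not_lt, Finset.card_univ, Fintype.card_fin] at h4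
      omega
    exact this
  let Ψ : V →ₗ[F] U := LinearMap.ofIsCompl hC (ρ.comp B.subtype) (C'.subtype.comp ψ)
  refine ⟨Ψ, fun v hv => ?_, ?_⟩
  · exact LinearMap.ofIsCompl_apply_left hC ⟨v, hv⟩
  · have h3 := LinearMap.finrank_range_add_finrank_ker Ψ
    have h4 : LinearMap.range Ψ = B.map ρ ⊔ LinearMap.range (C'.subtype.comp ψ) := by
      rw [LinearMap.range_ofIsCompl, hmap]
    have h5 : B.map ρ ⊓ LinearMap.range (C'.subtype.comp ψ) = ⊥ := by
      rw [eq_bot_iff, ← hC'.inf_eq_bot]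
      refine inf_le_inf_left _ ?_
      rintro _ ⟨x, rfl⟩
      exact (ψ x).2
    have h6 := Submodule.finrank_sup_add_finrank_inf_eq (B.map ρ)
      (LinearMap.range (C'.subtype.comp ψ))
    rw [h5, finrank_bot, ← h4] at h6
    have h7 : finrank F (LinearMap.range (C'.subtype.comp ψ)) = finrank F C - k := by
      rw [LinearMap.range_comp, ← hψ]
      exact (Submodule.equivMapOfInjective _ C'.subtype_injective _).finrank_eq.symm
    omega

end LinearAlgebra

/-! ### The sign character of GF(2) and weights of vectors. -/

section Characters

set_option linter.unusedSectionVars false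

/-- The nontrivial character of `ZMod 2`. -/
def sgn (x : ZMod 2) : ℝ := if x = 0 then 1 else -1

lemma zmod_two_eq : ∀ x : ZMod 2, x = 0 ∨ x = 1 := by decide

lemma sgn_zero : sgn 0 = 1 := by simp [sgn]

lemma sgn_add (x y : ZMod 2) : sgn (x + y) = sgn x * sgn y := by
  have h : (1 : ZMod 2) + 1 = 0 := by decide
  rcases zmod_two_eq x with rfl | rfl <;> rcases zmod_two_eq y with rfl | rfl <;> simp [sgn, h]

lemma abs_sgn (x : ZMod 2) : |sgn x| = 1 := by unfold sgn; split_ifs <;> simp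

lemma sgn_sum {κ : Type*} (I : Finset κ) (f : κ → ZMod 2) :
    sgn (∑ i ∈ I, f i) = ∏ i ∈ I, sgn (f i) := by
  classical
  induction I using Finset.induction_on with
  | empty => simp [sgn_zero]
  | insert a I ha ih => rw [Finset.sum_insert ha, Finset.prod_insert ha, sgn_add, ih]

/-- Translation by a vector on which `f` is nonzero permutes the terms and changes the sign of the
sum. -/
lemma sum_sgn_linearMap {V : Type*} [AddCommGroup V] [Module (ZMod 2) V] [Fintype V]
    (f : V →ₗ[ZMod 2] ZMod 2) (hf : f ≠ 0) : ∑ v, sgn (f v) = 0 := by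
  obtain ⟨v₀, hv₀⟩ : ∃ v, f v ≠ 0 := by
    by_contra h; push Not at h; exact hf (LinearMap.ext h)
  have h1 : ∑ v, sgn (f v) = ∑ v, sgn (f (v + v₀)) :=
    (Equiv.sum_comp (Equiv.addRight v₀) fun v => sgn (f v)).symm
  have h2 : sgn (f v₀) = -1 := by simp [sgn, hv₀]
  simp only [map_add, sgn_add, h2] at h1
  rw [← Finset.sum_mul] at h1
  linarith

variable {ι : Type} [Fintype ι] [DecidableEq ι]

/-- The support of a vector. -/
def supp (w : ι → ZMod 2) : Finset ι := Finset.univ.filter fun i => w i ≠ 0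

lemma mem_supp {w : ι → ZMod 2} {i : ι} : i ∈ supp w ↔ w i ≠ 0 := by simp [supp]

lemma chi_supp (w : ι → ZMod 2) : chi (supp w) = w := by
  funext i
  simp only [chi, mem_supp]
  rcases zmod_two_eq (w i) with h | h <;> simp [h]

lemma supp_chi (S : Finset ι) : supp (chi S) = S := by
  ext i; simp [mem_supp, chi]

lemma supp_eq_empty {w : ι → ZMod 2} : supp w = ∅ ↔ w = 0 := by
  constructor
  · intro h; rw [← chi_supp w, h]; funext i; simp [chi]
  · rintro rfl; simp [supp]

lemma card_supp_add_le (w w' : ι → ZMod 2) :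
    (supp (w + w')).card ≤ (supp w).card + (supp w').card := by
  refine (Finset.card_le_card fun i hi => ?_).trans (Finset.card_union_le _ _)
  rw [Finset.mem_union, mem_supp, mem_supp]
  rw [mem_supp, Pi.add_apply] at hi
  by_contra h
  push Not at h
  simp [h.1, h.2] at hi

/-- The link between weights and Fourier coefficients: a vector with weight near half of the rows
has a small character sum. -/
lemma sum_sgn_apply (w : ι → ZMod 2) :
    ∑ a, sgn (w a) = (Fintype.card ι : ℝ) - 2 * (supp w).card := by
  have h : ∀ a, sgn (w a) = 1 - 2 * (if w a ≠ 0 then 1 else 0) := by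
    intro a; unfold sgn; split_ifs <;> first | contradiction | norm_num
  simp only [h, Finset.sum_sub_distrib, ← Finset.mul_sum, Finset.sum_boole, supp]
  simp

open Classical in
/-- The number of coordinates that agree with a given functional on `W`. -/
lemma card_mul_card_eq_sum (W : Submodule (ZMod 2) (ι → ZMod 2)) (χ : W →ₗ[ZMod 2] ZMod 2) :
    (Fintype.card W : ℝ) * (Finset.univ.filter fun a : ι => ∀ w : W, w.1 a = χ w).card
      = ∑ w : W, sgn (χ w) * ((Fintype.card ι : ℝ) - 2 * (supp w.1).card) := by
  simp only [← sum_sgn_apply, Finset.mul_sum]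
  rw [Finset.sum_comm, Finset.card_filter]
  push_cast
  rw [Finset.mul_sum]
  refine Finset.sum_congr rfl fun a _ => ?_
  let f : W →ₗ[ZMod 2] ZMod 2 := χ + (LinearMap.proj a).comp W.subtype
  have hf : ∀ w : W, sgn (χ w) * sgn (w.1 a) = sgn (f w) := fun w => by
    rw [← sgn_add]; rfl
  simp only [hf]
  split_ifs with h
  · have : ∀ w, f w = 0 := fun w => by
      change χ w + w.1 a = 0
      rw [h w]; exact CharTwo.add_self_eq_zero _
    simp [this, sgn_zero]
  · rw [mul_zero, sum_sgn_linearMap]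
    intro h0
    apply h
    intro w
    have : χ w + w.1 a = 0 := LinearMap.congr_fun h0 w
    exact (CharTwo.add_eq_zero.1 this).symm

end Characters

/-! ### Resampling the columns of `J` to prescribe the left kernel. -/

section Resampling

set_option linter.unusedSectionVars false

open Module

variable {ι : Type} [Fintype ι] [DecidableEq ι]

/-- The pairing with the column `j` with random rows `p`. -/
def orthFun (j : ι) (p : ι × ι) : (ι → ZMod 2) →ₗ[ZMod 2] ZMod 2 :=
  LinearMap.proj (R := ZMod 2) (φ := fun _ : ι => ZMod 2) j
    + LinearMap.proj (φ := fun _ => ZMod 2) p.1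
    + LinearMap.proj (R := ZMod 2) (φ := fun _ : ι => ZMod 2) p.2

/-- The vectors that are orthogonal to the columns off `J`. -/
def leftKerOff (e : ι → ι × ι) (J : Finset ι) : Submodule (ZMod 2) (ι → ZMod 2) :=
  LinearMap.ker (LinearMap.pi fun j : {j // j ∈ Jᶜ} => orthFun j.1 (e j.1))

lemma mem_leftKerOff {e : ι → ι × ι} {J : Finset ι} {w : ι → ZMod 2} :
    w ∈ leftKerOff e J ↔ ∀ j ∈ Jᶜ, Orth w j (e j) := by
  rw [leftKerOff, LinearMap.mem_ker, funext_iff, Subtype.forall]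
  rfl

/-- Only N - |J| equations are imposed. This deterministic lower bound allows Markov's inequality to
be applied to the excess of the number of vectors over `2 ^ |J|`. -/
lemma card_le_finrank_leftKerOff (e : ι → ι × ι) (J : Finset ι) :
    J.card ≤ finrank (ZMod 2) (leftKerOff e J) := by
  have h := LinearMap.finrank_range_add_finrank_ker
    (LinearMap.pi fun j : {j // j ∈ Jᶜ} => orthFun j.1 (e j.1))
  have h2 := Submodule.finrank_le (LinearMap.range
    (LinearMap.pi fun j : {j // j ∈ Jᶜ} => orthFun j.1 (e j.1)))
  rw [finrank_fintype_fun_eq_card, Fintype.card_coe, Finset.card_compl] at h2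
  rw [finrank_fintype_fun_eq_card] at h
  have h3 := Finset.card_le_univ J
  unfold leftKerOff
  omega

open Classical in
/-- The vectors orthogonal to the columns off `J` form a space of dimension `|J|`; not too many of
them are small, and these all meet `J`; the others have size close to half of the rows. -/
def Usable (J : Finset ι) (k : ℕ) (W : Submodule (ZMod 2) (ι → ZMod 2)) : Prop :=
  finrank (ZMod 2) W = J.card ∧
  (Finset.univ.filter fun S : Finset ι =>
    8 * S.card ≤ Fintype.card ι ∧ chi S ∈ W).card ≤ 2 ^ (J.card - k) ∧
  (∀ w ∈ W, Fintype.card ι < 8 * (supp w).card → IsCore (Fintype.card ι) (supp w).card) ∧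
  ∀ w ∈ W, w ≠ 0 → 8 * (supp w).card ≤ Fintype.card ι → ¬ Disjoint (supp w) J

lemma card_submodule_zmod_two (W : Submodule (ZMod 2) (ι → ZMod 2)) [Fintype W] :
    Fintype.card W = 2 ^ finrank (ZMod 2) W := by
  rw [Module.card_eq_pow_finrank (K := ZMod 2), ZMod.card]

/-- The small vectors form a subspace `B`: a sum of two of them has weight at most N / 4, and the
vectors of `W` that are not small weigh more than that. By counting, dim `B` ≤ |J| - k. Restriction
to `J` is injective on `B`, because each nonzero small vector meets `J`, so it extends to a map with
nullity `k` that is still injective on `B`. -/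
lemma Usable.exists_linearMap {J : Finset ι} {k : ℕ} {W : Submodule (ZMod 2) (ι → ZMod 2)}
    (h : Usable J k W) (hk : k ≤ J.card)
    (hcore : ∀ n, IsCore (Fintype.card ι) n → Fintype.card ι < 4 * n) :
    ∃ Ψ : W →ₗ[ZMod 2] (J → ZMod 2),
      (∀ w : W, 8 * (supp w.1).card ≤ Fintype.card ι → ∀ j : J, Ψ w j = w.1 j) ∧
      finrank (ZMod 2) (LinearMap.ker Ψ) = k ∧
      ∀ w : W, Ψ w = 0 → w ≠ 0 → Fintype.card ι < 8 * (supp w.1).card := by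
  classical
  obtain ⟨hdim, hcard, hlarge, hsmall⟩ := h
  let B : Submodule (ZMod 2) W :=
    { carrier := {w | 8 * (supp w.1).card ≤ Fintype.card ι}
      zero_mem' := by
        simp only [Set.mem_ofPred_eq, Submodule.coe_zero, supp_eq_empty.2, Finset.card_empty]
        omega
      add_mem' := by
        intro a b ha hb
        simp only [Set.mem_ofPred_eq] at ha hb ⊢
        by_contra hab
        have h1 := hcore _ (hlarge _ (a + b).2 (not_le.1 hab))
        have h2 := card_supp_add_le a.1 b.1
        rw [Submodule.coe_add] at h1
        omega
      smul_mem' := by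
        intro c a ha
        rcases zmod_two_eq c with rfl | rfl
        · simp only [Set.mem_ofPred_eq, zero_smul, Submodule.coe_zero, supp_eq_empty.2,
            Finset.card_empty]
          omega
        · simpa using ha }
  have hB : ∀ w : W, w ∈ B ↔ 8 * (supp w.1).card ≤ Fintype.card ι := fun _ => Iff.rfl
  let ρ : W →ₗ[ZMod 2] (J → ZMod 2) :=
    (LinearMap.funLeft (ZMod 2) (ZMod 2) (Subtype.val : J → ι)).comp W.subtype
  have hρ : ∀ (w : W) (j : J), ρ w j = w.1 j := fun _ _ => rfl
  have hker : ∀ b ∈ B, ρ b = 0 → b = 0 := by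
    intro b hb h0
    by_contra hne
    refine hsmall b.1 b.2 (fun h => hne (Subtype.ext h)) hb ?_
    rw [Finset.disjoint_left]
    intro i hi hJ
    exact mem_supp.1 hi (congrFun h0 ⟨i, hJ⟩)
  have hBcard : finrank (ZMod 2) B ≤ J.card - k := by
    have h1 : Fintype.card B ≤ 2 ^ (J.card - k) := by
      refine le_trans ?_ hcard
      rw [← Finset.card_univ]
      refine Finset.card_le_card_of_injOn (fun b => supp b.1.1) ?_ ?_
      · intro b _
        simp only [Finset.coe_filter, Set.mem_ofPred_eq, Finset.mem_univ, true_and, chi_supp]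
        exact ⟨b.2, b.1.2⟩
      · intro b _ b' _ hbb
        refine Subtype.ext (Subtype.ext ?_)
        rw [← chi_supp b.1.1, ← chi_supp b'.1.1]
        exact congrArg chi hbb
    rw [Module.card_eq_pow_finrank (K := ZMod 2), ZMod.card] at h1
    exact (Nat.pow_le_pow_iff_right (by norm_num)).1 h1
  obtain ⟨Ψ, hΨB, hΨk⟩ := exists_linearMap_extend (F := ZMod 2) (V := W) (U := J → ZMod 2)
    (by rw [hdim, finrank_fintype_fun_eq_card, Fintype.card_coe]) B ρ hker (k := k)
    (by rw [hdim]; omega)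
  refine ⟨Ψ, fun w hw j => by rw [hΨB w hw, hρ], hΨk, fun w hw hne => ?_⟩
  by_contra hs
  exact hne (hker w (not_lt.1 hs) (by rw [← hΨB w (not_lt.1 hs)]; exact hw))

-- In the Fourier expansion of the count, the zero vector contributes N, the small vectors
-- contribute nonnegative terms because `χ` vanishes on them, and each of the at most `2 ^ |J|`
-- remaining vectors takes away at most N / 2^(|J| + 1). So at least N / 2 is left for |W| times the
-- count.
open Classical in
lemma Usable.card_agree_ge {J : Finset ι} {k : ℕ} {W : Submodule (ZMod 2) (ι → ZMod 2)}
    (h : Usable J k W)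
    (hcore : ∀ n : ℕ, IsCore (Fintype.card ι) n →
      2 ^ (J.card + 2) * |(Fintype.card ι : ℝ) - 2 * n| ≤ Fintype.card ι)
    (χ : W →ₗ[ZMod 2] ZMod 2)
    (hχ : ∀ w : W, 8 * (supp w.1).card ≤ Fintype.card ι → χ w = 0) :
    (Fintype.card ι : ℝ) / 2 ^ (J.card + 1)
      ≤ (Finset.univ.filter fun a : ι => ∀ w : W, w.1 a = χ w).card := by
  obtain ⟨hdim, -, hlarge, -⟩ := h
  have key := card_mul_card_eq_sum W χ
  have hW : (Fintype.card W : ℝ) = 2 ^ J.card := by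
    rw [card_submodule_zmod_two, hdim]; push_cast; rfl
  set N : ℝ := (Fintype.card ι : ℝ) with hN
  have hN0 : 0 ≤ N := by positivity
  have hterm : ∀ w : W, (if w = 0 then N else 0) - N / 2 ^ (J.card + 1)
      ≤ sgn (χ w) * (N - 2 * (supp w.1).card) := by
    intro w
    have hpos : 0 ≤ N / 2 ^ (J.card + 1) := by positivity
    by_cases hw : 8 * (supp w.1).card ≤ Fintype.card ι
    · rw [hχ w hw, sgn_zero, one_mul]
      split_ifs with h0
      · rw [h0, Submodule.coe_zero, supp_eq_empty.2 rfl]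
        simpa using hpos
      · have : 8 * ((supp w.1).card : ℝ) ≤ N := by rw [hN]; exact_mod_cast hw
        linarith
    · have h1 := hcore _ (hlarge _ w.2 (not_le.1 hw))
      have h0 : w ≠ 0 := by
        rintro rfl
        apply hw
        rw [Submodule.coe_zero, supp_eq_empty.2 rfl]
        simp
      rw [if_neg h0]
      have h2 : |N - 2 * ((supp w.1).card : ℝ)| ≤ N / 2 ^ (J.card + 1) := by
        rw [le_div_iff₀ (by positivity), mul_comm]
        refine le_trans ?_ h1
        gcongr <;> norm_num
      have h3 : |sgn (χ w) * (N - 2 * ((supp w.1).card : ℝ))| ≤ N / 2 ^ (J.card + 1) := by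
        rw [abs_mul, abs_sgn, one_mul]; exact h2
      have := (abs_le.1 h3).1
      linarith
  have hsum := Finset.sum_le_sum fun w (_ : w ∈ (Finset.univ : Finset W)) => hterm w
  rw [← key, hW, Finset.sum_sub_distrib, Finset.sum_ite_eq' Finset.univ (0 : W), Finset.sum_const,
    Finset.card_univ, nsmul_eq_mul, hW, if_pos (Finset.mem_univ _)] at hsum
  have h4 : (2 : ℝ) ^ J.card * (N / 2 ^ (J.card + 1)) = N / 2 := by rw [pow_succ]; field_simp
  have h5 : (2 : ℝ) ^ J.card * (N / 2 ^ (J.card + 1)) ≤ 2 ^ J.card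
      * ((Finset.univ.filter fun a : ι => ∀ w : W, w.1 a = χ w).card : ℝ) := by
    linarith
  exact le_of_mul_le_mul_left h5 (by positivity)

lemma totalPairs_le_sq (s : Sampling) (N : ℕ) : totalPairs s N ≤ N ^ 2 := by
  cases s with
  | withReplacement => simp [totalPairs, pow_two]
  | withoutReplacement =>
    rw [pow_two]
    exact Nat.mul_le_mul (Nat.sub_le _ _) (Nat.sub_le _ _)

/-- Take the first random row where all of `W` vanishes and the second one where `W` agrees with
`θ`; both sets of rows have positive density. At most 3N of these pairs are inadmissible without
replacement, which the lower bound on N absorbs. -/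
lemma Usable.colPr_ge (s : Sampling) {J : Finset ι} {k : ℕ}
    {W : Submodule (ZMod 2) (ι → ZMod 2)} (h : Usable J k W)
    (hcore : ∀ n : ℕ, IsCore (Fintype.card ι) n →
      2 ^ (J.card + 2) * |(Fintype.card ι : ℝ) - 2 * n| ≤ Fintype.card ι)
    (hN : 3 * 2 ^ (2 * J.card + 3) ≤ Fintype.card ι)
    (θ : W →ₗ[ZMod 2] ZMod 2)
    (hθ : ∀ w : W, 8 * (supp w.1).card ≤ Fintype.card ι → θ w = 0) (j : ι) :
    1 / 2 ^ (2 * J.card + 3) ≤ colPr s j (fun p => ∀ w : W, w.1 p.1 + w.1 p.2 = θ w) := by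
  classical
  have h0 := h.card_agree_ge hcore 0 (fun _ _ => rfl)
  have h1 := h.card_agree_ge hcore θ hθ
  set A₀ := Finset.univ.filter fun a : ι => ∀ w : W, w.1 a = (0 : W →ₗ[ZMod 2] ZMod 2) w with hA₀
  set A₁ := Finset.univ.filter fun a : ι => ∀ w : W, w.1 a = θ w with hA₁
  set bad : Finset (ι × ι) := ({j} ×ˢ Finset.univ ∪ Finset.univ ×ˢ {j})
    ∪ Finset.univ.image fun a => (a, a) with hbad
  have hbadcard : bad.card ≤ 3 * Fintype.card ι := by
    have e1 := Finset.card_union_le ({j} ×ˢ Finset.univ ∪ Finset.univ ×ˢ {j} : Finset (ι × ι))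
      (Finset.univ.image fun a => (a, a))
    have e2 := Finset.card_union_le ({j} ×ˢ Finset.univ : Finset (ι × ι)) (Finset.univ ×ˢ {j})
    have e3 : (Finset.univ.image fun a : ι => (a, a)).card ≤ Fintype.card ι := by
      simpa using Finset.card_image_le (s := Finset.univ) (f := fun a : ι => (a, a))
    rw [Finset.card_product, Finset.card_product, Finset.card_singleton, Finset.card_univ] at e2
    rw [hbad]
    omega
  have hsub : (A₀ ×ˢ A₁) \ bad
      ⊆ (pairs s j).filter fun p => ∀ w : W, w.1 p.1 + w.1 p.2 = θ w := by
    intro p hp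
    simp only [hbad, hA₀, hA₁, Finset.mem_sdiff, Finset.mem_product, Finset.mem_filter,
      Finset.mem_univ, true_and, Finset.mem_union, Finset.mem_image, Finset.mem_singleton,
      and_true, not_or] at hp
    obtain ⟨⟨hp0, hp1⟩, ⟨hj1, hj2⟩, hd⟩ := hp
    refine Finset.mem_filter.2 ⟨?_, fun w => ?_⟩
    · cases s with
      | withReplacement => exact Finset.mem_univ _
      | withoutReplacement =>
        refine Finset.mem_filter.2 ⟨Finset.mem_univ _, hj1, hj2, fun h => hd ⟨p.1, ?_⟩⟩
        exact Prod.ext rfl h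
    · rw [hp0 w, hp1 w]; simp
  have hcard : (A₀.card : ℝ) * A₁.card - 3 * Fintype.card ι
      ≤ ((pairs s j).filter fun p => ∀ w : W, w.1 p.1 + w.1 p.2 = θ w).card := by
    have h2 := Finset.card_le_card hsub
    have h3 := Finset.le_card_sdiff bad (A₀ ×ˢ A₁)
    rw [Finset.card_product] at h3
    have h4 : A₀.card * A₁.card ≤ ((pairs s j).filter fun p =>
      ∀ w : W, w.1 p.1 + w.1 p.2 = θ w).card + 3 * Fintype.card ι := by omega
    rw [sub_le_iff_le_add]
    exact_mod_cast h4
  have hN' : (3 : ℝ) * 2 ^ (2 * J.card + 3) ≤ Fintype.card ι := by exact_mod_cast hN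
  set N : ℝ := (Fintype.card ι : ℝ) with hNdef
  have hN0 : 0 < N := lt_of_lt_of_le (by positivity) hN'
  have hprod : N ^ 2 / 2 ^ (2 * J.card + 2) ≤ (A₀.card : ℝ) * A₁.card := by
    calc N ^ 2 / 2 ^ (2 * J.card + 2) = N / 2 ^ (J.card + 1) * (N / 2 ^ (J.card + 1)) := by
          rw [div_mul_div_comm, ← pow_add, pow_two]; congr 2; ring
      _ ≤ _ := by gcongr
  rw [colPr_def, card_pairs]
  have htot : (totalPairs s (Fintype.card ι) : ℝ) ≤ N ^ 2 := by
    rw [hNdef]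
    exact_mod_cast totalPairs_le_sq s (Fintype.card ι)
  have htot0 : (0 : ℝ) < totalPairs s (Fintype.card ι) := by
    have : 3 ≤ Fintype.card ι := le_trans (by
      have := Nat.one_le_two_pow (n := 2 * J.card + 3); omega) hN
    exact_mod_cast totalPairs_pos s this
  rw [div_le_div_iff₀ (by positivity) htot0, one_mul]
  refine htot.trans ?_
  have h6 : N ^ 2 ≤ (N ^ 2 / 2 ^ (2 * J.card + 2) - 3 * N) * 2 ^ (2 * J.card + 3) := by
    have h7 : (N ^ 2 / 2 ^ (2 * J.card + 2) - 3 * N) * 2 ^ (2 * J.card + 3)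
        = 2 * N ^ 2 - N * (3 * 2 ^ (2 * J.card + 3)) := by
      rw [pow_succ _ (2 * J.card + 2)]; field_simp
    rw [h7]
    nlinarith
  refine h6.trans ?_
  gcongr
  linarith

/-- The left kernel has dimension `k`, and the sizes of its nonzero vectors are close to half of
the rows. -/
def Good (k : ℕ) (e : ι → ι × ι) : Prop :=
  finrank (ZMod 2) (leftKerOff e ∅) = k ∧
    ∀ w ∈ leftKerOff e ∅, w ≠ 0 → IsCore (Fintype.card ι) (supp w).card

/-- When the columns of `J` pair with `W` as `Ψ` prescribes, a vector of `W` is orthogonal to them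
exactly if `Ψ` kills it, so the left kernel is the kernel of `Ψ`. -/
lemma good_of_usable {J : Finset ι} {k : ℕ} {e : ι → ι × ι} (h : Usable J k (leftKerOff e J))
    (Ψ : leftKerOff e J →ₗ[ZMod 2] (J → ZMod 2))
    (hk : finrank (ZMod 2) (LinearMap.ker Ψ) = k)
    (hΨ : ∀ w, Ψ w = 0 → w ≠ 0 → Fintype.card ι < 8 * (supp w.1).card)
    (he : ∀ j : J, ∀ w : leftKerOff e J, w.1 j + w.1 (e j).1 + w.1 (e j).2 = Ψ w j) :
    Good k e := by
  have hmem : ∀ w : ι → ZMod 2, w ∈ leftKerOff e ∅ ↔ ∃ v : leftKerOff e J, Ψ v = 0 ∧ v.1 = w := by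
    intro w
    constructor
    · intro hw
      rw [mem_leftKerOff] at hw
      refine ⟨⟨w, mem_leftKerOff.2 fun j _ => hw j (by simp)⟩, ?_, rfl⟩
      funext j
      rw [← he]
      exact hw j (by simp)
    · rintro ⟨v, hv, rfl⟩
      rw [mem_leftKerOff]
      intro j _
      by_cases hj : j ∈ J
      · have := he ⟨j, hj⟩ v
        rw [hv] at this
        exact this
      · exact mem_leftKerOff.1 v.2 j (by simpa using hj)
  constructor
  · have heq : leftKerOff e ∅ = (LinearMap.ker Ψ).map (leftKerOff e J).subtype := by
      ext w
      rw [hmem, Submodule.mem_map]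
      rfl
    rw [heq, ← hk]
    exact (Submodule.equivMapOfInjective _ (leftKerOff e J).subtype_injective _).finrank_eq.symm
  · intro w hw hne
    obtain ⟨v, hv, rfl⟩ := (hmem w).1 hw
    exact h.2.2.1 _ v.2 (hΨ v hv fun h0 => hne (by rw [h0]; rfl))

/-- Each of the |J| columns realises its coordinate of the map with probability at least `1 / 2 ^ (2
* |J| + 3)`, independently given the columns off `J`. -/
lemma le_pr_good (s : Sampling) {J : Finset ι} {k : ℕ} (hk : k ≤ J.card)
    (hcore : ∀ n : ℕ, IsCore (Fintype.card ι) n →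
      2 ^ (J.card + 2) * |(Fintype.card ι : ℝ) - 2 * n| ≤ Fintype.card ι)
    (hN : 3 * 2 ^ (2 * J.card + 3) ≤ Fintype.card ι) :
    (1 / 2 ^ (2 * J.card + 3)) ^ J.card * pr s (fun e => Usable J k (leftKerOff e J))
      ≤ pr s (Good (ι := ι) k) := by
  classical
  have hN3 : 3 ≤ Fintype.card ι := le_trans (by
      have := Nat.one_le_two_pow (n := 2 * J.card + 3); omega) hN
  have hcore4 : ∀ n, IsCore (Fintype.card ι) n → Fintype.card ι < 4 * n := by
    intro n hn
    have h1 := hcore n hn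
    have h2 : (4 : ℝ) ≤ 2 ^ (J.card + 2) := by
      rw [pow_add]; have : (1 : ℝ) ≤ 2 ^ J.card := one_le_pow₀ (by norm_num); linarith
    have h3 : 4 * |(Fintype.card ι : ℝ) - 2 * n| ≤ Fintype.card ι := by
      refine le_trans ?_ h1; gcongr
    have h4 := le_abs_self ((Fintype.card ι : ℝ) - 2 * n)
    have h5 : (3 : ℝ) ≤ Fintype.card ι := by exact_mod_cast hN3
    have h6 : (Fintype.card ι : ℝ) < 4 * n := by linarith
    exact_mod_cast h6
  -- The map is chosen as a function of `W` alone, hence of the columns off `J`, as resampling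
  -- requires.
  let Ψ : ∀ W : Submodule (ZMod 2) (ι → ZMod 2), W →ₗ[ZMod 2] (J → ZMod 2) := fun W =>
    if h : Usable J k W then (h.exists_linearMap hk hcore4).choose else 0
  have hΨ : ∀ W, Usable J k W →
      (∀ w : W, 8 * (supp w.1).card ≤ Fintype.card ι → ∀ j : J, Ψ W w j = w.1 j) ∧
      finrank (ZMod 2) (LinearMap.ker (Ψ W)) = k ∧
      ∀ w : W, Ψ W w = 0 → w ≠ 0 → Fintype.card ι < 8 * (supp w.1).card := by
    intro W h
    have hW : Ψ W = (h.exists_linearMap hk hcore4).choose := dif_pos h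
    rw [hW]
    exact (h.exists_linearMap hk hcore4).choose_spec
  let H : (ι → ι × ι) → ι → ι × ι → Prop := fun e j p => ∀ hj : j ∈ J,
    ∀ w : leftKerOff e J, w.1 j + w.1 p.1 + w.1 p.2 = Ψ (leftKerOff e J) w ⟨j, hj⟩
  have hker : ∀ e e' : ι → ι × ι, (∀ j ∉ J, e j = e' j) → leftKerOff e J = leftKerOff e' J := by
    intro e e' h
    ext w
    rw [mem_leftKerOff, mem_leftKerOff]
    exact forall₂_congr fun j hj => by rw [h j (by simpa using hj)]
  refine (le_pr_and_resample (s := s) hN3 J (fun e => Usable J k (leftKerOff e J)) H ?_ ?_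
    (by positivity) ?_).trans (pr_mono fun e _ he => ?_)
  · intro e e' h; rw [hker e e' h]
  · intro e e' h; simp only [H]; rw [hker e e' h]
  · intro e _ he j hj
    obtain ⟨h1, -, -⟩ := hΨ _ he
    -- The unit entry in row `j` is moved to the right-hand side. On small vectors the two summands
    -- agree, so `θ` vanishes there.
    let θ : leftKerOff e J →ₗ[ZMod 2] ZMod 2 :=
      (LinearMap.proj ⟨j, hj⟩).comp (Ψ (leftKerOff e J))
        + (LinearMap.proj j).comp (leftKerOff e J).subtype
    have hθ : ∀ w, θ w = Ψ (leftKerOff e J) w ⟨j, hj⟩ + w.1 j := fun _ => rfl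
    refine (he.colPr_ge s hcore hN θ (fun w hw => ?_) j).trans (colPr_mono fun p _ hp => ?_)
    · rw [hθ, h1 w hw]; exact CharTwo.add_self_eq_zero _
    · intro hj' w
      have := hp w
      rw [hθ] at this
      rw [add_assoc, this, add_left_comm, CharTwo.add_self_eq_zero, add_zero]
  · obtain ⟨hu, hH⟩ := he
    obtain ⟨-, h2, h3⟩ := hΨ _ hu
    exact good_of_usable hu _ h2 h3 fun j w => hH j.1 j.2 j.2 w

end Resampling

/-! ### A left kernel of prescribed dimension without small vectors has positive probability. -/

section LowerBound

set_option linter.unusedSectionVars false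

open Module

variable {ι : Type} [Fintype ι] [DecidableEq ι]

/-- Markov's inequality for the number of sets with a property. -/
lemma pr_card_ge_le (s : Sampling) (hN : 3 ≤ Fintype.card ι) (I : Finset (Finset ι))
    (R : Finset ι → (ι → ι × ι) → Prop) [∀ e, DecidablePred fun S => R S e] {a b : ℝ}
    (hb : 0 < b)
    (ha : ∀ e, a ≤ ((I.filter fun S => R S e).card : ℝ)) :
    pr s (fun e => a + b ≤ ((I.filter fun S => R S e).card : ℝ))
      ≤ (∑ S ∈ I, pr s (R S) - a) / b := by
  classical
  have hinst : ∀ e, (I.filter fun S => R S e).card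
      = (@Finset.filter _ (fun S => R S e) (fun _ => Classical.propDecidable _) I).card := by
    intro e; congr!
  simp only [hinst] at ha ⊢
  have hpos := configs_card_pos (ι := ι) s hN
  rw [sum_pr_eq, le_div_iff₀ hb, pr_def, div_mul_eq_mul_div, le_sub_iff_add_le,
    div_add' _ _ _ (by positivity)]
  gcongr ?_ / _
  rw [Finset.card_filter]
  push_cast
  rw [Finset.sum_mul, mul_comm a, ← nsmul_eq_mul, ← Finset.sum_const, ← Finset.sum_add_distrib]
  refine Finset.sum_le_sum fun e _ => ?_
  have := ha e
  split_ifs with h <;> linarith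

lemma card_filter_orth (e : ι → ι × ι) (J : Finset ι) :
    (Finset.univ.filter fun S : Finset ι => ∀ j ∈ Jᶜ, Orth (chi S) j (e j)).card
      = 2 ^ finrank (ZMod 2) (leftKerOff e J) := by
  classical
  rw [← card_submodule_zmod_two, ← Finset.card_univ]
  refine Finset.card_bij' (fun S hS => ⟨chi S, mem_leftKerOff.2 (Finset.mem_filter.1 hS).2⟩)
    (fun w _ => supp w.1) ?_ ?_ ?_ ?_
  · intro S _; exact Finset.mem_univ _
  · intro w _
    rw [Finset.mem_filter, chi_supp]
    exact ⟨Finset.mem_univ _, mem_leftKerOff.1 w.2⟩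
  · intro S _; exact supp_chi S
  · intro w _; exact Subtype.ext (chi_supp w.1)

/-- The expected number of vectors between `N / 8` and `27 N / 100` tends to zero. -/
lemma sum_intermediate_le (s : Sampling) (D : ℕ) {ε : ℝ} (hε : 0 < ε) :
    ∀ᶠ N : ℕ in atTop, ∀ (ι : Type) [Fintype ι] [DecidableEq ι] (J : Finset ι),
      Fintype.card ι = N → J.card = D →
      ∑ S : Finset ι with Fintype.card ι < 8 * S.card ∧ 100 * S.card ≤ 27 * Fintype.card ι,
        pr s (fun e => ∀ j ∈ Jᶜ, Orth (chi S) j (e j)) ≤ ε := by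
  have hr0 := rho_pos
  have hr1 := rho_lt_one
  have hlim : Tendsto (fun N : ℕ => 2 ^ D * (rho ^ (N / 32) / (1 - rho))) atTop
      (nhds (2 ^ D * (0 / (1 - rho)))) :=
    (((tendsto_pow_atTop_nhds_zero_of_lt_one hr0.le hr1).comp
      (Nat.tendsto_div_const_atTop (by norm_num))).div_const _).const_mul _
  rw [zero_div, mul_zero] at hlim
  filter_upwards [eventually_ge_atTop 3, eventually_ge_atTop (50 * D),
    hlim.eventually_le_const hε] with N hN hND hl ι _ _ J hcard hJ
  subst hcard
  rw [sum_pr_orth s hN J fun k => Fintype.card ι < 8 * k ∧ 100 * k ≤ 27 * Fintype.card ι, hJ]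
  refine le_trans ?_ hl
  set N := Fintype.card ι
  calc _ ≤ ∑ I ∈ J.powerset, rho ^ (N / 32) / (1 - rho) := by
        refine Finset.sum_le_sum fun I hI => ?_
        -- A set of more than N / 8 rows has more than N / 8 - N / 50 > N / 32 of them off `J`.
        refine le_trans (Finset.sum_le_sum fun t ht => ?_)
          (sum_geometric_gt_le (N / 32) (N - D + 1))
        have hID : I.card ≤ D := by rw [← hJ]; exact Finset.card_le_card (Finset.mem_powerset.1 hI)
        split_ifs with h1 h2 h2
        · refine (small_term_le s hN hND (by simpa [Nat.lt_succ_iff] using ht) h1.2).trans ?_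
          exact mul_le_of_le_one_left (by positivity) (pow_le_one₀ (by norm_num) (by norm_num))
        · omega
        · rw [mul_zero]; positivity
        · rw [mul_zero]
    _ = _ := by rw [Finset.sum_const, Finset.card_powerset, hJ]; simp

lemma eventually_core (D : ℕ) : ∀ᶠ N : ℕ in atTop, ∀ n : ℕ, IsCore N n →
    2 ^ (D + 2) * |(N : ℝ) - 2 * n| ≤ N := by
  set c : ℝ := 1 / (2 ^ (D + 3)) ^ 2 with hc
  filter_upwards [eventually_log_le (c := c) (by positivity) (a := 1) (by norm_num),
    eventually_ge_atTop 1] with N hlog hN n hn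
  have hN0 : (1 : ℝ) ≤ N := by exact_mod_cast hN
  rw [Real.rpow_one] at hlog
  unfold IsCore at hn
  have h1 : Real.sqrt (N * Real.log N) ≤ N / 2 ^ (D + 3) := by
    rw [Real.sqrt_le_left (by positivity)]
    calc (N : ℝ) * Real.log N ≤ N * (c * N) := by gcongr
      _ = (N / 2 ^ (D + 3)) ^ 2 := by rw [hc]; field_simp
  have h2 : |(N : ℝ) - 2 * n| = 2 * |(n : ℝ) - N / 2| := by
    rw [show (N : ℝ) - 2 * n = -(2 * ((n : ℝ) - N / 2)) by ring, abs_neg, abs_mul]; norm_num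
  rw [h2]
  calc (2 : ℝ) ^ (D + 2) * (2 * |(n : ℝ) - N / 2|)
      ≤ 2 ^ (D + 2) * (2 * (N / 2 ^ (D + 3))) := by
        gcongr
        have : 0 ≤ (N : ℝ) / 2 ^ (D + 3) := by positivity
        linarith
    _ = N := by rw [pow_succ _ (D + 2)]; field_simp

/-- Few choices have a nonzero vector of small size off `J`. -/
lemma pr_small_disjoint_le (s : Sampling) (J : Finset ι) (w : ℕ) (hN : 6 ≤ Fintype.card ι)
    (hJ : 50 * J.card ≤ Fintype.card ι) :
    pr s (fun e => ∃ v ∈ leftKerOff e J, v ≠ 0 ∧ 8 * (supp v).card ≤ Fintype.card ι ∧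
      Disjoint (supp v) J)
    ≤ (1 - pr s (NoClosedSet (ι := ι) w)) + ((∑ l ∈ Finset.range (w + 1), (4 * (w : ℝ)) ^ l)
        * (2 * w ^ 2 + J.card * (4 * w)) / Fintype.card ι + rho ^ w / (1 - rho)) := by
  classical
  -- A small vector off `J` has more than `w` elements, or is a closed set, or is a set of at most
  -- `w` rows that is not closed; each of the three terms accounts for one case.
  rw [← pr_not (by omega)]
  refine le_trans ?_ (add_le_add_right (add_le_add (sum_pr_not_closed_le s J w hN)
    (sum_small_disjoint_le s J w (by omega) hJ)) _)
  refine le_trans ?_ (add_le_add_right (add_le_add (pr_exists_le _ _) (pr_exists_le _ _)) _)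
  refine le_trans (pr_mono fun e _ he => ?_) (pr_or_le.trans (add_le_add_right pr_or_le _))
  obtain ⟨v, hv, hne, hsm, hdis⟩ := he
  have hsub : supp v ⊆ Jᶜ := fun i hi => by
    simpa using Finset.disjoint_left.1 hdis hi
  have horth : ∀ j ∈ Jᶜ, Orth (chi (supp v)) j (e j) := by
    rw [chi_supp]; exact mem_leftKerOff.1 hv
  rcases lt_or_ge w (supp v).card with h | h
  · exact Or.inr (Or.inr ⟨supp v, Finset.mem_filter.2 ⟨Finset.mem_powerset.2 hsub, h, by omega⟩,
      horth⟩)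
  by_cases hcl : ClosedSet (supp v) e
  · refine Or.inl fun hno => hno (supp v) ?_ h hcl
    rw [Finset.nonempty_iff_ne_empty, Ne, supp_eq_empty]
    exact hne
  · exact Or.inr (Or.inl ⟨supp v, Finset.mem_filter.2 ⟨Finset.mem_powerset.2 hsub, h⟩, horth, hcl⟩)

/-- The columns off `J` are usable with probability bounded away from zero, if `J` is large. -/
lemma exists_le_pr_usable (s : Sampling) (k : ℕ) : ∃ p : ℝ, 0 < p ∧ ∃ D : ℕ, k ≤ D ∧
    ∀ᶠ N : ℕ in atTop, ∀ (ι : Type) [Fintype ι] [DecidableEq ι] (J : Finset ι),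
      Fintype.card ι = N → J.card = D →
      p ≤ pr s (fun e : ι → ι × ι => Usable J k (leftKerOff e J)) := by
  classical
  have hr0 := rho_pos
  have hr1 := rho_lt_one
  obtain ⟨p, hp, hclosed⟩ := exists_le_pr_noClosedSet s
  -- The order of choice matters: `p` is uniform in `w`, then `w` makes the tail small against `p`,
  -- then `D` makes `(3 / 4) ^ D` small against `p`, and only then N grows. Altogether the bad
  -- events have probability at most 1 - 3p / 8.
  obtain ⟨w, hw⟩ := exists_rho_pow_le (ε := p / 8) (by positivity)
  obtain ⟨D, hDk, hD⟩ : ∃ D, k ≤ D ∧ (1 + 2 ^ k) * ((3 / 4 : ℝ) ^ D / (1 - rho)) ≤ p / 8 := by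
    have h := ((tendsto_pow_atTop_nhds_zero_of_lt_one (r := (3 / 4 : ℝ)) (by norm_num)
      (by norm_num)).div_const (1 - rho)).const_mul ((1 : ℝ) + 2 ^ k)
    rw [zero_div, mul_zero] at h
    obtain ⟨D, h1, h2⟩ := ((eventually_ge_atTop k).and
      (h.eventually_le_const (show 0 < p / 8 by positivity))).exists
    exact ⟨D, h1, h2⟩
  refine ⟨p / 4, by positivity, D, hDk, ?_⟩
  set K : ℝ := (∑ l ∈ Finset.range (w + 1), (4 * (w : ℝ)) ^ l) * (2 * w ^ 2 + D * (4 * w)) with hK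
  have hlim : Tendsto (fun N : ℕ => K / (N : ℝ)) atTop (nhds 0) :=
    tendsto_const_div_atTop_nhds_zero_nat _
  have hε : 0 < p / 16 := by positivity
  filter_upwards [eventually_ge_atTop 6, eventually_ge_atTop (50 * D), hclosed w,
    sum_noncore_le s D hε, sum_core_le s D hε, sum_intermediate_le s D hε,
    hlim.eventually_le_const (show 0 < p / 8 by positivity)]
    with N hN hND hcl hnon hcore hint hl ι _ _ J hcard hJ
  subst hcard
  have hN3 : 3 ≤ Fintype.card ι := by omega
  have hrp : 0 < 1 - rho := by linarith
  -- The number of vectors is a power of 2 and at least `2 ^ D`; below `2 ^ (D + 1)` it is `2 ^ D`,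
  -- so avoiding `P₁` fixes the dimension.
  set P₁ : (ι → ι × ι) → Prop := fun e => (2 : ℝ) ^ D + 2 ^ D
    ≤ ((Finset.univ.filter fun S : Finset ι => ∀ j ∈ Jᶜ, Orth (chi S) j (e j)).card : ℝ) with hP₁
  set P₂ : (ι → ι × ι) → Prop := fun e => (0 : ℝ) + 2 ^ (D - k)
    ≤ (((Finset.univ.filter fun S : Finset ι => 8 * S.card ≤ Fintype.card ι).filter
      fun S => ∀ j ∈ Jᶜ, Orth (chi S) j (e j)).card : ℝ) with hP₂
  set P₃ : (ι → ι × ι) → Prop := fun e => ∃ S ∈ Finset.univ.filter fun S : Finset ι =>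
    Fintype.card ι < 8 * S.card ∧ ¬ IsCore (Fintype.card ι) S.card,
      ∀ j ∈ Jᶜ, Orth (chi S) j (e j) with hP₃
  set P₄ : (ι → ι × ι) → Prop := fun e => ∃ v ∈ leftKerOff e J, v ≠ 0 ∧
    8 * (supp v).card ≤ Fintype.card ι ∧ Disjoint (supp v) J with hP₄
  have hsmallsum := sum_small_le s J hN3 (by rw [hJ]; exact hND)
  rw [hJ] at hsmallsum
  have hnonsum := hnon ι J (fun k => 27 * Fintype.card ι < 100 * k ∧ ¬ IsCore (Fintype.card ι) k)
    (fun _ h => h) rfl hJ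
  have hcoresum := hcore ι J (fun k => IsCore (Fintype.card ι) k) (fun _ h => h) rfl hJ
  have hintsum := hint ι J rfl hJ
  have h1 : pr s P₁ ≤ (3 / 4) ^ D / (1 - rho) + p / 8 := by
    refine (pr_card_ge_le s hN3 Finset.univ (fun S e => ∀ j ∈ Jᶜ, Orth (chi S) j (e j))
      (a := 2 ^ D) (b := 2 ^ D) (by positivity) fun e => ?_).trans ?_
    · rw [card_filter_orth]
      push_cast
      refine pow_le_pow_right₀ (by norm_num) ?_
      rw [← hJ]; exact card_le_finrank_leftKerOff e J
    · have hsplit : ∑ S : Finset ι, pr s (fun e => ∀ j ∈ Jᶜ, Orth (chi S) j (e j))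
          ≤ (3 / 2) ^ D / (1 - rho) + p / 16 + 2 ^ D * (1 + p / 16) := by
        rw [← Finset.sum_filter_add_sum_filter_not _
          (fun S : Finset ι => IsCore (Fintype.card ι) S.card), add_comm]
        refine add_le_add ?_ hcoresum
        rw [← Finset.sum_filter_add_sum_filter_not _
          (fun S : Finset ι => 100 * S.card ≤ 27 * Fintype.card ι)]
        refine add_le_add ?_ ?_
        · refine le_trans (Finset.sum_le_sum_of_subset_of_nonneg ?_ fun _ _ _ => pr_nonneg)
            hsmallsum
          exact Finset.filter_subset_filter _ (Finset.filter_subset _ _)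
        · refine le_trans (Finset.sum_le_sum_of_subset_of_nonneg ?_ fun _ _ _ => pr_nonneg)
            hnonsum
          intro S hS
          simp only [Finset.mem_filter, Finset.mem_univ, true_and, not_le] at hS ⊢
          exact ⟨hS.2, hS.1⟩
      rw [div_le_iff₀ (by positivity)]
      have h2D : (1 : ℝ) ≤ 2 ^ D := one_le_pow₀ (by norm_num)
      have h32 : (3 / 2 : ℝ) ^ D = (3 / 4) ^ D * 2 ^ D := by rw [← mul_pow]; norm_num
      have h33 : (3 / 2 : ℝ) ^ D / (1 - rho) = (3 / 4) ^ D / (1 - rho) * 2 ^ D := by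
        rw [h32]; ring
      nlinarith
  have h2 : pr s P₂ ≤ 2 ^ k * ((3 / 4) ^ D / (1 - rho)) := by
    refine (pr_card_ge_le s hN3 (Finset.univ.filter fun S : Finset ι => 8 * S.card ≤ Fintype.card ι)
      (fun S e => ∀ j ∈ Jᶜ, Orth (chi S) j (e j)) (a := 0) (b := 2 ^ (D - k)) (by positivity)
      fun e => by positivity).trans ?_
    rw [sub_zero, div_le_iff₀ (by positivity)]
    refine le_trans (Finset.sum_le_sum_of_subset_of_nonneg ?_ fun _ _ _ => pr_nonneg)
      (hsmallsum.trans ?_)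
    · intro S hS
      simp only [Finset.mem_filter, Finset.mem_univ, true_and] at hS ⊢
      omega
    · apply le_of_eq
      have h2D : (2 : ℝ) ^ D = 2 ^ k * 2 ^ (D - k) := by rw [← pow_add]; congr 1; omega
      have h32 : (3 / 2 : ℝ) ^ D = (3 / 4) ^ D * 2 ^ D := by rw [← mul_pow]; norm_num
      rw [h32, h2D]; ring
  have h3 : pr s P₃ ≤ p / 16 + p / 16 := by
    refine (pr_exists_le _ _).trans ?_
    rw [← Finset.sum_filter_add_sum_filter_not _
          (fun S : Finset ι => 100 * S.card ≤ 27 * Fintype.card ι)]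
    refine add_le_add (le_trans (Finset.sum_le_sum_of_subset_of_nonneg ?_ fun _ _ _ => pr_nonneg)
      hintsum) (le_trans (Finset.sum_le_sum_of_subset_of_nonneg ?_ fun _ _ _ => pr_nonneg) hnonsum)
    · intro S hS
      simp only [Finset.mem_filter, Finset.mem_univ, true_and] at hS ⊢
      exact ⟨hS.1.1, hS.2⟩
    · intro S hS
      simp only [Finset.mem_filter, Finset.mem_univ, true_and, not_le] at hS ⊢
      exact ⟨hS.2, hS.1.2⟩
  have h4 : pr s P₄ ≤ (1 - p) + (p / 8 + p / 8) := by
    refine (pr_small_disjoint_le s J w hN (by rw [hJ]; exact hND)).trans ?_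
    have := hcl ι rfl
    rw [hJ]
    gcongr
  have h5 : 1 - pr s (fun e : ι → ι × ι => Usable J k (leftKerOff e J))
      ≤ pr s P₁ + (pr s P₂ + (pr s P₃ + pr s P₄)) := by
    rw [← pr_not hN3]
    refine le_trans (pr_mono (Q := fun e => P₁ e ∨ P₂ e ∨ P₃ e ∨ P₄ e) fun e _ he => ?_)
      (pr_or_le.trans (add_le_add_right (pr_or_le.trans (add_le_add_right pr_or_le _)) _))
    by_contra hno
    simp only [not_or] at hno
    obtain ⟨n1, n2, n3, n4⟩ := hno
    apply he
    refine ⟨?_, ?_, ?_, ?_⟩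
    · rw [hJ]
      simp only [hP₁, card_filter_orth, not_le] at n1
      rw [← two_mul, ← pow_succ'] at n1
      push_cast at n1
      have n1' := (pow_lt_pow_iff_right₀ (by norm_num : (1 : ℝ) < 2)).1 n1
      have := card_le_finrank_leftKerOff e J
      omega
    · simp only [hP₂, not_le, zero_add] at n2
      rw [hJ]
      refine le_of_lt ?_
      rw [Finset.filter_filter] at n2
      simp only [mem_leftKerOff]
      exact_mod_cast n2
    · intro v hv hlt
      by_contra hnc
      exact n3 ⟨supp v, Finset.mem_filter.2 ⟨Finset.mem_univ _, hlt, hnc⟩, by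
        rw [chi_supp]; exact mem_leftKerOff.1 hv⟩
    · intro v hv hne hle hdis
      exact n4 ⟨v, hv, hne, hle, hdis⟩
  linarith

/-- All nonzero vectors of the left kernel have size close to half of the rows, and its dimension
is `k`, with probability bounded away from zero. -/
theorem exists_le_pr_good (s : Sampling) (k : ℕ) : ∃ c : ℝ, 0 < c ∧ ∀ᶠ N : ℕ in atTop,
    ∀ (ι : Type) [Fintype ι] [DecidableEq ι], Fintype.card ι = N →
      c ≤ pr s (Good (ι := ι) k) := by
  obtain ⟨p, hp, D, hDk, h⟩ := exists_le_pr_usable s k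
  refine ⟨(1 / 2 ^ (2 * D + 3)) ^ D * p, by positivity, ?_⟩
  filter_upwards [h, eventually_core D, eventually_ge_atTop (3 * 2 ^ (2 * D + 3)),
    eventually_ge_atTop D] with N hN hcore hN2 hND ι _ _ hcard
  subst hcard
  obtain ⟨J, -, hJ⟩ := Finset.exists_subset_card_eq (s := (Finset.univ : Finset ι)) (n := D)
    (by simpa using hND)
  have h1 := le_pr_good s (J := J) (k := k) (by omega) (by rw [hJ]; exact hcore)
    (by rw [hJ]; exact hN2)
  rw [hJ] at h1
  refine le_trans ?_ h1
  gcongr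
  exact hN ι J rfl hJ

/-- It is unlikely that there is a vector in the left kernel that is neither small nor of size
close to half of the rows. -/
theorem pr_intermediate_le (s : Sampling) {ε : ℝ} (hε : 0 < ε) : ∃ w₀ : ℕ, ∀ᶠ N : ℕ in atTop,
    ∀ (ι : Type) [Fintype ι] [DecidableEq ι], Fintype.card ι = N →
      pr s (fun e : ι → ι × ι => ∃ v ∈ leftKerOff e ∅, w₀ < (supp v).card ∧
        ¬ IsCore (Fintype.card ι) (supp v).card) ≤ ε := by
  classical
  obtain ⟨w, hw⟩ := exists_rho_pow_le (ε := ε / 2) (by positivity)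
  refine ⟨w, ?_⟩
  filter_upwards [eventually_ge_atTop 3, sum_noncore_le s 0 (show 0 < ε / 2 by positivity)]
    with N hN hnon ι _ _ hcard
  subst hcard
  have h1 := hnon ι ∅ (fun k => 27 * Fintype.card ι < 100 * k ∧ ¬ IsCore (Fintype.card ι) k)
    (fun _ h => h) rfl Finset.card_empty
  have h2 := (sum_small_disjoint_le s (∅ : Finset ι) w hN (by simp)).trans hw
  calc _ ≤ pr s (fun e : ι → ι × ι => (∃ S ∈ (∅ᶜ : Finset ι).powerset.filter fun S =>
            w < S.card ∧ 100 * S.card ≤ 27 * Fintype.card ι,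
            ∀ j ∈ (∅ : Finset ι)ᶜ, Orth (chi S) j (e j)) ∨
          (∃ S ∈ Finset.univ.filter fun S : Finset ι =>
            27 * Fintype.card ι < 100 * S.card ∧ ¬ IsCore (Fintype.card ι) S.card,
            ∀ j ∈ (∅ : Finset ι)ᶜ, Orth (chi S) j (e j))) := by
        refine pr_mono fun e _ he => ?_
        obtain ⟨v, hv, hlt, hnc⟩ := he
        have horth : ∀ j ∈ (∅ : Finset ι)ᶜ, Orth (chi (supp v)) j (e j) := by
          rw [chi_supp]; exact mem_leftKerOff.1 hv
        rcases le_or_gt (100 * (supp v).card) (27 * Fintype.card ι) with h | h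
        · exact Or.inl ⟨supp v, Finset.mem_filter.2 ⟨by simp, hlt, h⟩, horth⟩
        · exact Or.inr ⟨supp v, Finset.mem_filter.2 ⟨Finset.mem_univ _, h, hnc⟩, horth⟩
    _ ≤ _ := pr_or_le
    _ ≤ ε / 2 + ε / 2 :=
        add_le_add ((pr_exists_le _ _).trans h2) ((pr_exists_le _ _).trans h1)
    _ = ε := by ring

end LowerBound

/-! ### Counting matrices of given rank over GF(2). -/

section RankCount

set_option linter.unusedSectionVars false

open Module

lemma gaussianCoeff_zero_succ (q : ℝ) (r : ℕ) : gaussianCoeff q 0 (r + 1) = 0 := by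
  unfold gaussianCoeff
  exact Finset.prod_eq_zero (Finset.mem_range.2 (Nat.succ_pos r)) (by simp)

lemma gaussianCoeff_eq_zero {q : ℝ} {m r : ℕ} (h : m < r) : gaussianCoeff q m r = 0 := by
  unfold gaussianCoeff
  exact Finset.prod_eq_zero (Finset.mem_range.2 h) (by simp)

/-- This form of the q-Pascal rule matches the recursion that arises when one more vector is put in
front of a tuple. -/
lemma gaussianCoeff_succ_succ (m r : ℕ) : gaussianCoeff 2 (m + 1) (r + 1)
    = 2 ^ (r + 1) * gaussianCoeff 2 m (r + 1) + gaussianCoeff 2 m r := by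
  have hden : ∀ i : ℕ, (2 : ℝ) ^ (i + 1) - 1 ≠ 0 := fun i => by
    have : (1 : ℝ) < 2 ^ (i + 1) := one_lt_pow₀ (by norm_num) (by omega)
    linarith
  rcases lt_or_ge m r with h | h
  · rw [gaussianCoeff_eq_zero (by omega), gaussianCoeff_eq_zero (by omega : m < r + 1),
      gaussianCoeff_eq_zero h]; simp
  · have h1 : gaussianCoeff 2 m (r + 1)
        = gaussianCoeff 2 m r * ((2 ^ (m - r) - 1) / (2 ^ (r + 1) - 1)) := by
      unfold gaussianCoeff; rw [Finset.prod_range_succ]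
    have h2 : gaussianCoeff 2 (m + 1) (r + 1)
        = gaussianCoeff 2 m r * ((2 ^ (m + 1) - 1) / (2 ^ (r + 1) - 1)) := by
      unfold gaussianCoeff
      rw [Finset.prod_div_distrib, Finset.prod_div_distrib, Finset.prod_range_succ',
        Finset.prod_range_succ (fun i => (2 : ℝ) ^ (i + 1) - 1)]
      simp only [Nat.add_sub_add_right, Nat.sub_zero]
      rw [div_mul_div_comm]
    rw [h1, h2]
    have h3 : (2 : ℝ) ^ (m + 1) = 2 ^ (r + 1) * 2 ^ (m - r) := by
      rw [← pow_add]; congr 1; omega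
    rw [h3]
    have := hden r
    field_simp
    ring

open Classical in
/-- The number of `m`-tuples of vectors that span a space of dimension `r`. -/
lemma card_finrank_span_eq (V : Type*) [AddCommGroup V] [Module (ZMod 2) V] [Fintype V]
    (m r : ℕ) :
    ((Finset.univ.filter fun A : Fin m → V =>
        finrank (ZMod 2) (Submodule.span (ZMod 2) (Set.range A)) = r).card : ℝ)
      = gaussianCoeff 2 m r
        * ∏ i ∈ Finset.range r, ((2 : ℝ) ^ finrank (ZMod 2) V - 2 ^ i) := by
  have : Module.Finite (ZMod 2) V := Module.Finite.of_finite
  have hfin : ∀ U : Submodule (ZMod 2) V, Fintype.card U = 2 ^ finrank (ZMod 2) U := fun U => by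
    rw [Module.card_eq_pow_finrank (K := ZMod 2), ZMod.card]
  have hcardV : Fintype.card V = 2 ^ finrank (ZMod 2) V := by
    rw [Module.card_eq_pow_finrank (K := ZMod 2), ZMod.card]
  induction m generalizing r with
  | zero =>
    cases r with
    | zero => simp [gaussianCoeff]
    | succ r =>
      rw [gaussianCoeff_zero_succ, zero_mul, Nat.cast_eq_zero, Finset.card_eq_zero,
        Finset.filter_eq_empty_iff]
      intro A _
      rw [Set.range_eq_empty, Submodule.span_empty, finrank_bot]
      omega
  | succ m ih =>
    -- A new first vector raises the dimension unless it is in the span. So dimension `r + 1` arises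
    -- from `r + 1` in `2 ^ (r + 1)` ways and from `r` in `2 ^ dim V - 2 ^ r` ways.
    have hspan : ∀ (x : V) (A : Fin m → V),
        finrank (ZMod 2) (Submodule.span (ZMod 2) (Set.range (Fin.cons x A : Fin (m + 1) → V)))
        = finrank (ZMod 2) (Submodule.span (ZMod 2) (Set.range A))
          + if x ∈ Submodule.span (ZMod 2) (Set.range A) then 0 else 1 := by
      intro x A
      rw [Fin.range_cons]
      split_ifs with h
      · rw [Submodule.span_insert_eq_span h, add_zero]
      · rw [Submodule.span_insert, sup_comm]
        exact Submodule.finrank_sup_span_singleton h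
    have hcount : ((Finset.univ.filter fun A : Fin (m + 1) → V =>
        finrank (ZMod 2) (Submodule.span (ZMod 2) (Set.range A)) = r).card : ℝ)
        = ∑ A : Fin m → V, ((Finset.univ.filter fun x : V =>
          finrank (ZMod 2) (Submodule.span (ZMod 2) (Set.range A))
          + (if x ∈ Submodule.span (ZMod 2) (Set.range A) then 0 else 1) = r).card : ℝ) := by
      rw [Finset.card_filter]
      push_cast
      rw [← (Fin.consEquiv fun _ : Fin (m + 1) => V).sum_comp, Fintype.sum_prod_type,
        Finset.sum_comm]
      refine Finset.sum_congr rfl fun A _ => ?_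
      rw [Finset.card_filter]
      push_cast
      refine Finset.sum_congr rfl fun x _ => ?_
      rw [← hspan x A]
      rfl
    have hin : ∀ A : Fin m → V, ((Finset.univ.filter fun x : V =>
        x ∈ Submodule.span (ZMod 2) (Set.range A)).card : ℝ)
        = 2 ^ finrank (ZMod 2) (Submodule.span (ZMod 2) (Set.range A)) := by
      intro A
      have := hfin (Submodule.span (ZMod 2) (Set.range A))
      rw [Fintype.card_subtype] at this
      exact_mod_cast this
    have hout : ∀ A : Fin m → V, ((Finset.univ.filter fun x : V =>
        x ∉ Submodule.span (ZMod 2) (Set.range A)).card : ℝ)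
        = 2 ^ finrank (ZMod 2) V
          - 2 ^ finrank (ZMod 2) (Submodule.span (ZMod 2) (Set.range A)) := by
      intro A
      have h := Finset.card_filter_add_card_filter_not (s := (Finset.univ : Finset V))
        (fun x => x ∈ Submodule.span (ZMod 2) (Set.range A))
      rw [Finset.card_univ, hcardV] at h
      rw [← hin A, eq_sub_iff_add_eq, add_comm]
      exact_mod_cast h
    rw [hcount]
    cases r with
    | zero =>
      have h1 : ∀ A : Fin m → V, ((Finset.univ.filter fun x : V =>
          finrank (ZMod 2) (Submodule.span (ZMod 2) (Set.range A))
          + (if x ∈ Submodule.span (ZMod 2) (Set.range A) then 0 else 1) = 0).card : ℝ)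
          = if finrank (ZMod 2) (Submodule.span (ZMod 2) (Set.range A)) = 0 then 1 else 0 := by
        intro A
        split_ifs with h
        · rw [h]
          have h2 := hin A
          rw [h, pow_zero] at h2
          rw [← h2]
          congr 2
          ext x
          simp
        · rw [Finset.filter_false_of_mem]
          · simp
          · intro x _; omega
      simp only [h1]
      have h2 := ih 0
      rw [Finset.card_filter] at h2
      push_cast at h2
      rw [h2]
      simp [gaussianCoeff]
    | succ r =>
      have h1 : ∀ A : Fin m → V, ((Finset.univ.filter fun x : V =>
          finrank (ZMod 2) (Submodule.span (ZMod 2) (Set.range A))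
          + (if x ∈ Submodule.span (ZMod 2) (Set.range A) then 0 else 1) = r + 1).card : ℝ)
          = (if finrank (ZMod 2) (Submodule.span (ZMod 2) (Set.range A)) = r + 1 then 1 else 0)
              * 2 ^ (r + 1)
            + (if finrank (ZMod 2) (Submodule.span (ZMod 2) (Set.range A)) = r then 1 else 0)
              * (2 ^ finrank (ZMod 2) V - 2 ^ r) := by
        intro A
        by_cases ha : finrank (ZMod 2) (Submodule.span (ZMod 2) (Set.range A)) = r + 1
        · rw [if_pos ha, if_neg (by omega), ← ha, ← hin A]
          simp only [one_mul, zero_mul, add_zero]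
          congr 2
          ext x
          simp
        · by_cases hb : finrank (ZMod 2) (Submodule.span (ZMod 2) (Set.range A)) = r
          · rw [if_neg ha, if_pos hb, zero_mul, zero_add, one_mul, ← hb, ← hout A]
            congr 2
            ext x
            simp
          · rw [if_neg ha, if_neg hb, zero_mul, zero_mul, Finset.filter_false_of_mem]
            · simp
            · intro x _
              split_ifs <;> omega
      simp only [h1]
      rw [Finset.sum_add_distrib, ← Finset.sum_mul, ← Finset.sum_mul]
      have h2 := ih (r + 1)
      have h3 := ih r
      rw [Finset.card_filter] at h2 h3
      push_cast at h2 h3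
      rw [h2, h3, gaussianCoeff_succ_succ, Finset.prod_range_succ]
      ring

lemma prod_Icc_eq_prod_range (f : ℕ → ℝ) (h r : ℕ) :
    ∏ j ∈ Finset.Icc (h + 1) (h + r), f j = ∏ i ∈ Finset.range r, f (h + r - i) := by
  induction r with
  | zero => simp
  | succ r ih =>
    rw [← add_assoc, Finset.prod_Icc_succ_top (by omega), ih, Finset.prod_range_succ']
    simp only [Nat.add_sub_add_right, Nat.sub_zero]

/-- The limiting probability is the proportion of the matrices of rank `r`. -/
lemma pStar_eq (h r m : ℕ) (hr : r ≤ m) :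
    pStar h r m = gaussianCoeff 2 m r * (∏ i ∈ Finset.range r, ((2 : ℝ) ^ (h + r) - 2 ^ i))
      / 2 ^ ((h + r) * m) := by
  have h1 : ∏ i ∈ Finset.range r, ((2 : ℝ) ^ (h + r) - 2 ^ i)
      = (2 ^ (h + r)) ^ r * ∏ i ∈ Finset.range r, (1 - (1 / 2 : ℝ) ^ (h + r - i)) := by
    have : ((2 : ℝ) ^ (h + r)) ^ r = ∏ _i ∈ Finset.range r, (2 : ℝ) ^ (h + r) := by simp
    rw [this, ← Finset.prod_mul_distrib]
    refine Finset.prod_congr rfl fun i hi => ?_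
    rw [Finset.mem_range] at hi
    have h2 : (2 : ℝ) ^ (h + r) = 2 ^ (h + r - i) * 2 ^ i := by rw [← pow_add]; congr 1; omega
    rw [mul_sub, mul_one, one_div, inv_pow]
    nth_rw 3 [h2]
    field_simp
  unfold pStar
  rw [prod_Icc_eq_prod_range, h1]
  have h3 : (2 : ℝ) ^ ((h + r) * m) = (2 ^ (h + r)) ^ r * 2 ^ ((h + r) * (m - r)) := by
    rw [← pow_mul, ← pow_add, ← mul_add]; congr 2; omega
  rw [h3, one_div, inv_pow]
  field_simp

lemma pStar_pos (h r m : ℕ) (hr : r ≤ m) : 0 < pStar h r m := by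
  unfold pStar gaussianCoeff
  have h1 : 0 < ∏ i ∈ Finset.range r, ((2 : ℝ) ^ (m - i) - 1) / (2 ^ (i + 1) - 1) := by
    refine Finset.prod_pos fun i hi => ?_
    rw [Finset.mem_range] at hi
    have h2 : (1 : ℝ) < 2 ^ (m - i) := one_lt_pow₀ (by norm_num) (by omega)
    have h3 : (1 : ℝ) < 2 ^ (i + 1) := one_lt_pow₀ (by norm_num) (by omega)
    exact div_pos (by linarith) (by linarith)
  have h4 : 0 < ∏ j ∈ Finset.Icc (h + 1) (h + r), (1 - (1 / 2 : ℝ) ^ j) := by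
    refine Finset.prod_pos fun j hj => ?_
    rw [Finset.mem_Icc] at hj
    have : (1 / 2 : ℝ) ^ j < 1 := pow_lt_one₀ (by norm_num) (by norm_num) (by omega)
    linarith
  positivity

end RankCount

/-! ### Small Fourier coefficients imply near-uniformity. -/

section Equidistribution

set_option linter.unusedSectionVars false

open Module

/-- A map into matrices over `GF(2)` with small nontrivial Fourier coefficients is nearly
equidistributed. -/
lemma card_preimage_sub_le {V τ : Type*} [Fintype V] [Fintype τ] [DecidableEq τ]
    (f : V → τ → ZMod 2) {δ : ℝ} (hδ : 0 ≤ δ)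
    (hf : ∀ T : τ → ZMod 2, T ≠ 0 → |∑ v, sgn (∑ i, T i * f v i)| ≤ δ * Fintype.card V)
    (S : Finset (τ → ZMod 2)) :
    |((Finset.univ.filter fun v => f v ∈ S).card : ℝ)
        - Fintype.card V * (S.card / 2 ^ Fintype.card τ)|
      ≤ 2 ^ Fintype.card τ * δ * Fintype.card V := by
  have hq : (0 : ℝ) < 2 ^ Fintype.card τ := by positivity
  have hcard : (Fintype.card (τ → ZMod 2) : ℝ) = 2 ^ Fintype.card τ := by
    rw [Fintype.card_fun, ZMod.card]; push_cast; rfl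
  have horth : ∀ x : τ → ZMod 2, ∑ T : τ → ZMod 2, sgn (∑ i, T i * x i)
      = if x = 0 then (2 : ℝ) ^ Fintype.card τ else 0 := by
    intro x
    split_ifs with hx
    · simp [hx, sgn_zero]
    · let g : (τ → ZMod 2) →ₗ[ZMod 2] ZMod 2 :=
        ∑ i, x i • LinearMap.proj (R := ZMod 2) (φ := fun _ : τ => ZMod 2) i
      have hg : ∀ T, g T = ∑ i, T i * x i := by
        intro T
        simp only [g, LinearMap.sum_apply, LinearMap.smul_apply, LinearMap.proj_apply,
          smul_eq_mul]
        exact Finset.sum_congr rfl fun i _ => mul_comm _ _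
      simp only [← hg]
      refine sum_sgn_linearMap g fun h0 => hx ?_
      funext i
      have := hg (Pi.single i 1)
      rw [h0] at this
      simpa [Pi.single_apply] using this.symm
  -- Fourier inversion at a single value: `T = 0` gives the uniform share, and the other `T`
  -- together add an error of at most `δ * |V|` after division by the number of characters.
  have hpoint : ∀ a : τ → ZMod 2,
      |((Finset.univ.filter fun v => f v = a).card : ℝ) - Fintype.card V / 2 ^ Fintype.card τ|
        ≤ δ * Fintype.card V := by
    intro a
    have h1 : 2 ^ Fintype.card τ * ((Finset.univ.filter fun v => f v = a).card : ℝ)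
        = ∑ T : τ → ZMod 2, sgn (∑ i, T i * a i) * ∑ v, sgn (∑ i, T i * f v i) := by
      simp only [Finset.mul_sum]
      rw [Finset.sum_comm, Finset.card_filter]
      push_cast
      rw [Finset.mul_sum]
      refine Finset.sum_congr rfl fun v _ => ?_
      have h2 : ∀ T : τ → ZMod 2, sgn (∑ i, T i * a i) * sgn (∑ i, T i * f v i)
          = sgn (∑ i, T i * (a + f v) i) := by
        intro T
        rw [← sgn_add, ← Finset.sum_add_distrib]
        congr 1
        exact Finset.sum_congr rfl fun i _ => by rw [Pi.add_apply, mul_add]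
      simp only [h2]
      rw [horth]
      have h3 : a + f v = 0 ↔ f v = a := by
        constructor
        · intro h; funext i
          exact (CharTwo.add_eq_zero.1 (congrFun h i)).symm
        · rintro rfl; funext i; exact CharTwo.add_self_eq_zero _
      simp only [h3]
      split_ifs <;> simp
    rw [← Finset.add_sum_erase _ _ (Finset.mem_univ (0 : τ → ZMod 2))] at h1
    simp only [Pi.zero_apply, zero_mul, Finset.sum_const_zero, sgn_zero, Finset.sum_const,
      Finset.card_univ, nsmul_eq_mul, mul_one, one_mul] at h1
    have h4 : |∑ T ∈ Finset.univ.erase (0 : τ → ZMod 2), sgn (∑ i, T i * a i)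
        * ∑ v, sgn (∑ i, T i * f v i)| ≤ 2 ^ Fintype.card τ * (δ * Fintype.card V) := by
      refine (Finset.abs_sum_le_sum_abs _ _).trans ?_
      refine (Finset.sum_le_card_nsmul _ _ (δ * Fintype.card V) fun T hT => ?_).trans ?_
      · rw [abs_mul, abs_sgn, one_mul]
        exact hf T (Finset.ne_of_mem_erase hT)
      · rw [nsmul_eq_mul]
        gcongr
        rw [← hcard, ← Finset.card_univ]
        exact_mod_cast Finset.card_le_card (Finset.erase_subset _ _)
    rw [← mul_le_mul_iff_right₀ hq, ← abs_of_pos hq, ← abs_mul, abs_of_pos hq, mul_sub, h1,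
      mul_div_cancel₀ _ hq.ne', add_sub_cancel_left]
    exact h4
  have hsum : ((Finset.univ.filter fun v => f v ∈ S).card : ℝ)
        - Fintype.card V * (S.card / 2 ^ Fintype.card τ)
      = ∑ a ∈ S, (((Finset.univ.filter fun v => f v = a).card : ℝ)
        - Fintype.card V / 2 ^ Fintype.card τ) := by
    rw [Finset.sum_sub_distrib, Finset.sum_const, nsmul_eq_mul]
    congr 1
    · rw [Finset.card_eq_sum_card_fiberwise (f := f) (t := S) fun v hv => by simpa using hv]
      push_cast
      refine Finset.sum_congr rfl fun a ha => ?_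
      congr 2
      ext v
      simp only [Finset.mem_filter, Finset.mem_univ, true_and]
      exact ⟨fun h => h.2, fun h => ⟨h ▸ ha, h⟩⟩
    · ring
  rw [hsum]
  refine (Finset.abs_sum_le_sum_abs _ _).trans ?_
  refine (Finset.sum_le_card_nsmul _ _ _ fun a _ => hpoint a).trans ?_
  rw [nsmul_eq_mul, mul_assoc]
  gcongr
  rw [← hcard, ← Finset.card_univ]
  exact_mod_cast Finset.card_le_card (Finset.subset_univ S)

end Equidistribution

/-! ### Rank of the pairing matrix for a uniform choice of outer rows. -/

section RankDistribution

set_option linter.unusedSectionVars false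

open Module

variable {μ κ : Type*} [Fintype μ] [Fintype κ]

/-- The vectors whose pullback along `v` is orthogonal to `R`. -/
def pullbackOrth (R : Submodule (ZMod 2) (μ → ZMod 2)) (v : μ → κ) :
    Submodule (ZMod 2) (κ → ZMod 2) where
  carrier := {y | ∀ z ∈ R, ∑ j, z j * y (v j) = 0}
  add_mem' := by
    intro a b ha hb z hz
    simp only [Pi.add_apply, mul_add, Finset.sum_add_distrib, ha z hz, hb z hz, add_zero]
  zero_mem' := by intro z _; simp
  smul_mem' := by
    intro c a ha z hz
    simp only [Pi.smul_apply, smul_eq_mul, mul_left_comm _ c, ← Finset.mul_sum, ha z hz, mul_zero]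

lemma mem_pullbackOrth {R : Submodule (ZMod 2) (μ → ZMod 2)} {v : μ → κ} {y : κ → ZMod 2} :
    y ∈ pullbackOrth R v ↔ ∀ z ∈ R, ∑ j, z j * y (v j) = 0 := Iff.rfl

/-- The pairing of a basis of `R` with the pullbacks of a basis of `K`. -/
def pairing {k m : ℕ} (y : Fin k → κ → ZMod 2) (z : Fin m → μ → ZMod 2) (v : μ → κ) :
    Matrix (Fin m) (Fin k) (ZMod 2) := fun β α => ∑ j, z β j * y α (v j)

/-- In coordinates with respect to `bK`, the intersection is the kernel of the pairing matrix, so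
this is rank-nullity with the row rank. -/
lemma finrank_inf_pullbackOrth {K : Submodule (ZMod 2) (κ → ZMod 2)}
    {R : Submodule (ZMod 2) (μ → ZMod 2)} {k m : ℕ} (bK : Basis (Fin k) (ZMod 2) K)
    (bR : Basis (Fin m) (ZMod 2) R) (v : μ → κ) :
    finrank (ZMod 2) (Submodule.span (ZMod 2) (Set.range
        (pairing (fun α => (bK α).1) (fun β => (bR β).1) v)))
      + finrank (ZMod 2) ↥(K ⊓ pullbackOrth R v) = k := by
  set A := pairing (fun α => (bK α).1) (fun β => (bR β).1) v with hA
  let g : (Fin k → ZMod 2) →ₗ[ZMod 2] (κ → ZMod 2) :=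
    K.subtype ∘ₗ bK.equivFun.symm.toLinearMap
  have hg : Function.Injective g := by
    simp only [g, LinearMap.coe_comp]
    exact K.injective_subtype.comp bK.equivFun.symm.injective
  have hgx : ∀ c x, g c x = ∑ α, c α * (bK α).1 x := by
    intro c x
    simp [g, Basis.equivFun_symm_apply, Finset.sum_apply]
  have hmul : ∀ c β, A.mulVec c β = ∑ j, (bR β).1 j * g c (v j) := by
    intro c β
    simp only [Matrix.mulVec, dotProduct, hA, pairing, hgx, Finset.mul_sum, Finset.sum_mul]
    rw [Finset.sum_comm]
    refine Finset.sum_congr rfl fun j _ => Finset.sum_congr rfl fun α _ => ?_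
    ring
  have hker : (LinearMap.ker A.mulVecLin).map g = K ⊓ pullbackOrth R v := by
    ext y
    simp only [Submodule.mem_map, LinearMap.mem_ker, Matrix.mulVecLin_apply, Submodule.mem_inf,
      mem_pullbackOrth]
    constructor
    · rintro ⟨c, hc, rfl⟩
      refine ⟨(bK.equivFun.symm c).2, fun z hz => ?_⟩
      have h1 := bR.sum_repr ⟨z, hz⟩
      have h2 : ∀ j, z j = ∑ β, bR.repr ⟨z, hz⟩ β * (bR β).1 j := by
        intro j
        have := congrArg (fun u : R => u.1 j) h1
        simp only [AddSubmonoidClass.coe_finsetSum, Submodule.coe_smul, Finset.sum_apply,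
          Pi.smul_apply, smul_eq_mul] at this
        exact this.symm
      simp only [h2, Finset.sum_mul]
      rw [Finset.sum_comm]
      refine Finset.sum_eq_zero fun β _ => ?_
      simp only [mul_assoc, ← Finset.mul_sum]
      rw [← hmul c β, hc]
      simp
    · rintro ⟨hyK, hy⟩
      refine ⟨bK.equivFun ⟨y, hyK⟩, ?_, by simp [g]⟩
      funext β
      rw [hmul]
      have : g (bK.equivFun ⟨y, hyK⟩) = y := by simp [g]
      rw [this]
      exact hy _ (bR β).2
  have h3 := (Submodule.equivMapOfInjective g hg (LinearMap.ker A.mulVecLin)).finrank_eq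
  rw [hker] at h3
  rw [← h3]
  have h4 := LinearMap.finrank_range_add_finrank_ker A.mulVecLin
  rw [finrank_fin_fun] at h4
  have h5 : finrank (ZMod 2) (LinearMap.range A.mulVecLin)
      = finrank (ZMod 2) (Submodule.span (ZMod 2) (Set.range A.row)) :=
    Matrix.rank_eq_finrank_span_row A
  rw [h5] at h4
  exact h4

open Classical in
/-- The dimension of `K ∩ pullbackOrth R v` for uniformly distributed `v`. -/
lemma card_finrank_pullbackOrth_sub_le {K : Submodule (ZMod 2) (κ → ZMod 2)}
    {R : Submodule (ZMod 2) (μ → ZMod 2)} {h r m : ℕ} (hr : r ≤ m)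
    (hK : finrank (ZMod 2) K = h + r) (hR : finrank (ZMod 2) R = m) {δ : ℝ} (hδ : 0 ≤ δ)
    (hy : ∀ y ∈ K, y ≠ 0 → |∑ a, sgn (y a)| ≤ δ * Fintype.card κ) :
    |((Finset.univ.filter fun v : μ → κ =>
        finrank (ZMod 2) ↥(K ⊓ pullbackOrth R v) = h).card : ℝ)
        - (Fintype.card κ : ℝ) ^ Fintype.card μ * pStar h r m|
      ≤ 2 ^ (m * (h + r)) * δ * (Fintype.card κ : ℝ) ^ Fintype.card μ := by
  let bK := finBasisOfFinrankEq (ZMod 2) K hK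
  let bR := finBasisOfFinrankEq (ZMod 2) R hR
  let f : (μ → κ) → Fin m × Fin (h + r) → ZMod 2 := fun v p =>
    pairing (fun α => (bK α).1) (fun β => (bR β).1) v p.1 p.2
  have hV : (Fintype.card (μ → κ) : ℝ) = (Fintype.card κ : ℝ) ^ Fintype.card μ := by
    rw [Fintype.card_fun]; push_cast; rfl
  have hf : ∀ T : Fin m × Fin (h + r) → ZMod 2, T ≠ 0 →
      |∑ v, sgn (∑ i, T i * f v i)| ≤ δ * Fintype.card (μ → κ) := by
    intro T hT
    -- Grouped by `j`, the exponent of the character is a sum of `t j (v j)`. As the `v j` range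
    -- independently, the character sum is a product over `j`, and each `t j` lies in `K`.
    let t : μ → κ → ZMod 2 := fun j b => ∑ p : Fin m × Fin (h + r),
      T p * (bR p.1).1 j * (bK p.2).1 b
    have h1 : ∀ v, ∑ i, T i * f v i = ∑ j, t j (v j) := by
      intro v
      simp only [f, pairing, t, Finset.mul_sum]
      rw [Finset.sum_comm]
      refine Finset.sum_congr rfl fun j _ => Finset.sum_congr rfl fun p _ => ?_
      ring
    have h2 : ∑ v, sgn (∑ i, T i * f v i) = ∏ j, ∑ b, sgn (t j b) := by
      rw [Finset.prod_univ_sum]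
      rw [Fintype.piFinset_univ]
      refine Finset.sum_congr rfl fun v _ => ?_
      rw [h1, sgn_sum]
    have htj : ∀ j, t j = ∑ α, (∑ β, T (β, α) * (bR β).1 j) • (bK α).1 := by
      intro j
      funext b
      simp only [t, Finset.sum_apply, Pi.smul_apply, smul_eq_mul, Fintype.sum_prod_type,
        Finset.sum_mul]
      exact Finset.sum_comm
    have htK : ∀ j, t j ∈ K := fun j => by
      rw [htj]
      exact K.sum_mem fun α _ => K.smul_mem _ (bK α).2
    -- If all `t j` were zero, independence of the basis of `K` and then of that of `R` would give
    -- `T = 0`. The factor at `j₀` is small by hypothesis; the others are bounded trivially.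
    obtain ⟨j₀, hj₀⟩ : ∃ j, t j ≠ 0 := by
      by_contra hcon
      push Not at hcon
      refine hT ?_
      funext p
      have h3 : ∀ j α, ∑ β, T (β, α) * (bR β).1 j = 0 := by
        intro j
        have h4 : ∑ α, (∑ β, T (β, α) * (bR β).1 j) • bK α = 0 := by
          apply Subtype.ext
          have := hcon j
          rw [htj] at this
          rw [AddSubmonoidClass.coe_finsetSum]
          simpa using this
        exact Fintype.linearIndependent_iff.1 bK.linearIndependent _ h4
      have h5 : ∑ β, T (β, p.2) • bR β = 0 := by
        apply Subtype.ext
        funext j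
        rw [AddSubmonoidClass.coe_finsetSum]
        simpa using h3 j p.2
      exact Fintype.linearIndependent_iff.1 bR.linearIndependent _ h5 p.1
    rw [h2, Finset.abs_prod, hV, ← Finset.mul_prod_erase _ _ (Finset.mem_univ j₀)]
    have h6 : ∏ j ∈ Finset.univ.erase j₀, |∑ b, sgn (t j b)|
        ≤ (Fintype.card κ : ℝ) ^ (Fintype.card μ - 1) := by
      refine (Finset.prod_le_prod (g := fun _ => (Fintype.card κ : ℝ)) (fun _ _ => abs_nonneg _)
        fun j _ => ?_).trans (le_of_eq ?_)
      · refine (Finset.abs_sum_le_sum_abs _ _).trans ?_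
        simp [abs_sgn]
      · rw [Finset.prod_const, Finset.card_erase_of_mem (Finset.mem_univ _), Finset.card_univ]
    have h7 : 0 < Fintype.card μ := Fintype.card_pos_iff.2 ⟨j₀⟩
    calc |∑ b, sgn (t j₀ b)| * ∏ j ∈ Finset.univ.erase j₀, |∑ b, sgn (t j b)|
        ≤ (δ * Fintype.card κ) * (Fintype.card κ : ℝ) ^ (Fintype.card μ - 1) := by
          gcongr
          exact hy _ (htK j₀) hj₀
      _ = δ * (Fintype.card κ : ℝ) ^ Fintype.card μ := by
          rw [mul_assoc, ← pow_succ', Nat.sub_add_cancel h7]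
  -- By rank-nullity, an intersection of dimension `h` in a space of dimension `h + r` means rank
  -- `r`.
  let S : Finset (Fin m × Fin (h + r) → ZMod 2) := Finset.univ.filter fun a =>
    finrank (ZMod 2) (Submodule.span (ZMod 2) (Set.range fun β α => a (β, α))) = r
  have hS : (S.card : ℝ) / 2 ^ Fintype.card (Fin m × Fin (h + r)) = pStar h r m := by
    rw [pStar_eq h r m hr]
    have h1 := card_finrank_span_eq (Fin (h + r) → ZMod 2) m r
    rw [finrank_fin_fun] at h1
    rw [← h1, Fintype.card_prod, Fintype.card_fin, Fintype.card_fin, mul_comm m]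
    congr 2
    refine Finset.card_equiv (Equiv.curry _ _ _) fun a => ?_
    simp only [S, Finset.mem_filter, Finset.mem_univ, true_and]
    rfl
  have key := card_preimage_sub_le f hδ hf S
  rw [hS, hV] at key
  have h8 : (Finset.univ.filter fun v : μ → κ => f v ∈ S)
      = Finset.univ.filter fun v : μ → κ => finrank (ZMod 2) ↥(K ⊓ pullbackOrth R v) = h := by
    ext v
    have h9 := finrank_inf_pullbackOrth bK bR v
    simp only [S, Finset.mem_filter, Finset.mem_univ, true_and]
    have h10 : (fun β α => f v (β, α))
      = pairing (fun α => (bK α).1) (fun β => (bR β).1) v := rfl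
    rw [h10]
    omega
  rw [h8, Fintype.card_prod, Fintype.card_fin, Fintype.card_fin] at key
  exact key

end RankDistribution

/-! ### Simple sequences as linear independence. -/

section SimpleSequences

set_option linter.unusedSectionVars false

open Module

variable {ι : Type} [Fintype ι] [DecidableEq ι]

lemma chi_symmDiffOver {k : ℕ} (B : Fin k → Finset ι) (I : Finset (Fin k)) :
    chi (symmDiffOver B I) = ∑ i ∈ I, chi (B i) := by
  funext x
  rw [Finset.sum_apply]
  simp only [chi, symmDiffOver, Finset.mem_filter, Finset.mem_univ, true_and, Finset.sum_boole]
  split_ifs with h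
  · exact (ZMod.natCast_eq_one_iff_odd.2 h).symm
  · exact (ZMod.natCast_eq_zero_iff_even.2 (Nat.not_odd_iff_even.1 h)).symm

/-- The left kernel of a matrix. -/
def leftKer (M : Matrix ι ι (ZMod 2)) : Submodule (ZMod 2) (ι → ZMod 2) :=
  LinearMap.ker M.vecMulLinear

lemma mem_leftKer {M : Matrix ι ι (ZMod 2)} {w : ι → ZMod 2} :
    w ∈ leftKer M ↔ ∀ j, ∑ i, w i * M i j = 0 := by
  simp only [leftKer, LinearMap.mem_ker, Matrix.vecMulLinear_apply, funext_iff]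
  rfl

lemma chi_mem_leftKer {M : Matrix ι ι (ZMod 2)} {S : Finset ι} :
    chi S ∈ leftKer M ↔ ∀ j, ∑ i ∈ S, M i j = 0 := by
  simp [mem_leftKer, chi]

lemma isDependency_iff {M : Matrix ι ι (ZMod 2)} {S : Finset ι} :
    IsDependency M S ↔ S.Nonempty ∧ chi S ∈ leftKer M := by
  rw [chi_mem_leftKer, IsDependency]

lemma isDependency_supp {M : Matrix ι ι (ZMod 2)} {w : ι → ZMod 2} (hw : w ∈ leftKer M)
    (h : w ≠ 0) : IsDependency M (supp w) := by
  rw [isDependency_iff, chi_supp]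
  exact ⟨Finset.nonempty_iff_ne_empty.2 fun h' => h (supp_eq_empty.1 h'), hw⟩

/-- If the kernel vectors of large weight are those off the kernel of `π`, the maximal length of a
simple sequence is the rank of `π` on the left kernel. -/
lemma hasMaxSimple_iff {U : Type*} [AddCommGroup U] [Module (ZMod 2) U] [Module.Finite (ZMod 2) U]
    {M : Matrix ι ι (ZMod 2)} (π : (ι → ZMod 2) →ₗ[ZMod 2] U)
    (hπ : ∀ w ∈ leftKer M, IsLargeSize (Fintype.card ι) (supp w).card ↔ π w ≠ 0) (l : ℕ) :
    HasMaxSimple M l ↔ finrank (ZMod 2) ((leftKer M).map π) = l := by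
  have key : HasMaxSimple M (finrank (ZMod 2) ((leftKer M).map π)) := by
    constructor
    · let b := finBasis (ZMod 2) ((leftKer M).map π)
      -- Lower bound: lift a basis of the image. A nonempty sum of lifts is not killed by `π`, hence
      -- is large.
      have h1 : ∀ i, ∃ w ∈ leftKer M, π w = (b i).1 := fun i => (b i).2
      choose w hw hwb using h1
      have hsum : ∀ I : Finset (Fin (finrank (ZMod 2) ((leftKer M).map π))), I.Nonempty →
          π (∑ i ∈ I, w i) ≠ 0 := by
        intro I hI h0
        obtain ⟨i₀, hi₀⟩ := hI
        have h2 : ∑ i ∈ I, (1 : ZMod 2) • b i = 0 := by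
          apply Subtype.ext
          rw [AddSubmonoidClass.coe_finsetSum]
          simp only [one_smul, ← hwb]
          rw [← map_sum, h0]
          rfl
        have := linearIndependent_iff'.1 b.linearIndependent I (fun _ => 1) h2 i₀ hi₀
        exact one_ne_zero this
      refine ⟨fun i => supp (w i), fun i => isDependency_supp (hw i) ?_, fun I hI => ?_⟩
      · intro h0
        have := hsum {i} ⟨i, by simp⟩
        rw [Finset.sum_singleton, h0, map_zero] at this
        exact this rfl
      · have h3 : symmDiffOver (fun i => supp (w i)) I = supp (∑ i ∈ I, w i) := by
          rw [← supp_chi (symmDiffOver (fun i => supp (w i)) I), chi_symmDiffOver]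
          simp only [chi_supp]
        rw [h3, hπ _ ((leftKer M).sum_mem fun i _ => hw i)]
        exact hsum I hI
    · rintro k ⟨B, hB, hlarge⟩
      have hmem : ∀ i, chi (B i) ∈ leftKer M := fun i => (isDependency_iff.1 (hB i)).2
      -- Upper bound: over GF(2), a linear relation between the images is a nonempty subfamily whose
      -- symmetric difference is killed by `π`, so it is not large, against simplicity.
      let u : Fin k → (leftKer M).map π := fun i => ⟨π (chi (B i)), chi (B i), hmem i, rfl⟩
      have hu : LinearIndependent (ZMod 2) u := by
        rw [Fintype.linearIndependent_iff]
        intro c hc i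
        by_contra hi
        have h1 : ∑ i, c i • u i = ∑ i ∈ Finset.univ.filter (fun i => c i ≠ 0), u i := by
          rw [Finset.sum_filter]
          refine Finset.sum_congr rfl fun i _ => ?_
          rcases zmod_two_eq (c i) with h | h <;> simp [h]
        have h2 := hlarge (Finset.univ.filter fun i => c i ≠ 0) ⟨i, by simpa using hi⟩
        rw [← supp_chi (symmDiffOver B _), chi_symmDiffOver,
          hπ _ ((leftKer M).sum_mem fun i _ => hmem i)] at h2
        apply h2
        rw [h1] at hc
        have h3 := congrArg Subtype.val hc
        rw [AddSubmonoidClass.coe_finsetSum] at h3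
        rw [map_sum]
        exact h3
      simpa using hu.fintype_card_le_finrank
  constructor
  · intro h; exact key.unique h
  · rintro rfl; exact key

end SimpleSequences

/-! ### Right kernel and row space of a square matrix. -/

section RightKernel

set_option linter.unusedSectionVars false

open Module

variable {ι : Type} [Fintype ι] [DecidableEq ι]

/-- The right kernel of a matrix. -/
def rightKer (S : Matrix ι ι (ZMod 2)) : Submodule (ZMod 2) (ι → ZMod 2) :=
  LinearMap.ker S.mulVecLin

lemma finrank_rightKer (S : Matrix ι ι (ZMod 2)) :
    finrank (ZMod 2) (rightKer S) = finrank (ZMod 2) (leftKer S) := by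
  have h1 := LinearMap.finrank_range_add_finrank_ker S.mulVecLin
  have h2 := LinearMap.finrank_range_add_finrank_ker S.transpose.mulVecLin
  have h3 : S.transpose.rank = S.rank := Matrix.rank_transpose S
  have h4 : leftKer S = LinearMap.ker S.transpose.mulVecLin := by
    ext w
    simp [leftKer]
  unfold Matrix.rank at h3
  rw [h4, rightKer]
  omega

/-- The range of the transpose is the annihilator of the kernel. -/
lemma exists_vecMul_eq_iff (S : Matrix ι ι (ZMod 2)) (u : ι → ZMod 2) :
    (∃ x, Matrix.vecMul x S = u) ↔ ∀ z ∈ rightKer S, ∑ j, z j * u j = 0 := by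
  constructor
  · rintro ⟨x, rfl⟩ z hz
    have h : S.mulVec z = 0 := by simpa [rightKer] using hz
    have h2 : ∑ j, z j * Matrix.vecMul x S j = dotProduct (Matrix.vecMul x S) z := by
      simp [dotProduct, mul_comm]
    rw [h2, ← Matrix.dotProduct_mulVec, h, dotProduct_zero]
  · intro h
    by_contra hu
    have hu' : u ∉ LinearMap.range S.vecMulLinear := by
      rintro ⟨x, hx⟩; exact hu ⟨x, hx⟩
    -- A functional that vanishes on the row space but not at `u` is the pairing with a vector `z`;
    -- vanishing on the rows puts `z` in the right kernel.
    obtain ⟨f, hf, hfr⟩ := Submodule.exists_le_ker_of_notMem hu'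
    let z : ι → ZMod 2 := fun j => f (Pi.single j 1)
    have hfz : ∀ y, f y = ∑ j, z j * y j := by
      intro y
      rw [LinearMap.pi_apply_eq_sum_univ f y]
      refine Finset.sum_congr rfl fun j _ => ?_
      rw [smul_eq_mul, mul_comm]
      simp only [z]
      congr 2
      funext i
      simp [Pi.single_apply, eq_comm]
    refine hf ?_
    rw [hfz]
    refine h z ?_
    rw [rightKer, LinearMap.mem_ker]
    funext i
    have h5 : f (Matrix.vecMul (Pi.single i 1) S) = 0 := hfr ⟨_, rfl⟩
    rw [hfz] at h5
    simp only [Matrix.single_one_vecMul] at h5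
    simp only [Matrix.mulVecLin_apply, Matrix.mulVec, dotProduct, Pi.zero_apply]
    rw [← h5]
    exact Finset.sum_congr rfl fun j _ => mul_comm _ _

end RightKernel

/-! ### Structure of the matrix under the block hypothesis. -/

section Blocks

open Module

variable {n : ℕ}

/-- The extension by zero of a vector. -/
def extendZero {p : Fin n → Prop} [DecidablePred p] (x : {i // p i} → ZMod 2) : Fin n → ZMod 2 :=
  fun i => if h : p i then x ⟨i, h⟩ else 0

lemma extendZero_of_pos {p : Fin n → Prop} [DecidablePred p] (x : {i // p i} → ZMod 2) {i : Fin n}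
    (h : p i) : extendZero x i = x ⟨i, h⟩ := dif_pos h

lemma extendZero_of_neg {p : Fin n → Prop} [DecidablePred p] (x : {i // p i} → ZMod 2) {i : Fin n}
    (h : ¬ p i) : extendZero x i = 0 := dif_neg h

lemma sum_mul_outMatrix {p : Fin n → Prop} [DecidablePred p] [Fintype {i // p i}]
    (x : {i // p i} → ZMod 2) (e : Fin n → Fin n × Fin n) (j : Fin n) :
    ∑ i, x i * outMatrix e i.1 j
      = extendZero x j + extendZero x (e j).1 + extendZero x (e j).2 := by
  have h : ∀ c : Fin n, ∑ i : {i // p i}, x i * (if i.1 = c then 1 else 0) = extendZero x c := by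
    intro c
    by_cases hc : p c
    · rw [extendZero_of_pos x hc, Finset.sum_eq_single ⟨c, hc⟩]
      · simp
      · intro b _ hb
        rw [if_neg fun h' => hb (Subtype.ext h'), mul_zero]
      · simp
    · rw [extendZero_of_neg x hc]
      refine Finset.sum_eq_zero fun b _ => ?_
      rw [if_neg fun (h' : b.1 = c) => hc (h' ▸ b.2), mul_zero]
  simp only [outMatrix, mul_add, Finset.sum_add_distrib, h]

lemma mem_leftKer_outMatrix {e : Fin n → Fin n × Fin n} {w : Fin n → ZMod 2} :
    w ∈ leftKer (outMatrix e) ↔ ∀ j, w j + w (e j).1 + w (e j).2 = 0 := by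
  simp [mem_leftKer, outMatrix, mul_add, Finset.sum_add_distrib]

/-- The block of `outMatrix e` on the indices that satisfy `p`. -/
abbrev block (e : Fin n → Fin n × Fin n) (p : Fin n → Prop) :
    Matrix {i // p i} {i // p i} (ZMod 2) :=
  (outMatrix e).submatrix (fun i => i.val) (fun i => i.val)

lemma mem_leftKer_block {e : Fin n → Fin n × Fin n} {p : Fin n → Prop} [DecidablePred p]
    [Fintype {i // p i}] {x : {i // p i} → ZMod 2} : x ∈ leftKer (block e p) ↔
      ∀ j : {i // p i}, x j + extendZero x (e j.1).1 + extendZero x (e j.1).2 = 0 := by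
  rw [mem_leftKer]
  refine forall_congr' fun j => ?_
  have h := sum_mul_outMatrix x e j.1
  rw [extendZero_of_pos x j.2] at h
  rw [← h]
  rfl

/-- In the columns of `L`, one of the random rows is in `L` and the other one is `v j`, off `L`. -/
def Outer (L : Finset (Fin n)) (e : Fin n → Fin n × Fin n)
    (v : {i // i ∈ L} → {i // i ∉ L}) : Prop :=
  ∀ j : {i // i ∈ L}, ((e j.1).1 ∈ L ∧ (e j.1).2 = (v j).1) ∨ ((e j.1).1 = (v j).1 ∧ (e j.1).2 ∈ L)

/-- In the columns off `L`, the random rows are off `L` or cancel. -/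
def OffClosed (L : Finset (Fin n)) (e : Fin n → Fin n × Fin n) : Prop :=
  ∀ j ∉ L, ((e j).1 ∉ L ∧ (e j).2 ∉ L) ∨ ((e j).1 = (e j).2 ∧ (e j).1 ∈ L)

/-- The zero block still allows two equal random rows in `L`, since they cancel; this happens only
with replacement. -/
lemma offClosed_iff {L : Finset (Fin n)} {e : Fin n → Fin n × Fin n} :
    OffClosed L e ↔ ∀ i ∈ L, ∀ j ∉ L, outMatrix e i j = 0 := by
  constructor
  · intro h i hi j hj
    have hij : i ≠ j := fun h' => hj (h' ▸ hi)
    rcases h j hj with ⟨h1, h2⟩ | ⟨h1, h2⟩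
    · simp only [outMatrix]
      rw [if_neg hij, if_neg fun (h' : i = (e j).1) => h1 (h' ▸ hi),
        if_neg fun (h' : i = (e j).2) => h2 (h' ▸ hi)]; simp
    · simp only [outMatrix]
      rw [if_neg hij, h1, zero_add, CharTwo.add_self_eq_zero]
  · intro h j hj
    by_cases heq : (e j).1 = (e j).2
    · by_cases h1 : (e j).1 ∈ L
      · exact Or.inr ⟨heq, h1⟩
      · exact Or.inl ⟨h1, heq ▸ h1⟩
    · left
      constructor
      · intro h1
        have := h _ h1 j hj
        simp only [outMatrix] at this
        rw [if_neg fun (h' : (e j).1 = j) => hj (h' ▸ h1), if_neg heq] at this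
        simp at this
      · intro h1
        have := h _ h1 j hj
        simp only [outMatrix] at this
        rw [if_neg fun (h' : (e j).2 = j) => hj (h' ▸ h1),
          if_neg fun h' => heq h'.symm] at this
        simp at this

section Splits

variable {L : Finset (Fin n)} {e : Fin n → Fin n × Fin n} {w m : ℕ}

/-- This makes |L| at most mω, so it is negligible against √n, uniformly in L. -/
lemma SplitsIntoSmallFundamental.card_le {ι : Type} [Fintype ι] [DecidableEq ι]
    {S : Matrix ι ι (ZMod 2)} (h : SplitsIntoSmallFundamental S w m) :
    Fintype.card ι ≤ m * w := by
  obtain ⟨h1, -, h3⟩ := h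
  rw [← h3, ← h1, ← smul_eq_mul]
  refine Finset.sum_le_card_nsmul _ _ _ fun B hB => ?_
  simp only [smallFundamental, Finset.mem_filter] at hB
  exact hB.2.2

/-- The dependencies are disjoint and their sizes add up to the number of rows, so they cover all
rows. -/
lemma SplitsIntoSmallFundamental.exists_mem {ι : Type} [Fintype ι] [DecidableEq ι]
    {S : Matrix ι ι (ZMod 2)} (h : SplitsIntoSmallFundamental S w m) (i : ι) :
    ∃ B ∈ smallFundamental S w, i ∈ B := by
  obtain ⟨-, h2, h3⟩ := h
  have h4 : ((smallFundamental S w).biUnion id).card = Fintype.card ι := by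
    rw [← h3]
    exact Finset.card_biUnion fun S hS T hT hST => h2 S hS T hT hST
  have h5 := Finset.eq_univ_of_card _ h4
  have h6 : i ∈ (smallFundamental S w).biUnion id := h5 ▸ Finset.mem_univ i
  simpa using h6

lemma extendZero_chi_ne_zero_iff {p : Fin n → Prop} [DecidablePred p] (B : Finset {i // p i})
    (i : Fin n) : extendZero (chi B) i ≠ 0 ↔ ∃ h : p i, (⟨i, h⟩ : {i // p i}) ∈ B := by
  by_cases h : p i
  · rw [extendZero_of_pos _ h]; simp [chi, h]
  · rw [extendZero_of_neg _ h]; simp [h]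

/-- The random rows of a column of `L`: one lies in the block of the column, the other one off
`L`. -/
lemma exists_inner (h : SplitsIntoSmallFundamental (block e (· ∈ L)) w m) (j : {i // i ∈ L}) :
    ∃ a : {i // i ∈ L}, (∀ B ∈ smallFundamental (block e (· ∈ L)) w, j ∈ B ↔ a ∈ B) ∧
      (((e j.1).1 = a.1 ∧ (e j.1).2 ∉ L) ∨ ((e j.1).1 ∉ L ∧ (e j.1).2 = a.1)) := by
  obtain ⟨B, hB, hj⟩ := h.exists_mem j
  have hdisj := h.2.1
  have heq : ∀ B ∈ smallFundamental (block e (· ∈ L)) w,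
      chi B j + extendZero (chi B) (e j.1).1 + extendZero (chi B) (e j.1).2 = 0 := by
    intro B hB
    simp only [smallFundamental, Finset.mem_filter] at hB
    exact mem_leftKer_block.1 (isDependency_iff.1 hB.2.1.1).2 j
  have hchi : chi B j = 1 := by simp [chi, hj]
  -- Orthogonality to `B` puts exactly one random row `a` in `B`. If the other one, `b`, were in
  -- `L`, it would lie in another dependency `B'`, and column `j` would meet `B'` only in `b`, which
  -- is impossible.
  have key : ∀ a b : Fin n, extendZero (chi B) a ≠ 0 → extendZero (chi B) b = 0 →
      (∀ B' ∈ smallFundamental (block e (· ∈ L)) w,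
        chi B' j + extendZero (chi B') a + extendZero (chi B') b = 0) →
      b ∉ L ∧ ∃ a' : {i // i ∈ L}, a = a'.1 ∧
        ∀ B' ∈ smallFundamental (block e (· ∈ L)) w, j ∈ B' ↔ a' ∈ B' := by
    intro a b ha hb hab
    obtain ⟨haL, haB⟩ := (extendZero_chi_ne_zero_iff B a).1 ha
    have hother : ∀ B' ∈ smallFundamental (block e (· ∈ L)) w, B' ≠ B →
        j ∉ B' ∧ (⟨a, haL⟩ : {i // i ∈ L}) ∉ B' := fun B' hB' hne =>
      ⟨fun h' => Finset.disjoint_left.1 (hdisj B' hB' B hB hne) h' hj,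
        fun h' => Finset.disjoint_left.1 (hdisj B' hB' B hB hne) h' haB⟩
    refine ⟨fun hbL => ?_, ⟨a, haL⟩, rfl, fun B' hB' => ?_⟩
    · obtain ⟨B', hB', hbB'⟩ := h.exists_mem ⟨b, hbL⟩
      have hne : B' ≠ B := by
        rintro rfl
        exact (extendZero_chi_ne_zero_iff B' b).2 ⟨hbL, hbB'⟩ hb
      obtain ⟨h1, h2⟩ := hother B' hB' hne
      have h3 := hab B' hB'
      rw [extendZero_of_pos _ haL, extendZero_of_pos _ hbL] at h3
      simp [chi, h1, h2, hbB'] at h3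
    · by_cases hne : B' = B
      · subst hne; exact ⟨fun _ => haB, fun _ => hj⟩
      · exact ⟨fun h' => absurd h' (hother B' hB' hne).1,
          fun h' => absurd h' (hother B' hB' hne).2⟩
  have h0 := heq B hB
  rw [hchi] at h0
  rcases zmod_two_eq (extendZero (chi B) (e j.1).1) with h1 | h1 <;>
    rcases zmod_two_eq (extendZero (chi B) (e j.1).2) with h2 | h2
  · rw [h1, h2] at h0; exact absurd h0 (by decide)
  · obtain ⟨h3, a, ha, h4⟩ := key (e j.1).2 (e j.1).1 (by rw [h2]; decide) h1
      fun B' hB' => by rw [add_right_comm]; exact heq B' hB'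
    exact ⟨a, h4, Or.inr ⟨h3, ha⟩⟩
  · obtain ⟨h3, a, ha, h4⟩ := key (e j.1).1 (e j.1).2 (by rw [h1]; decide) h2 heq
    exact ⟨a, h4, Or.inl ⟨ha, h3⟩⟩
  · rw [h1, h2] at h0; exact absurd h0 (by decide)

lemma exists_outer (h : SplitsIntoSmallFundamental (block e (· ∈ L)) w m) :
    ∃ v, Outer L e v := by
  have h1 : ∀ j : {i // i ∈ L}, ∃ b : {i // i ∉ L},
      ((e j.1).1 ∈ L ∧ (e j.1).2 = b.1) ∨ ((e j.1).1 = b.1 ∧ (e j.1).2 ∈ L) := by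
    intro j
    obtain ⟨a, -, ⟨h2, h3⟩ | ⟨h2, h3⟩⟩ := exists_inner h j
    · exact ⟨⟨_, h3⟩, Or.inl ⟨h2 ▸ a.2, rfl⟩⟩
    · exact ⟨⟨_, h2⟩, Or.inr ⟨rfl, h3 ▸ a.2⟩⟩
  choose v hv using h1
  exact ⟨v, hv⟩

/-- The left kernel of the block on `L` is spanned by its small fundamental dependencies. -/
lemma finrank_leftKer_block (h : SplitsIntoSmallFundamental (block e (· ∈ L)) w m) :
    finrank (ZMod 2) (leftKer (block e (· ∈ L))) = m := by
  choose a ha hea using exists_inner h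
  set F := smallFundamental (block e (· ∈ L)) w with hF
  -- Within `L`, column `j` has exactly the entries `j` and `a j`, cancelling if they coincide; so
  -- the left kernel consists of the vectors invariant under `a`.
  have hker : ∀ x, x ∈ leftKer (block e (· ∈ L)) ↔ ∀ j, x j = x (a j) := by
    intro x
    rw [mem_leftKer_block]
    refine forall_congr' fun j => ?_
    rcases hea j with ⟨h1, h2⟩ | ⟨h1, h2⟩
    · rw [extendZero_of_neg _ h2, h1, extendZero_of_pos _ (a j).2, add_zero]
      exact CharTwo.add_eq_zero
    · rw [extendZero_of_neg _ h1, h2, extendZero_of_pos _ (a j).2, add_zero]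
      exact CharTwo.add_eq_zero
  have hfund : ∀ B ∈ F, IsFundamental (block e (· ∈ L)) B := by
    intro B hB
    simp only [hF, smallFundamental, Finset.mem_filter] at hB
    exact hB.2.1
  have hconst : ∀ x ∈ leftKer (block e (· ∈ L)), ∀ B ∈ F, ∀ i ∈ B, ∀ i' ∈ B, x i = x i' := by
    intro x hx B hB i hi i' hi'
    -- The map `a` preserves `B`, so cutting `x` down to `B` stays in the kernel. As `B` is
    -- fundamental, the result is zero or the indicator of `B`, and `x` is constant on `B`.
    let y : {i // i ∈ L} → ZMod 2 := fun i => if i ∈ B then x i else 0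
    have hy : y ∈ leftKer (block e (· ∈ L)) := by
      rw [hker] at hx ⊢
      intro j
      simp only [y, ha j B hB, hx j]
    have h1 : y = 0 ∨ supp y = B := by
      by_cases h0 : y = 0
      · exact Or.inl h0
      · refine Or.inr ((hfund B hB).2 _ (fun k hk => ?_) (isDependency_supp hy h0))
        rw [mem_supp] at hk
        by_contra hkB
        exact hk (if_neg hkB)
    have h2 : ∀ k ∈ B, x k = y k := fun k hk => (if_pos hk).symm
    rw [h2 i hi, h2 i' hi']
    rcases h1 with h1 | h1
    · simp [h1]
    · rw [← chi_supp y, h1]; simp [chi, hi, hi']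
  let b : F → {i // i ∈ L} → ZMod 2 := fun B => chi B.1
  have hne : ∀ B : F, ∃ i, i ∈ B.1 := fun B => (hfund B.1 B.2).1.1
  choose i₀ hi₀ using hne
  have heval : ∀ (c : F → ZMod 2) (B : F) (i : {i // i ∈ L}), i ∈ B.1 →
      (∑ B', c B' • b B') i = c B := by
    intro c B i hi
    rw [Finset.sum_apply, Finset.sum_eq_single B]
    · simp [b, chi, hi]
    · intro B' _ hB'
      have : i ∉ B'.1 := fun h' => Finset.disjoint_left.1
        (h.2.1 B'.1 B'.2 B.1 B.2 fun h'' => hB' (Subtype.ext h'')) h' hi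
      simp [b, chi, this]
    · simp
  have hspan : leftKer (block e (· ∈ L)) = Submodule.span (ZMod 2) (Set.range b) := by
    apply le_antisymm
    · intro x hx
      have : x = ∑ B, x (i₀ B) • b B := by
        funext i
        obtain ⟨B, hB, hi⟩ := h.exists_mem i
        rw [heval _ ⟨B, hB⟩ i hi]
        exact hconst x hx B hB i hi _ (hi₀ ⟨B, hB⟩)
      rw [this]
      exact Submodule.sum_mem _ fun B _ =>
        Submodule.smul_mem _ _ (Submodule.subset_span ⟨B, rfl⟩)
    · rw [Submodule.span_le]
      rintro _ ⟨B, rfl⟩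
      exact (isDependency_iff.1 (hfund B.1 B.2).1).2
  have hli : LinearIndependent (ZMod 2) b := by
    rw [Fintype.linearIndependent_iff]
    intro c hc B
    rw [← heval c B _ (hi₀ B), hc]
    rfl
  rw [hspan, finrank_span_eq_card hli, Fintype.card_coe, hF]
  exact h.1

end Splits

/-- The restriction of a vector to the complement of `L`. -/
def restrictOff (L : Finset (Fin n)) : (Fin n → ZMod 2) →ₗ[ZMod 2] ({i // i ∉ L} → ZMod 2) :=
  LinearMap.funLeft (ZMod 2) (ZMod 2) Subtype.val

/-- The vectors off `L` that extend to the left kernel. -/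
lemma map_restrictOff_leftKer {L : Finset (Fin n)} {e : Fin n → Fin n × Fin n}
    (hoff : OffClosed L e) {v : {i // i ∈ L} → {i // i ∉ L}} (hv : Outer L e v) :
    (leftKer (outMatrix e)).map (restrictOff L)
      = leftKer (block e (· ∉ L)) ⊓ pullbackOrth (rightKer (block e (· ∈ L))) v := by
  have hcol : ∀ (x : {i // i ∈ L} → ZMod 2) (j : {i // i ∈ L}),
      Matrix.vecMul x (block e (· ∈ L)) j
        = x j + extendZero x (e j.1).1 + extendZero x (e j.1).2 := by
    intro x j
    have h := sum_mul_outMatrix x e j.1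
    rw [extendZero_of_pos x j.2] at h
    rw [← h, Matrix.vecMul, dotProduct]
    rfl
  have hoffeq : ∀ (w : Fin n → ZMod 2) (j : {i // i ∉ L}),
      restrictOff L w j + extendZero (restrictOff L w) (e j.1).1
        + extendZero (restrictOff L w) (e j.1).2 = w j.1 + w (e j.1).1 + w (e j.1).2 := by
    intro w j
    rcases hoff j.1 j.2 with ⟨h1, h2⟩ | ⟨h1, h2⟩
    · rw [extendZero_of_pos _ h1, extendZero_of_pos _ h2]; rfl
    · rw [← h1, extendZero_of_neg _ (not_not.2 h2), add_assoc, add_assoc, add_zero,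
        CharTwo.add_self_eq_zero]; rfl
  have hineq : ∀ (w : Fin n → ZMod 2) (j : {i // i ∈ L}),
      Matrix.vecMul (fun i : {i // i ∈ L} => w i.1) (block e (· ∈ L)) j
        + restrictOff L w (v j) = w j.1 + w (e j.1).1 + w (e j.1).2 := by
    intro w j
    rw [hcol]
    rcases hv j with ⟨h1, h2⟩ | ⟨h1, h2⟩
    · rw [extendZero_of_pos _ h1, h2, extendZero_of_neg _ (v j).2, add_zero]; rfl
    · rw [extendZero_of_pos _ h2, h1, extendZero_of_neg _ (v j).2, add_zero, add_right_comm]; rfl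
  -- The columns off `L` constrain `y` alone. Column `j` of `L` asks for a vector `x` on `L` with
  -- `(x S_L) j = y (v j)`; such an `x` exists iff `y ∘ v` is orthogonal to the right kernel.
  ext y
  rw [Submodule.mem_inf, mem_pullbackOrth, ← exists_vecMul_eq_iff, mem_leftKer_block,
    Submodule.mem_map]
  constructor
  · rintro ⟨w, hw, rfl⟩
    rw [mem_leftKer_outMatrix] at hw
    refine ⟨fun j => by rw [hoffeq]; exact hw j.1, fun i => w i.1, ?_⟩
    funext j
    exact CharTwo.add_eq_zero.1 ((hineq w j).trans (hw j.1))
  · rintro ⟨hy, x, hx⟩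
    let w : Fin n → ZMod 2 := fun i => if h : i ∈ L then x ⟨i, h⟩ else y ⟨i, h⟩
    have hwy : restrictOff L w = y := by
      funext i
      exact dif_neg i.2
    have hwx : (fun i : {i // i ∈ L} => w i.1) = x := by
      funext i
      exact dif_pos i.2
    refine ⟨w, mem_leftKer_outMatrix.2 fun j => ?_, hwy⟩
    by_cases hj : j ∈ L
    · rw [← hineq w ⟨j, hj⟩, hwy, hwx, hx]
      exact CharTwo.add_self_eq_zero _
    · rw [← hoffeq w ⟨j, hj⟩, hwy]
      exact hy ⟨j, hj⟩

end Blocks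

/-! ### The outer random rows are uniform given the rest. -/

section OuterResampling

set_option linter.unusedSectionVars false

open Module

variable {n : ℕ} {L : Finset (Fin n)} {e : Fin n → Fin n × Fin n}
  {v v' : {i // i ∈ L} → {i // i ∉ L}}

/-- Replaces the random rows off `L` in the columns of `L` by `v`. -/
def replaceOuter (L : Finset (Fin n)) (e : Fin n → Fin n × Fin n)
    (v : {i // i ∈ L} → {i // i ∉ L}) : Fin n → Fin n × Fin n := fun j =>
  if h : j ∈ L then
    if (e j).1 ∈ L then ((e j).1, (v ⟨j, h⟩).1) else ((v ⟨j, h⟩).1, (e j).2)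
  else e j

lemma replaceOuter_off {j : Fin n} (hj : j ∉ L) : replaceOuter L e v j = e j := dif_neg hj

lemma replaceOuter_fst (j : {i // i ∈ L}) (h : (e j.1).1 ∈ L) :
    replaceOuter L e v j = ((e j.1).1, (v j).1) := by
  simp [replaceOuter, j.2, h]

lemma replaceOuter_snd (j : {i // i ∈ L}) (h : (e j.1).1 ∉ L) :
    replaceOuter L e v j = ((v j).1, (e j.1).2) := by
  simp [replaceOuter, j.2, h]

lemma Outer.unique (h : Outer L e v) (h' : Outer L e v') : v = v' := by
  funext j
  apply Subtype.ext
  rcases h j with ⟨h1, h2⟩ | ⟨h1, h2⟩ <;> rcases h' j with ⟨h3, h4⟩ | ⟨h3, h4⟩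
  · rw [← h2, h4]
  · exact absurd (h3 ▸ h1) (v' j).2
  · exact absurd (h1 ▸ h3) (v j).2
  · rw [← h1, h3]

lemma Outer.replaceOuter (h : Outer L e v) (v' : {i // i ∈ L} → {i // i ∉ L}) :
    Outer L (replaceOuter L e v') v' := by
  intro j
  rcases h j with ⟨h1, h2⟩ | ⟨h1, h2⟩
  · rw [replaceOuter_fst j h1]; exact Or.inl ⟨h1, rfl⟩
  · rw [replaceOuter_snd j (h1 ▸ (v j).2)]; exact Or.inr ⟨rfl, h2⟩

lemma Outer.replaceOuter_replaceOuter (h : Outer L e v) (v' : {i // i ∈ L} → {i // i ∉ L}) :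
    _root_.replaceOuter L (_root_.replaceOuter L e v') v = e := by
  funext j
  by_cases hj : j ∈ L
  · have key : ∀ j : {i // i ∈ L},
        _root_.replaceOuter L (_root_.replaceOuter L e v') v j = e j.1 := by
      intro j
      rcases h j with ⟨h1, h2⟩ | ⟨h1, h2⟩
      · have h3 := replaceOuter_fst (v := v') j h1
        rw [replaceOuter_fst j (by rw [h3]; exact h1), h3, ← h2]
      · have h3 := replaceOuter_snd (v := v') j (by rw [h1]; exact (v j).2)
        rw [replaceOuter_snd j (by rw [h3]; exact (v' j).2), h3, ← h1]
    exact key ⟨j, hj⟩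
  · rw [replaceOuter_off hj, replaceOuter_off hj]

/-- Also without replacement any row off `L` is admissible as the outer row, because the column
index and the other random row are both in `L`. -/
lemma Outer.replaceOuter_mem {s : Sampling} (h : Outer L e v) (he : e ∈ configs (Fin n) s)
    (v' : {i // i ∈ L} → {i // i ∉ L}) : _root_.replaceOuter L e v' ∈ configs (Fin n) s := by
  rw [configs, Fintype.mem_piFinset] at he ⊢
  intro j
  by_cases hj : j ∈ L
  · have key : ∀ j : {i // i ∈ L}, _root_.replaceOuter L e v' j ∈ pairs s j.1 := by
      intro j
      have hej := he j.1
      cases s with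
      | withReplacement => simp [pairs]
      | withoutReplacement =>
        simp only [pairs, Finset.mem_filter, Finset.mem_univ, true_and] at hej ⊢
        have hvj : (v' j).1 ≠ j.1 := fun h' => (v' j).2 (h' ▸ j.2)
        rcases h j with ⟨h1, h2⟩ | ⟨h1, h2⟩
        · rw [replaceOuter_fst j h1]
          exact ⟨hej.1, hvj, fun (h' : (e j.1).1 = (v' j).1) => (v' j).2 (h' ▸ h1)⟩
        · rw [replaceOuter_snd j (by rw [h1]; exact (v j).2)]
          exact ⟨hvj, hej.2.1, fun (h' : (v' j).1 = (e j.1).2) => (v' j).2 (h' ▸ h2)⟩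
    exact key ⟨j, hj⟩
  · rw [replaceOuter_off hj]; exact he j

lemma Outer.block_replaceOuter (h : Outer L e v) (v' : {i // i ∈ L} → {i // i ∉ L}) :
    block (_root_.replaceOuter L e v') (· ∈ L) = block e (· ∈ L) := by
  ext i j
  have hi : ∀ u : {i // i ∈ L} → {i // i ∉ L}, i.1 ≠ (u j).1 := fun u h' => (u j).2 (h' ▸ i.2)
  simp only [Matrix.submatrix_apply, outMatrix]
  rcases h j with ⟨h1, h2⟩ | ⟨h1, h2⟩
  · rw [replaceOuter_fst j h1, h2, if_neg (hi v), if_neg (hi v')]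
  · rw [replaceOuter_snd j (by rw [h1]; exact (v j).2), h1, if_neg (hi v), if_neg (hi v')]

lemma block_off_congr {e e' : Fin n → Fin n × Fin n} (h : ∀ j ∉ L, e j = e' j) :
    block e (· ∉ L) = block e' (· ∉ L) := by
  ext i j
  simp only [Matrix.submatrix_apply, outMatrix]
  rw [h j.1 j.2]

lemma block_congr {e e' : Fin n → Fin n × Fin n} (h : ∀ j ∈ L, e j = e' j) :
    block e (· ∈ L) = block e' (· ∈ L) := by
  ext i j
  simp only [Matrix.submatrix_apply, outMatrix]
  rw [h j.1 j.2]

open Classical in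
/-- On a set of choices that is invariant under the replacement of the outer random rows, these are
uniformly distributed. -/
lemma sum_card_replaceOuter (E : Finset (Fin n → Fin n × Fin n))
    (hout : ∀ e ∈ E, ∃ v, Outer L e v) (hE : ∀ e ∈ E, ∀ v, replaceOuter L e v ∈ E)
    (F : (Fin n → Fin n × Fin n) → Prop) :
    ∑ e ∈ E, ((Finset.univ.filter fun v => F (replaceOuter L e v)).card : ℝ)
      = Fintype.card ({i // i ∈ L} → {i // i ∉ L}) * (E.filter F).card := by
  choose out hout using hout
  have h1 : ∑ e ∈ E, ∑ v : {i // i ∈ L} → {i // i ∉ L},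
        (if F (replaceOuter L e v) then (1 : ℝ) else 0)
      = ∑ e ∈ E, ∑ _v : {i // i ∈ L} → {i // i ∉ L}, (if F e then (1 : ℝ) else 0) := by
    rw [← Finset.sum_product', ← Finset.sum_product']
    -- Exchanging the outer rows of `e` with `v` is an involution on pairs.
    refine Finset.sum_bij'
      (fun q hq => (replaceOuter L q.1 q.2, out q.1 (Finset.mem_product.1 hq).1))
      (fun q hq => (replaceOuter L q.1 q.2, out q.1 (Finset.mem_product.1 hq).1)) ?_ ?_ ?_ ?_ ?_
    · intro q hq
      exact Finset.mem_product.2 ⟨hE _ (Finset.mem_product.1 hq).1 _, Finset.mem_univ _⟩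
    · intro q hq
      exact Finset.mem_product.2 ⟨hE _ (Finset.mem_product.1 hq).1 _, Finset.mem_univ _⟩
    · intro q hq
      exact Prod.ext ((hout _ _).replaceOuter_replaceOuter _)
        ((hout _ _).unique ((hout q.1 (Finset.mem_product.1 hq).1).replaceOuter _))
    · intro q hq
      exact Prod.ext ((hout _ _).replaceOuter_replaceOuter _)
        ((hout _ _).unique ((hout q.1 (Finset.mem_product.1 hq).1).replaceOuter _))
    · intro q hq; rfl
  simp only [Finset.sum_const, nsmul_eq_mul, Finset.card_univ, ← Finset.mul_sum] at h1
  simp only [Finset.card_filter]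
  push_cast
  exact h1

end OuterResampling

/-! ### The conditional count when all dependencies off `L` are near half. -/

section ConditionalCount

open Module

variable {n : ℕ} {L : Finset (Fin n)}

/-- The part of the block hypothesis on the columns off `L`. -/
def OffHypothesis (L : Finset (Fin n)) (w k : ℕ) (e : Fin n → Fin n × Fin n) : Prop :=
  OffClosed L e ∧ (∀ S, IsDependency (block e (· ∉ L)) S → w < S.card) ∧
    HasMaxSimple (block e (· ∉ L)) k

lemma blockHypothesis_iff {w m k : ℕ} {e : Fin n → Fin n × Fin n} :
    BlockHypothesis (outMatrix e) L w m k ↔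
      SplitsIntoSmallFundamental (block e (· ∈ L)) w m ∧ OffHypothesis L w k e := by
  rw [BlockHypothesis, ← offClosed_iff, OffHypothesis]
  tauto

lemma offHypothesis_congr {w k : ℕ} {e e' : Fin n → Fin n × Fin n} (h : ∀ j ∉ L, e j = e' j) :
    OffHypothesis L w k e ↔ OffHypothesis L w k e' := by
  rw [OffHypothesis, OffHypothesis, block_off_congr h]
  refine and_congr_left fun _ => forall₂_congr fun j hj => ?_
  rw [h j hj]

/-- All nonzero left kernel vectors of the block off `L` have about half of the rows. -/
def OffCore (L : Finset (Fin n)) (e : Fin n → Fin n × Fin n) : Prop :=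
  ∀ y ∈ leftKer (block e (· ∉ L)), y ≠ 0 → IsCore (Fintype.card {i // i ∉ L}) (supp y).card

lemma offCore_congr {e e' : Fin n → Fin n × Fin n} (h : ∀ j ∉ L, e j = e' j) :
    OffCore L e ↔ OffCore L e' := by
  rw [OffCore, OffCore, block_off_congr h]

lemma IsCore.isLargeSize {N c : ℕ} (h : IsCore N c) : IsLargeSize N c := by
  refine h.trans ?_
  have := Real.sqrt_nonneg ((N : ℝ) * Real.log (N : ℝ))
  linarith

lemma card_supp_restrictOff_le (w : Fin n → ZMod 2) :
    (supp (restrictOff L w)).card ≤ (supp w).card := by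
  refine Finset.card_le_card_of_injOn Subtype.val (fun i hi => ?_) Subtype.val_injective.injOn
  rw [Finset.mem_coe, mem_supp] at hi ⊢
  exact hi

lemma card_supp_le_restrictOff (w : Fin n → ZMod 2) :
    (supp w).card ≤ (supp (restrictOff L w)).card + L.card := by
  have h : supp w ⊆ (supp (restrictOff L w)).map (Function.Embedding.subtype _) ∪ L := by
    intro i hi
    rw [Finset.mem_union]
    by_cases hL : i ∈ L
    · exact Or.inr hL
    · left
      rw [Finset.mem_map]
      refine ⟨⟨i, hL⟩, ?_, rfl⟩
      rw [mem_supp] at hi ⊢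
      exact hi
  refine (Finset.card_le_card h).trans ((Finset.card_union_le _ _).trans ?_)
  rw [Finset.card_map]

/-- All nonzero kernel vectors are large, so `hasMaxSimple_iff` applies with the identity map. -/
lemma finrank_leftKer_of_offCore {k : ℕ} {e : Fin n → Fin n × Fin n} (hcore : OffCore L e)
    (hzero : ¬ IsLargeSize (Fintype.card {i // i ∉ L}) 0)
    : HasMaxSimple (block e (· ∉ L)) k ↔ finrank (ZMod 2) (leftKer (block e (· ∉ L))) = k := by
  rw [hasMaxSimple_iff LinearMap.id, Submodule.map_id]
  intro w hw
  rw [LinearMap.id_apply]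
  constructor
  · rintro h rfl
    rw [supp_eq_empty.2 rfl, Finset.card_empty] at h
    exact hzero h
  · intro h0
    exact (hcore w hw h0).isLargeSize

/-- Here `hasMaxSimple_iff` is applied with the restriction off `L`. A kernel vector supported in
`L` is too small to be large, and any other one differs from its restriction, which is near half, by
at most |L| in size. -/
lemma hasMaxSimple_outMatrix_iff {h : ℕ} {e : Fin n → Fin n × Fin n} (hoff : OffClosed L e)
    {v : {i // i ∈ L} → {i // i ∉ L}} (hv : Outer L e v) (hcore : OffCore L e)
    (hlarge : ∀ c, IsCore (Fintype.card {i // i ∉ L}) c → ∀ c', c ≤ c' → c' ≤ c + L.card →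
      IsLargeSize n c') (hsmall : ∀ c ≤ L.card, ¬ IsLargeSize n c) :
    HasMaxSimple (outMatrix e) h ↔ finrank (ZMod 2) ↥(leftKer (block e (· ∉ L)) ⊓
      pullbackOrth (rightKer (block e (· ∈ L))) v) = h := by
  have hmap := map_restrictOff_leftKer hoff hv
  rw [hasMaxSimple_iff (restrictOff L), hmap]
  intro w hw
  rw [Fintype.card_fin]
  have h1 := card_supp_restrictOff_le (L := L) w
  have h2 := card_supp_le_restrictOff (L := L) w
  constructor
  · intro hl h0
    rw [h0, supp_eq_empty.2 rfl, Finset.card_empty, zero_add] at h2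
    exact hsmall _ h2 hl
  · intro h0
    have h3 : restrictOff L w ∈ leftKer (block e (· ∉ L)) := by
      have : restrictOff L w ∈ (leftKer (outMatrix e)).map (restrictOff L) := ⟨w, hw, rfl⟩
      rw [hmap] at this
      exact this.1
    exact hlarge _ (hcore _ h3 h0) _ h1 h2

open Classical in
/-- The conditional probability, on the event that all dependencies off `L` are large. -/
lemma card_hasMaxSimple_sub_le (s : Sampling) {h r m w : ℕ} (hr : r ≤ m) {δ : ℝ} (hδ : 0 ≤ δ)
    (hzero : ¬ IsLargeSize (Fintype.card {i // i ∉ L}) 0)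
    (hlarge : ∀ c, IsCore (Fintype.card {i // i ∉ L}) c → ∀ c', c ≤ c' → c' ≤ c + L.card →
      IsLargeSize n c') (hsmall : ∀ c ≤ L.card, ¬ IsLargeSize n c)
    (hcard : 0 < Fintype.card {i // i ∉ L})
    (hcore : ∀ c, IsCore (Fintype.card {i // i ∉ L}) c →
      |(Fintype.card {i // i ∉ L} : ℝ) - 2 * c| ≤ δ * Fintype.card {i // i ∉ L})
    (E : Finset (Fin n → Fin n × Fin n)) (hE : E = (configs (Fin n) s).filter fun e =>
      BlockHypothesis (outMatrix e) L w m (h + r) ∧ OffCore L e) :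
    |((E.filter fun e => HasMaxSimple (outMatrix e) h).card : ℝ) - E.card * pStar h r m|
      ≤ 2 ^ (m * (h + r)) * δ * E.card := by
  have hmem : ∀ e, e ∈ E ↔ e ∈ configs (Fin n) s ∧
      (SplitsIntoSmallFundamental (block e (· ∈ L)) w m ∧ OffHypothesis L w (h + r) e) ∧
      OffCore L e := by
    intro e
    rw [hE, Finset.mem_filter, blockHypothesis_iff]
  have hout : ∀ e ∈ E, ∃ v, Outer L e v := fun e he => exists_outer ((hmem e).1 he).2.1.1
  have hclosed : ∀ e ∈ E, ∀ v, replaceOuter L e v ∈ E := by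
    intro e he v
    obtain ⟨v₀, hv₀⟩ := hout e he
    rw [hmem] at he ⊢
    obtain ⟨h1, ⟨h2, h3⟩, h4⟩ := he
    have hagree : ∀ j ∉ L, replaceOuter L e v j = e j := fun j hj => replaceOuter_off hj
    refine ⟨hv₀.replaceOuter_mem h1 v, ⟨?_, (offHypothesis_congr hagree).2 h3⟩,
      (offCore_congr hagree).2 h4⟩
    rw [hv₀.block_replaceOuter]
    exact h2
  have hpos : (0 : ℝ) < Fintype.card ({i // i ∈ L} → {i // i ∉ L}) := by
    rw [Fintype.card_fun]; positivity
  set V : ℝ := (Fintype.card ({i // i ∈ L} → {i // i ∉ L}) : ℝ) with hV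
  have hsum := sum_card_replaceOuter E hout hclosed fun e => HasMaxSimple (outMatrix e) h
  -- For fixed `e`, replacing the outer rows changes neither block, so the spaces `K` and `R` stay
  -- fixed while `v` is uniform.
  have hterm : ∀ e ∈ E, |((Finset.univ.filter fun v =>
      HasMaxSimple (outMatrix (replaceOuter L e v)) h).card : ℝ) - V * pStar h r m|
      ≤ 2 ^ (m * (h + r)) * δ * V := by
    intro e he
    obtain ⟨v₀, hv₀⟩ := hout e he
    have he' := (hmem e).1 he
    have hR : finrank (ZMod 2) (rightKer (block e (· ∈ L))) = m := by
      rw [finrank_rightKer]; exact finrank_leftKer_block he'.2.1.1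
    have hK := (finrank_leftKer_of_offCore he'.2.2 hzero).1 he'.2.1.2.2.2
    have key := card_finrank_pullbackOrth_sub_le hr hK hR hδ fun y hy hy0 => by
      rw [sum_sgn_apply]; exact hcore _ (he'.2.2 y hy hy0)
    rw [hV, Fintype.card_fun]
    push_cast
    refine le_of_eq_of_le ?_ key
    congr 4
    ext v
    simp only [Finset.mem_filter, Finset.mem_univ, true_and]
    have hev := (hmem _).1 (hclosed e he v)
    have hagree : ∀ j ∉ L, replaceOuter L e v j = e j := fun j hj => replaceOuter_off hj
    rw [hasMaxSimple_outMatrix_iff hev.2.1.2.1 (hv₀.replaceOuter v) hev.2.2 hlarge hsmall,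
      hv₀.block_replaceOuter, block_off_congr hagree]
  have hfin : V * |((E.filter fun e => HasMaxSimple (outMatrix e) h).card : ℝ)
      - E.card * pStar h r m| ≤ V * (2 ^ (m * (h + r)) * δ * E.card) := by
    rw [← abs_of_pos hpos, ← abs_mul, abs_of_pos hpos, mul_sub, ← hsum]
    have : V * (E.card * pStar h r m) = ∑ _e ∈ E, V * pStar h r m := by
      rw [Finset.sum_const, nsmul_eq_mul]; ring
    rw [this, ← Finset.sum_sub_distrib]
    refine (Finset.abs_sum_le_sum_abs _ _).trans ((Finset.sum_le_card_nsmul _ _ _ hterm).trans ?_)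
    rw [nsmul_eq_mul]
    exact le_of_eq (by ring)
  exact le_of_mul_le_mul_left hfin hpos

end ConditionalCount

/-! ### Comparison of the columns off `L` with the smaller model. -/

section OffColumns

set_option linter.unusedSectionVars false

open Module

variable {n : ℕ} {L : Finset (Fin n)}

lemma pr_and_add_pr_and_not {ι : Type} [Fintype ι] [DecidableEq ι] (s : Sampling)
    (P Q : (ι → ι × ι) → Prop) :
    pr s (fun e => P e ∧ Q e) + pr s (fun e => P e ∧ ¬ Q e) = pr s P := by
  classical
  rw [pr_def, pr_def, pr_def, ← add_div]
  congr 1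
  have h := Finset.card_filter_add_card_filter_not (s := (configs ι s).filter P) Q
  rw [Finset.filter_filter, Finset.filter_filter] at h
  exact_mod_cast h

/-- The rows of `e` in the columns off `L` are those of `e'`. -/
def Restricts (L : Finset (Fin n)) (e : Fin n → Fin n × Fin n)
    (e' : {i // i ∉ L} → {i // i ∉ L} × {i // i ∉ L}) : Prop :=
  ∀ j : {i // i ∉ L}, e j.1 = ((e' j).1.1, (e' j).2.1)

lemma mem_pairs_val_iff {s : Sampling} (j : {i // i ∉ L}) (p : {i // i ∉ L} × {i // i ∉ L}) :
    (p.1.1, p.2.1) ∈ pairs s j.1 ↔ p ∈ pairs s j := by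
  cases s <;> simp [pairs, Subtype.ext_iff]

lemma leftKer_block_of_restricts {e : Fin n → Fin n × Fin n}
    {e' : {i // i ∉ L} → {i // i ∉ L} × {i // i ∉ L}} (h : Restricts L e e') :
    leftKer (block e (· ∉ L)) = leftKerOff e' ∅ := by
  ext y
  rw [mem_leftKer_block, mem_leftKerOff]
  simp only [Finset.compl_empty, Finset.mem_univ, true_imp_iff]
  refine forall_congr' fun j => ?_
  rw [h j, extendZero_of_pos _ (e' j).1.2, extendZero_of_pos _ (e' j).2.2]
  rfl

lemma pr_forall_off_le (s : Sampling) (hn : 3 ≤ n) (R : Fin n → Fin n × Fin n → Prop) {q : ℝ}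
    (hq : ∀ j ∉ L, colPr s j (R j) ≤ q) :
    pr s (fun e => ∀ j ∉ L, R j (e j)) ≤ q ^ Fintype.card {i // i ∉ L} := by
  have h := pr_forall_mem (s := s) (by rwa [Fintype.card_fin]) Lᶜ R
  simp only [Finset.mem_compl] at h
  rw [h, Fintype.card_subtype]
  have h2 : Finset.univ.filter (fun i => i ∉ L) = Lᶜ := by ext; simp
  rw [h2, ← Finset.prod_const]
  exact Finset.prod_le_prod (fun _ _ => colPr_nonneg) fun j hj => hq j (Finset.mem_compl.1 hj)

lemma pr_restricts (s : Sampling) (hn : 3 ≤ n) {e' : {i // i ∉ L} → {i // i ∉ L} × {i // i ∉ L}}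
    (he' : e' ∈ configs {i // i ∉ L} s) :
    pr s (fun e => Restricts L e e') = (1 / totalPairs s n : ℝ) ^ Fintype.card {i // i ∉ L} := by
  classical
  let R : Fin n → Fin n × Fin n → Prop := fun j p =>
    ∀ h : j ∉ L, p = ((e' ⟨j, h⟩).1.1, (e' ⟨j, h⟩).2.1)
  have h1 : ∀ e, Restricts L e e' ↔ ∀ j ∈ Lᶜ, R j (e j) := by
    intro e
    simp only [Restricts, R, Subtype.forall, Finset.mem_compl]
    exact ⟨fun h j _ hj => h j hj, fun h j hj => h j hj hj⟩
  simp only [h1]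
  rw [pr_forall_mem (by rwa [Fintype.card_fin]) Lᶜ R, Fintype.card_subtype]
  have h2 : Finset.univ.filter (fun i => i ∉ L) = Lᶜ := by ext; simp
  rw [h2, ← Finset.prod_const]
  refine Finset.prod_congr rfl fun j hj => ?_
  rw [Finset.mem_compl] at hj
  rw [colPr_def, card_pairs, Fintype.card_fin]
  congr 1
  rw [Nat.cast_eq_one, Finset.card_eq_one]
  refine ⟨((e' ⟨j, hj⟩).1.1, (e' ⟨j, hj⟩).2.1), ?_⟩
  ext p
  simp only [Finset.mem_filter, Finset.mem_singleton, R]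
  constructor
  · exact fun h => h.2 hj
  · rintro rfl
    refine ⟨(mem_pairs_val_iff ⟨j, hj⟩ _).2 (Fintype.mem_piFinset.1 he' ⟨j, hj⟩), fun _ => rfl⟩

/-- The columns off `L` are those of a uniformly distributed choice, if their random rows are off
`L`. -/
lemma pr_exists_restricts (s : Sampling) (hn : 3 ≤ n) (hN : 3 ≤ Fintype.card {i // i ∉ L})
    (P : ({i // i ∉ L} → {i // i ∉ L} × {i // i ∉ L}) → Prop) :
    pr s (fun e => ∃ e' ∈ configs {i // i ∉ L} s, Restricts L e e' ∧ P e')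
      = (totalPairs s (Fintype.card {i // i ∉ L}) / totalPairs s n : ℝ)
        ^ Fintype.card {i // i ∉ L} * pr s P := by
  classical
  have h1 := sum_pr_eq (s := s) ((configs {i // i ∉ L} s).filter P) fun e' e => Restricts L e e'
  have h2 : ∀ e : Fin n → Fin n × Fin n,
      (((configs {i // i ∉ L} s).filter P).filter fun e' => Restricts L e e').card
      = if ∃ e' ∈ configs {i // i ∉ L} s, Restricts L e e' ∧ P e' then 1 else 0 := by
    intro e
    split_ifs with h
    · obtain ⟨e', he', hr, hP⟩ := h
      rw [Finset.card_eq_one]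
      refine ⟨e', ?_⟩
      ext e''
      simp only [Finset.mem_filter, Finset.mem_singleton]
      constructor
      · rintro ⟨-, hr'⟩
        funext j
        have h3 := (hr j).symm.trans (hr' j)
        rw [Prod.mk.injEq] at h3
        exact Prod.ext (Subtype.ext h3.1.symm) (Subtype.ext h3.2.symm)
      · rintro rfl
        exact ⟨⟨he', hP⟩, hr⟩
    · rw [Finset.card_eq_zero, Finset.filter_eq_empty_iff]
      intro e' he' hr
      rw [Finset.mem_filter] at he'
      exact h ⟨e', he'.1, hr, he'.2⟩
  simp only [h2] at h1
  rw [pr_def, Finset.card_filter]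
  push_cast at h1 ⊢
  rw [← h1, Finset.sum_congr rfl fun e' he' => pr_restricts s hn (Finset.mem_filter.1 he').1,
    Finset.sum_const, nsmul_eq_mul, pr_def, card_configs]
  have h3 : (0 : ℝ) < totalPairs s (Fintype.card {i // i ∉ L}) := by
    exact_mod_cast totalPairs_pos s hN
  have h4 : (0 : ℝ) < totalPairs s n := by exact_mod_cast totalPairs_pos s hn
  push_cast
  rw [div_pow, div_pow, one_pow]
  field_simp

/-- The extra |L| counts the cancelling pairs (i, i) with i in L. -/
lemma colPr_offClosed_le (s : Sampling) {j : Fin n} (hj : j ∉ L) :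
    colPr s j (fun p => (p.1 ∉ L ∧ p.2 ∉ L) ∨ (p.1 = p.2 ∧ p.1 ∈ L))
      ≤ (totalPairs s (Fintype.card {i // i ∉ L}) + L.card) / totalPairs s n := by
  classical
  rw [colPr_def, card_pairs, Fintype.card_fin]
  gcongr
  rw [← card_pairs s (⟨j, hj⟩ : {i // i ∉ L})]
  have h : (pairs s j).filter (fun p => (p.1 ∉ L ∧ p.2 ∉ L) ∨ (p.1 = p.2 ∧ p.1 ∈ L))
      ⊆ (pairs s (⟨j, hj⟩ : {i // i ∉ L})).image (fun p => (p.1.1, p.2.1))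
        ∪ L.image fun i => (i, i) := by
    rintro ⟨a, b⟩ hp
    rw [Finset.mem_filter] at hp
    rw [Finset.mem_union, Finset.mem_image, Finset.mem_image]
    rcases hp.2 with ⟨h1, h2⟩ | ⟨h1, h2⟩
    · exact Or.inl ⟨(⟨a, h1⟩, ⟨b, h2⟩), (mem_pairs_val_iff ⟨j, hj⟩ _).1 hp.1, rfl⟩
    · exact Or.inr ⟨a, h2, Prod.ext rfl h1⟩
  have h2 := (Finset.card_le_card h).trans ((Finset.card_union_le _ _).trans
    (add_le_add Finset.card_image_le Finset.card_image_le))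
  exact_mod_cast h2

lemma OffClosed.of_restricts {e : Fin n → Fin n × Fin n}
    {e' : {i // i ∉ L} → {i // i ∉ L} × {i // i ∉ L}} (h : Restricts L e e') : OffClosed L e := by
  intro j hj
  have := h ⟨j, hj⟩
  left
  simp only at this
  rw [this]
  exact ⟨(e' ⟨j, hj⟩).1.2, (e' ⟨j, hj⟩).2.2⟩

/-- It is unlikely that a column off `L` has two coinciding random rows in `L`. -/
lemma pr_offClosed_not_restricts_le (s : Sampling) (hn : 3 ≤ n)
    (hN : 3 ≤ Fintype.card {i // i ∉ L}) :
    pr s (fun e => OffClosed L e ∧ ¬ ∃ e' ∈ configs {i // i ∉ L} s, Restricts L e e' ∧ True)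
      ≤ (totalPairs s (Fintype.card {i // i ∉ L}) / totalPairs s n : ℝ)
        ^ Fintype.card {i // i ∉ L} * (Real.exp (Fintype.card {i // i ∉ L}
          * (L.card / totalPairs s (Fintype.card {i // i ∉ L}))) - 1) := by
  -- The probability of proper columns is known exactly, and that of all closed ones exceeds it at
  -- most by the factor `(1 + |L| / T) ^ N`; the difference bounds the cancelling case.
  have h1 := pr_and_add_pr_and_not s (OffClosed L)
    fun e => ∃ e' ∈ configs {i // i ∉ L} s, Restricts L e e' ∧ True
  have h2 : pr s (fun e => OffClosed L e ∧
      ∃ e' ∈ configs {i // i ∉ L} s, Restricts L e e' ∧ True)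
      = pr s (fun e => ∃ e' ∈ configs {i // i ∉ L} s, Restricts L e e' ∧ True) :=
    pr_congr fun e _ => ⟨fun h => h.2, fun h => ⟨by
      obtain ⟨e', -, h, -⟩ := h; exact .of_restricts h, h⟩⟩
  rw [h2, pr_exists_restricts s hn hN, pr_true hN, mul_one] at h1
  have h3 : pr s (OffClosed L) ≤ _ := pr_forall_off_le s hn
    (fun _ p => (p.1 ∉ L ∧ p.2 ∉ L) ∨ (p.1 = p.2 ∧ p.1 ∈ L)) fun j hj => colPr_offClosed_le s hj
  have h4 : (0 : ℝ) < totalPairs s (Fintype.card {i // i ∉ L}) := by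
    exact_mod_cast totalPairs_pos s hN
  have h5 : (0 : ℝ) < totalPairs s n := by exact_mod_cast totalPairs_pos s hn
  have h6 : ((totalPairs s (Fintype.card {i // i ∉ L}) + L.card) / totalPairs s n : ℝ)
      = totalPairs s (Fintype.card {i // i ∉ L}) / totalPairs s n
        * (1 + L.card / totalPairs s (Fintype.card {i // i ∉ L})) := by
    field_simp
  rw [h6, mul_pow] at h3
  have h7 : (1 + L.card / totalPairs s (Fintype.card {i // i ∉ L}) : ℝ)
      ^ Fintype.card {i // i ∉ L} ≤ Real.exp (Fintype.card {i // i ∉ L}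
          * (L.card / totalPairs s (Fintype.card {i // i ∉ L}))) := by
    rw [Real.exp_nat_mul]
    gcongr
    rw [add_comm]
    exact Real.add_one_le_exp _
  have h8 : (0 : ℝ) ≤ (totalPairs s (Fintype.card {i // i ∉ L}) / totalPairs s n : ℝ)
        ^ Fintype.card {i // i ∉ L} := by positivity
  have h9 := mul_le_mul_of_nonneg_left h7 h8
  rw [mul_sub, mul_one]
  linarith

/-- This turns the lower bound for `Good` into one for the conditioning event. -/
lemma offHypothesis_of_restricts {w k : ℕ} {e : Fin n → Fin n × Fin n}
    {e' : {i // i ∉ L} → {i // i ∉ L} × {i // i ∉ L}} (h : Restricts L e e') (hg : Good k e')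
    (hzero : ¬ IsLargeSize (Fintype.card {i // i ∉ L}) 0)
    (hw : ∀ c, IsCore (Fintype.card {i // i ∉ L}) c → w < c) : OffHypothesis L w k e := by
  have hker := leftKer_block_of_restricts h
  have hcore : OffCore L e := by
    intro y hy; rw [hker] at hy; exact hg.2 y hy
  refine ⟨.of_restricts h, fun S hS => ?_, ?_⟩
  · rw [isDependency_iff] at hS
    have h1 := hcore _ hS.2 fun h0 => by
      rw [← supp_eq_empty, supp_chi] at h0
      exact hS.1.ne_empty h0
    rw [supp_chi] at h1
    exact hw _ h1
  · rw [finrank_leftKer_of_offCore hcore hzero, hker]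
    exact hg.1

/-- Given that the columns off `L` satisfy the block hypothesis, all their dependencies are likely
to be large. -/
lemma pr_offHypothesis_not_offCore_le (s : Sampling) {w k w₀ : ℕ} {c ε η : ℝ} (hn : 3 ≤ n)
    (hN : 3 ≤ Fintype.card {i // i ∉ L}) (hc : 0 < c)
    (hgood : c ≤ pr s (Good (ι := {i // i ∉ L}) k))
    (hint : pr s (fun e : {i // i ∉ L} → {i // i ∉ L} × {i // i ∉ L} =>
      ∃ v ∈ leftKerOff e ∅, w₀ < (supp v).card ∧
        ¬ IsCore (Fintype.card {i // i ∉ L}) (supp v).card) ≤ ε)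
    (hexp : Real.exp (Fintype.card {i // i ∉ L}
          * (L.card / totalPairs s (Fintype.card {i // i ∉ L}))) - 1 ≤ η)
    (hzero : ¬ IsLargeSize (Fintype.card {i // i ∉ L}) 0)
    (hw : ∀ c, IsCore (Fintype.card {i // i ∉ L}) c → w < c) (hw₀ : w₀ ≤ w) :
    pr s (fun e => OffHypothesis L w k e ∧ ¬ OffCore L e)
      ≤ (η + ε) / c * pr s (OffHypothesis L w k) := by
  -- The probability that all random rows of the columns off `L` are off `L`. It may be tiny, but it
  -- is a common factor of both sides and cancels.
  set α : ℝ := (totalPairs s (Fintype.card {i // i ∉ L}) / totalPairs s n : ℝ)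
        ^ Fintype.card {i // i ∉ L} with hα
  have hα0 : 0 ≤ α := by positivity
  have hlow : α * c ≤ pr s (OffHypothesis L w k) := by
    refine (mul_le_mul_of_nonneg_left hgood hα0).trans ?_
    rw [hα, ← pr_exists_restricts s hn hN]
    refine pr_mono fun e _ => ?_
    rintro ⟨e', -, h, hg⟩
    exact offHypothesis_of_restricts h hg hzero hw
  have hup : pr s (fun e => OffHypothesis L w k e ∧ ¬ OffCore L e) ≤ α * η + α * ε := by
    refine (pr_mono (Q := fun e => (OffClosed L e ∧ ¬ ∃ e' ∈ configs {i // i ∉ L} s,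
      Restricts L e e' ∧ True) ∨ ∃ e' ∈ configs {i // i ∉ L} s, Restricts L e e' ∧
        ∃ v ∈ leftKerOff e' ∅, w₀ < (supp v).card ∧
          ¬ IsCore (Fintype.card {i // i ∉ L}) (supp v).card) ?_).trans
      (pr_or_le.trans (add_le_add ?_ ?_))
    · rintro e - ⟨h1, h2⟩
      by_cases h3 : ∃ e' ∈ configs {i // i ∉ L} s, Restricts L e e' ∧ True
      · right
        obtain ⟨e', he', hr, -⟩ := h3
        refine ⟨e', he', hr, ?_⟩
        rw [OffCore] at h2
        push Not at h2
        obtain ⟨y, hy, hy0, hyc⟩ := h2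
        -- The event itself excludes sizes up to `w ≥ w₀`, so a vector outside the core falls in the
        -- range ruled out by the first moment.
        refine ⟨y, leftKer_block_of_restricts hr ▸ hy, hw₀.trans_lt ?_, hyc⟩
        exact h1.2.1 _ (isDependency_supp hy hy0)
      · exact Or.inl ⟨h1.1, h3⟩
    · exact (pr_offClosed_not_restricts_le s hn hN).trans (mul_le_mul_of_nonneg_left hexp hα0)
    · rw [pr_exists_restricts s hn hN]
      exact mul_le_mul_of_nonneg_left hint hα0
  have hηε : 0 ≤ η + ε := by
    have h1 : (0 : ℝ) ≤ Fintype.card {i // i ∉ L}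
          * (L.card / totalPairs s (Fintype.card {i // i ∉ L})) := by positivity
    have h2 := Real.one_le_exp h1
    have h3 := pr_nonneg.trans hint
    linarith
  calc _ ≤ α * η + α * ε := hup
    _ = (η + ε) / c * (α * c) := by field_simp
    _ ≤ _ := mul_le_mul_of_nonneg_left hlow (by positivity)

open Classical in
/-- The conditional count, from the estimates for the columns off `L`. -/
lemma card_blockHypothesis_sub_le (s : Sampling) {h r m w : ℕ} (hr : r ≤ m) {δ θ : ℝ} (hδ : 0 ≤ δ)
    (hn : 3 ≤ n)
    (hzero : ¬ IsLargeSize (Fintype.card {i // i ∉ L}) 0)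
    (hlarge : ∀ c, IsCore (Fintype.card {i // i ∉ L}) c → ∀ c', c ≤ c' → c' ≤ c + L.card →
      IsLargeSize n c') (hsmall : ∀ c ≤ L.card, ¬ IsLargeSize n c)
    (hcard : 0 < Fintype.card {i // i ∉ L})
    (hcore : ∀ c, IsCore (Fintype.card {i // i ∉ L}) c →
      |(Fintype.card {i // i ∉ L} : ℝ) - 2 * c| ≤ δ * Fintype.card {i // i ∉ L})
    (hoff : pr s (fun e => OffHypothesis L w (h + r) e ∧ ¬ OffCore L e)
      ≤ θ * pr s (OffHypothesis L w (h + r)))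
    (E : Finset (Fin n → Fin n × Fin n)) (hE : E = (configs (Fin n) s).filter fun e =>
      BlockHypothesis (outMatrix e) L w m (h + r)) :
    |((E.filter fun e => HasMaxSimple (outMatrix e) h).card : ℝ) - E.card * pStar h r m|
      ≤ (2 ^ (m * (h + r)) * δ + (1 + pStar h r m) * θ) * E.card := by
  have hn' : 3 ≤ Fintype.card (Fin n) := by rwa [Fintype.card_fin]
  have hpos : (0 : ℝ) < (configs (Fin n) s).card := by exact_mod_cast configs_card_pos s hn'
  have hprE : (E.card : ℝ) = pr s (fun e => BlockHypothesis (outMatrix e) L w m (h + r))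
      * (configs (Fin n) s).card := by
    rw [pr_def, hE, div_mul_cancel₀ _ hpos.ne']
  have hprEB : ((E.filter fun e => ¬ OffCore L e).card : ℝ)
      = pr s (fun e => BlockHypothesis (outMatrix e) L w m (h + r) ∧ ¬ OffCore L e)
      * (configs (Fin n) s).card := by
    rw [pr_def, hE, Finset.filter_filter, div_mul_cancel₀ _ hpos.ne']
  -- The condition on the block of `L` depends only on the columns of `L`, so by independence it is
  -- a common factor on both sides.
  have hbad : ((E.filter fun e => ¬ OffCore L e).card : ℝ) ≤ θ * E.card := by
    rw [hprE, hprEB, ← mul_assoc]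
    gcongr
    simp only [blockHypothesis_iff, and_assoc]
    have hin : ∀ e e' : Fin n → Fin n × Fin n, (∀ j ∈ L, e j = e' j) →
        (SplitsIntoSmallFundamental (block e (· ∈ L)) w m ↔
          SplitsIntoSmallFundamental (block e' (· ∈ L)) w m) := by
      intro e e' hee; rw [block_congr hee]
    have hm1 := pr_and_eq_mul (s := s) hn' L hin fun e e' hee =>
      offHypothesis_congr (w := w) (k := h + r) hee
    have hm2 := pr_and_eq_mul (s := s) (Q := fun e => OffHypothesis L w (h + r) e ∧ ¬ OffCore L e)
      hn' L hin fun e e' hee => by rw [offHypothesis_congr hee, offCore_congr hee]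
    rw [hm1, hm2, mul_left_comm]
    exact mul_le_mul_of_nonneg_left hoff pr_nonneg
  have hgood := card_hasMaxSimple_sub_le (w := w) s hr hδ hzero hlarge hsmall hcard hcore
    (E.filter fun e => OffCore L e) (by rw [hE, Finset.filter_filter])
  have h1 := Finset.card_filter_add_card_filter_not (s := E) (fun e => OffCore L e)
  have h2 := Finset.card_filter_add_card_filter_not
    (s := E.filter fun e => HasMaxSimple (outMatrix e) h) (fun e => OffCore L e)
  have h3 : ((E.filter fun e => HasMaxSimple (outMatrix e) h).filter fun e => ¬ OffCore L e).card
      ≤ (E.filter fun e => ¬ OffCore L e).card := by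
    rw [Finset.filter_filter]
    refine Finset.card_le_card fun e he => ?_
    rw [Finset.mem_filter] at he ⊢
    exact ⟨he.1, he.2.2⟩
  rw [Finset.filter_comm] at h2
  have hp := (pStar_pos h r m hr).le
  have h1' : ((E.filter fun e => OffCore L e).card : ℝ)
      + (E.filter fun e => ¬ OffCore L e).card = E.card := by exact_mod_cast h1
  have h2' : (((E.filter fun e => OffCore L e).filter
      fun e => HasMaxSimple (outMatrix e) h).card : ℝ)
      + ((E.filter fun e => HasMaxSimple (outMatrix e) h).filter fun e => ¬ OffCore L e).card
      = (E.filter fun e => HasMaxSimple (outMatrix e) h).card := by exact_mod_cast h2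
  have h3' : (((E.filter fun e => HasMaxSimple (outMatrix e) h).filter
      fun e => ¬ OffCore L e).card : ℝ) ≤ (E.filter fun e => ¬ OffCore L e).card := by
    exact_mod_cast h3
  have h4 : (0 : ℝ) ≤ ((E.filter fun e => HasMaxSimple (outMatrix e) h).filter
      fun e => ¬ OffCore L e).card := by positivity
  have h5 : 2 ^ (m * (h + r)) * δ * ((E.filter fun e => OffCore L e).card : ℝ)
      ≤ 2 ^ (m * (h + r)) * δ * E.card := by
    gcongr
    exact Finset.filter_subset _ _
  rw [abs_le] at hgood ⊢
  have h6 : pStar h r m * ((E.filter fun e => ¬ OffCore L e).card : ℝ)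
      ≤ pStar h r m * (θ * E.card) := mul_le_mul_of_nonneg_left hbad hp
  have h7 : 0 ≤ pStar h r m * ((E.filter fun e => ¬ OffCore L e).card : ℝ) := by positivity
  rw [← h1', ← h2']
  rw [← h1'] at h5 h6 hbad
  constructor <;> nlinarith [hgood.1, hgood.2]

end OffColumns

/-! ### Size comparisons for growing `n`, uniform in |L|. -/

section Numerics

lemma eventually_not_isLargeSize : ∀ᶠ N : ℕ in atTop, ∀ c : ℕ, 8 * c ≤ N → ¬ IsLargeSize N c := by
  filter_upwards [eventually_log_le (c := 1 / 16) (by norm_num) (a := 1) (by norm_num),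
    eventually_ge_atTop 1] with N hlog hN c hc hl
  have hN0 : (1 : ℝ) ≤ N := by exact_mod_cast hN
  have hc' : 8 * (c : ℝ) ≤ N := by exact_mod_cast hc
  rw [Real.rpow_one] at hlog
  unfold IsLargeSize at hl
  have h1 : Real.sqrt (N * Real.log N) ≤ N / 4 := by
    rw [Real.sqrt_le_left (by positivity)]
    nlinarith
  have h2 := (abs_le.1 (hl.trans h1)).1
  linarith

variable {ω : ℕ → ℕ}

lemma eventually_le_sqrt (hω : (fun n => (ω n : ℝ)) =o[atTop] (fun n => Real.sqrt (n : ℝ)))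
    (m : ℕ) {c : ℝ} (hc : 0 < c) : ∀ᶠ n : ℕ in atTop, (m * ω n : ℝ) ≤ c * Real.sqrt n := by
  have h := hω.bound (show 0 < c / (m + 1) by positivity)
  filter_upwards [h] with n hn
  rw [Real.norm_of_nonneg (by positivity), Real.norm_of_nonneg (by positivity)] at hn
  calc (m * ω n : ℝ) ≤ (m + 1) * (c / (m + 1) * Real.sqrt n) := by
        gcongr; linarith
    _ = c * Real.sqrt n := by field_simp

lemma eventually_mul_le (hω : (fun n => (ω n : ℝ)) =o[atTop] (fun n => Real.sqrt (n : ℝ)))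
    (m : ℕ) {c : ℝ} (hc : 0 < c) : ∀ᶠ n : ℕ in atTop, (m * ω n : ℝ) ≤ c * n := by
  filter_upwards [eventually_le_sqrt hω m hc, eventually_ge_atTop 1] with n hn h1
  refine hn.trans ?_
  gcongr
  rw [Real.sqrt_le_left (by positivity)]
  have : (1 : ℝ) ≤ n := by exact_mod_cast h1
  nlinarith

/-- As `m * ω n ≤ n / 2` eventually, `n - l` tends to infinity uniformly in the admissible `l`. This
is how limits in N = n - |L| become uniform in L. -/
lemma eventually_forall_sub (hω : (fun n => (ω n : ℝ)) =o[atTop] (fun n => Real.sqrt (n : ℝ)))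
    (m : ℕ) {X : ℕ → Prop} (hX : ∀ᶠ N in atTop, X N) :
    ∀ᶠ n in atTop, ∀ l, l ≤ m * ω n → X (n - l) := by
  obtain ⟨N₀, hN₀⟩ := eventually_atTop.1 hX
  filter_upwards [eventually_mul_le hω m (show (0 : ℝ) < 1 / 2 by norm_num),
    eventually_ge_atTop (2 * N₀)] with n hn h1 l hl
  apply hN₀
  have h2 : (l : ℝ) ≤ 1 / 2 * n := le_trans (by exact_mod_cast hl) hn
  have h3 : 2 * l ≤ n := by
    have : (2 * l : ℝ) ≤ n := by linarith
    exact_mod_cast this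
  omega

/-- A size close to half of `n - l` is large for `n`, even after a change by at most `l`. -/
lemma eventually_isLargeSize_of_isCore
    (hω : (fun n => (ω n : ℝ)) =o[atTop] (fun n => Real.sqrt (n : ℝ))) (m : ℕ) :
    ∀ᶠ n in atTop, ∀ l, l ≤ m * ω n → ∀ c, IsCore (n - l) c → ∀ c', c ≤ c' → c' ≤ c + l →
      IsLargeSize n c' := by
  filter_upwards [eventually_le_sqrt hω m (show (0 : ℝ) < 1 / 5 by norm_num),
    eventually_mul_le hω m (show (0 : ℝ) < 1 / 2 by norm_num),
    eventually_ge_atTop 3] with n hn hn2 h1 l hl c hc c' hc1 hc2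
  have hn3 : (3 : ℝ) ≤ n := by exact_mod_cast h1
  have hlω : (l : ℝ) ≤ m * ω n := by exact_mod_cast hl
  have hln : l ≤ n := by
    have : (l : ℝ) ≤ n := by linarith
    exact_mod_cast this
  have hlog : 1 ≤ Real.log n := by
    rw [Real.le_log_iff_exp_le (by linarith)]
    linarith [Real.exp_one_lt_d9]
  -- The deviation from half changes by at most l / 2 ≤ √n / 10 ≤ √(n log n) / 10, which is the gap
  -- between the factors 9/10 and 1. This is where ω = o(√n) is used in full.
  have hsq : Real.sqrt n ≤ Real.sqrt (n * Real.log n) := Real.sqrt_le_sqrt (by nlinarith)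
  unfold IsCore at hc
  unfold IsLargeSize
  have hcast : ((n - l : ℕ) : ℝ) = n - l := by push_cast [hln]; ring
  rw [hcast] at hc
  have hmono : Real.sqrt (((n : ℝ) - l) * Real.log ((n : ℝ) - l))
      ≤ Real.sqrt (n * Real.log n) := by
    have hl0 : (0 : ℝ) ≤ l := by positivity
    have hpos : (0 : ℝ) < n - l := by linarith
    refine Real.sqrt_le_sqrt ?_
    calc ((n : ℝ) - l) * Real.log ((n : ℝ) - l) ≤ (n - l) * Real.log n := by
          gcongr; linarith
      _ ≤ n * Real.log n := by gcongr; linarith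
  have hc1' : (c : ℝ) ≤ c' := by exact_mod_cast hc1
  have hc2' : (c' : ℝ) ≤ c + l := by exact_mod_cast hc2
  rw [abs_le] at hc ⊢
  constructor <;> linarith [hc.1, hc.2]

end Numerics

/-! ### Conditional probabilities as quotients of cardinalities. -/

section Conditioning

open MeasureTheory

lemma choices_eq (s : Sampling) (n : ℕ) : s.choices n = ↑(configs (Fin n) s) := by
  ext e
  cases s <;> simp [Sampling.choices, configs, pairs]

open Classical in
lemma law_cond_real (s : Sampling) (n : ℕ) (A B : (Fin n → Fin n × Fin n) → Prop) :
    ((s.law n)[|{e | A e}]).real {e | B e}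
      = ((((configs (Fin n) s).filter A).filter B).card : ℝ)
        / ((configs (Fin n) s).filter A).card := by
  have h1 : (s.law n)[|{e | A e}] = uniformOn ↑((configs (Fin n) s).filter A) := by
    have hset : s.choices n ∩ {e | A e} = ↑((configs (Fin n) s).filter A) := by
      rw [choices_eq]; ext e; simp
    rw [← hset, Sampling.law, uniformOn, uniformOn]
    exact cond_cond_eq_cond_inter' (Set.toFinite _).measurableSet (Set.toFinite _).measurableSet
      (Measure.count_apply_lt_top.2 (Set.toFinite _)).ne
  have h2 : {e | B e} = ((Finset.univ.filter B : Finset (Fin n → Fin n × Fin n)) : Set _) := by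
    ext e; simp
  rw [h1, h2, measureReal_def, uniformOn_apply_finset]
  rw [ENNReal.toReal_div, ENNReal.toReal_natCast, ENNReal.toReal_natCast]
  congr 3
  ext e
  simp

open Classical in
lemma exists_of_law_ne_zero (s : Sampling) (n : ℕ) (A : (Fin n → Fin n × Fin n) → Prop)
    (h : s.law n {e | A e} ≠ 0) : ((configs (Fin n) s).filter A).Nonempty := by
  rw [Sampling.law, Ne, uniformOn_eq_zero_iff (Set.toFinite _), choices_eq, ← Ne,
    ← Set.nonempty_iff_ne_empty] at h
  obtain ⟨e, he, hA⟩ := h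
  exact ⟨e, Finset.mem_filter.2 ⟨he, hA⟩⟩

end Conditioning

/-! ### Choice of the constants and conclusion. -/

theorem theorem5 (s : Sampling) (ω : ℕ → ℕ) (hω : Tendsto ω atTop atTop)
    (hω_slow : (fun n => (ω n : ℝ)) =o[atTop] (fun n => Real.sqrt (n : ℝ)))
    (h r m : ℕ) (hr : r ≤ m) :
    ∀ ε : ℝ, 0 < ε → ∀ᶠ n : ℕ in atTop, ∀ L : Finset (Fin n),
      s.law n {e | BlockHypothesis (outMatrix e) L (ω n) m (h + r)} ≠ 0 →
      |((s.law n)[|{e | BlockHypothesis (outMatrix e) L (ω n) m (h + r)}]).real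
          {e | HasMaxSimple (outMatrix e) h} / pStar h r m - 1| ≤ ε := by
  classical
  intro ε hε
  have hp := pStar_pos h r m hr
  set p := pStar h r m with hpdef
  obtain ⟨c, hc, hgood⟩ := exists_le_pr_good s (h + r)
  -- the error terms
  set θ : ℝ := ε * p / (2 * (1 + p)) with hθ
  have hθ0 : 0 < θ := by positivity
  -- Both the first moment error and the cancellation error are at most `η`, so their sum divided by
  -- `c` is `θ`; then `(1 + p) * θ` is half of `ε * p`, and `D` takes care of the Fourier half.
  set η : ℝ := θ * c / 2 with hη
  have hη0 : 0 < η := by positivity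
  obtain ⟨w₀, hint⟩ := pr_intermediate_le s hη0
  obtain ⟨D, hD⟩ : ∃ D : ℕ, (2 : ℝ) ^ (m * (h + r)) * (1 / 2 ^ (D + 2)) ≤ ε * p / 2 := by
    obtain ⟨D, hD⟩ := exists_pow_lt_of_lt_one
      (show 0 < ε * p / 2 / 2 ^ (m * (h + r)) by positivity) (show (1 / 2 : ℝ) < 1 by norm_num)
    refine ⟨D, ?_⟩
    rw [lt_div_iff₀ (by positivity), one_div, inv_pow] at hD
    refine le_trans ?_ hD.le
    rw [mul_comm, one_div]
    gcongr
    · norm_num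
    · omega
  have hlogη : 0 < Real.log (1 + η) := Real.log_pos (by linarith)
  filter_upwards [eventually_forall_sub hω_slow m hgood, eventually_forall_sub hω_slow m hint,
    eventually_forall_sub hω_slow m (eventually_core D),
    eventually_forall_sub hω_slow m (eventually_core 0),
    eventually_forall_sub hω_slow m eventually_not_isLargeSize,
    eventually_forall_sub hω_slow m (eventually_ge_atTop 6),
    eventually_not_isLargeSize,
    eventually_isLargeSize_of_isCore hω_slow m,
    eventually_mul_le hω_slow m (show (0 : ℝ) < 1 / 8 by norm_num),
    eventually_mul_le hω_slow 1 (show (0 : ℝ) < 1 / 8 by norm_num),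
    eventually_mul_le hω_slow m (show (0 : ℝ) < Real.log (1 + η) / 4 by positivity),
    hω.eventually_ge_atTop w₀, eventually_ge_atTop 3]
    with n hgood hint hcoreD hcore0 hnotlarge' hge hnotlarge hlarge hsmall hωn hexp hw₀ hn L hL
  set E := (configs (Fin n) s).filter fun e => BlockHypothesis (outMatrix e) L (ω n) m (h + r)
    with hE
  have hEne : E.Nonempty := exists_of_law_ne_zero s n _ hL
  have hLm : L.card ≤ m * ω n := by
    obtain ⟨e, he⟩ := hEne
    rw [hE, Finset.mem_filter, blockHypothesis_iff] at he
    have := he.2.1.card_le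
    rwa [Fintype.card_coe] at this
  have hN : Fintype.card {i // i ∉ L} = n - L.card := by
    rw [Fintype.card_subtype_compl, Fintype.card_fin, Fintype.card_coe]
  have hL8 : 8 * L.card ≤ n := by
    have h1 : (L.card : ℝ) ≤ m * ω n := by exact_mod_cast hLm
    have h2 : (8 * L.card : ℝ) ≤ n := by linarith
    exact_mod_cast h2
  have hN6 : 6 ≤ Fintype.card {i // i ∉ L} := by rw [hN]; exact hge _ hLm
  have hNn : (7 / 8 : ℝ) * n ≤ Fintype.card {i // i ∉ L} := by
    rw [hN, Nat.cast_sub (by omega)]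
    have : (8 * L.card : ℝ) ≤ n := by exact_mod_cast hL8
    linarith
  have hn0 : (0 : ℝ) < n := by
    have : 0 < n := by omega
    exact_mod_cast this
  have hoff := pr_offHypothesis_not_offCore_le (L := L) (w := ω n) (k := h + r) s hn (by omega) hc
    (hgood _ hLm {i // i ∉ L} hN) (hint _ hLm {i // i ∉ L} hN) (η := η) ?_
    (by rw [hN]; exact hnotlarge' _ hLm 0 (by omega)) ?_ hw₀
  · have key := card_blockHypothesis_sub_le (L := L) (w := ω n) (δ := 1 / 2 ^ (D + 2)) s hr
      (by positivity) hn (by rw [hN]; exact hnotlarge' _ hLm 0 (by omega))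
      (by rw [hN]; exact hlarge _ hLm) (fun c hc => hnotlarge c (by omega)) (by omega)
      (fun c hcc => ?_) hoff E hE
    · have hEpos : (0 : ℝ) < E.card := by exact_mod_cast hEne.card_pos
      rw [law_cond_real, ← hE]
      have h1 : (η + η) / c = θ := by rw [hη]; field_simp; ring
      have h2 : (1 + p) * θ = ε * p / 2 := by rw [hθ]; field_simp
      rw [h1, ← hpdef, h2] at key
      have h3 : ((E.filter fun e => HasMaxSimple (outMatrix e) h).card : ℝ) / E.card / p - 1
          = (((E.filter fun e => HasMaxSimple (outMatrix e) h).card : ℝ) - E.card * p)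
            / (E.card * p) := by
        field_simp
      rw [h3, abs_div, abs_of_pos (mul_pos hEpos hp), div_le_iff₀ (mul_pos hEpos hp)]
      refine key.trans ?_
      calc _ ≤ (ε * p / 2 + ε * p / 2) * E.card := by gcongr
        _ = ε * (E.card * p) := by ring
    · have h1 := hcoreD _ hLm c (hN ▸ hcc)
      rw [← hN] at h1
      rw [one_div, ← div_eq_inv_mul, le_div_iff₀ (by positivity), mul_comm]
      exact h1
  -- The exponent is at most 2|L| / N, which tends to zero because |L| ≤ mω = o(n).
  · have hT := half_sq_le_totalPairs s hN6
    have hNpos : (0 : ℝ) < Fintype.card {i // i ∉ L} := by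
      have : 0 < Fintype.card {i // i ∉ L} := by omega
      exact_mod_cast this
    have hTpos : (0 : ℝ) < totalPairs s (Fintype.card {i // i ∉ L}) :=
      lt_of_lt_of_le (by positivity) hT
    have h1 : (L.card : ℝ) ≤ Real.log (1 + η) / 4 * n := le_trans (by exact_mod_cast hLm) hexp
    have h2 : (Fintype.card {i // i ∉ L} : ℝ)
        * (L.card / totalPairs s (Fintype.card {i // i ∉ L})) ≤ Real.log (1 + η) := by
      rw [← mul_div_assoc, div_le_iff₀ hTpos]
      calc (Fintype.card {i // i ∉ L} : ℝ) * L.card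
          ≤ Fintype.card {i // i ∉ L} * (Real.log (1 + η)
            * (Fintype.card {i // i ∉ L} / 2)) := by
            gcongr
            nlinarith
        _ = Real.log (1 + η) * ((Fintype.card {i // i ∉ L} : ℝ) ^ 2 / 2) := by ring
        _ ≤ _ := by gcongr
    have h3 := Real.exp_le_exp.2 h2
    rw [Real.exp_log (by linarith)] at h3
    linarith
  · intro c hcc
    have h1 := hcore0 _ hLm c (hN ▸ hcc)
    rw [← hN] at h1
    rw [zero_add] at h1
    -- Core sizes are at least 3N / 8 with N ≥ 7n / 8, well above ω(n) ≤ n / 8.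
    have h2 := (abs_le.1 ((le_div_iff₀' (by norm_num)).2 h1)).2
    have h3 : ((ω n : ℕ) : ℝ) < c := by
      push_cast at hωn
      linarith
    exact_mod_cast h3
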